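/- Let $1\le \ell\le m$ and $N\ge 0$ be integers. Let $\omega_{FS}=\frac{\sqrt{-1}}{2\pi}\partial\bar\partial\log|w|^2$ be the Fubini--Study form on $\mathbb{CP}^m$, let $\mathrm{Vol}_k$ denote the Riemannian $k$-volume on $\mathbb{CP}^m$ for the Kähler metric with Kähler form $\omega_{FS}$, and let $$P_i(z_0,\dots,z_m)=\sum_{j_0+\cdots+j_m=N}\frac{a_{i,J}}{\sqrt{j_0!\cdots j_m!}}\,z_0^{j_0}\cdots z_m^{j_m}\qquad(1\le i\le \ell)$$ be independent random $\mathrm{SU}(m+1)$ polynomials of degree $N$, i.e. the coefficients $a_{i,J}$ are independent complex Gaussian random variables, each with density $\frac1\pi e^{-|a|^2}$ with respect to Lebesgue measure on $\mathbb C$. Let $Z_{\mathcal P}$ be the current of integration over the random set $\{z\in\mathbb{CP}^m : P_1(z)=\cdots=P_\ell(z)=0\}$, regarded with its complex orientation as an $(m-\ell)$-dimensional analytic set (which it is almost surely). Then $$E(Z_{\mathcal P})=N^\ell\,\omega_{FS}^\ell ,$$ that is, for every smooth $(m-\ell,m-\ell)$-form $\varphi$ on $\mathbb{CP}^m$ the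 random variable $(Z_{\mathcal P},\varphi)$ is integrable and $$E\big[(Z_{\mathcal P},\varphi)\big]=N^\ell\int_{\mathbb{CP}^m}\omega_{FS}^\ell\wedge\varphi .$$ In particular, for every open set $U\subset\mathbb{CP}^m$, $$E\big(\mathrm{Vol}_{2m-2\ell}\{z\in U : P_1(z)=\cdots=P_\ell(z)=0\}\big)=\frac{m!}{(m-\ell)!}\,N^\ell\,\mathrm{Vol}_{2m}(U).$$ -/

import Mathlib

open MeasureTheory ProbabilityTheory
open scoped ENNReal ContDiff LinearAlgebra.Projectivization

noncomputable section

namespace SUPoly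

/-! ### Complex projective space with its Fubini-Study distance -/

/-- `ℂ^{m+1}` with its standard Hermitian norm. -/
abbrev V (m : ℕ) : Type := EuclideanSpace ℂ (Fin (m + 1))

/-- Complex projective space `ℂℙ^m`. -/
def CP (m : ℕ) : Type := ℙ ℂ (V m)

/-- A nonzero vector of homogeneous coordinates of the point `p`. -/
def CP.rep {m : ℕ} (p : CP m) : V m := Projectivization.rep p

/-- The point `[w]` of `ℂℙ^m` with homogeneous coordinates `w`. -/
def CP.mk {m : ℕ} (w : V m) (hw : w ≠ 0) : CP m := Projectivization.mk ℂ w hw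

theorem CP.rep_ne_zero {m : ℕ} (p : CP m) : p.rep ≠ 0 := Projectivization.rep_nonzero p

/-- The Hermitian angle `arccos (|⟨v, w⟩| / (|v| |w|))` between two vectors. -/
def hermitianAngle {m : ℕ} (v w : V m) : ℝ :=
  Real.arccos (‖inner ℂ v w‖ / (‖v‖ * ‖w‖))

theorem hermitianAngle_self {m : ℕ} {v : V m} (hv : v ≠ 0) : hermitianAngle v v = 0 := by
  have h : ‖v‖ ≠ 0 := norm_ne_zero_iff.mpr hv
  have h2 : ‖inner ℂ v v‖ = ‖v‖ * ‖v‖ := by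
    rw [inner_self_eq_norm_sq_to_K]; simp [sq]
  rw [hermitianAngle, h2, div_self (mul_ne_zero h h), Real.arccos_one]

theorem hermitianAngle_comm {m : ℕ} (v w : V m) : hermitianAngle v w = hermitianAngle w v := by
  rw [hermitianAngle, hermitianAngle, norm_inner_symm, mul_comm ‖v‖]

/-- Every `v` can be rotated by a phase so that `⟨v, w⟩` becomes its absolute value. -/
theorem exists_phase (c : ℂ) : ∃ t : ℂ, ‖t‖ = 1 ∧ t * c = (‖c‖ : ℂ) := by
  by_cases hc : c = 0
  · exact ⟨1, by simp, by simp [hc]⟩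
  · have h : (‖c‖ : ℂ) ≠ 0 := by exact_mod_cast norm_ne_zero_iff.mpr hc
    refine ⟨(‖c‖ : ℂ) / c, ?_, div_mul_cancel₀ _ hc⟩
    rw [norm_div, Complex.norm_real, norm_norm, div_self (norm_ne_zero_iff.mpr hc)]

theorem hermitianAngle_triangle {m : ℕ} (u v w : V m) :
    hermitianAngle u w ≤ hermitianAngle u v + hermitianAngle v w := by
  let _ : InnerProductSpace ℝ (V m) := InnerProductSpace.rclikeToReal ℂ (V m)
  have key : ∀ x y : V m, InnerProductGeometry.angle x y =
      Real.arccos ((inner ℂ x y).re / (‖x‖ * ‖y‖)) := fun x y => rfl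
  obtain ⟨s, hs, hs'⟩ := exists_phase (inner ℂ v u)
  obtain ⟨t, ht, ht'⟩ := exists_phase (inner ℂ v w)
  have h := InnerProductGeometry.angle_le_angle_add_angle (s • u) v (t • w)
  have h1 : InnerProductGeometry.angle (s • u) v = hermitianAngle u v := by
    rw [InnerProductGeometry.angle_comm, hermitianAngle_comm, key, inner_smul_right, hs',
      norm_smul, hs, hermitianAngle]
    simp
  have h2 : InnerProductGeometry.angle v (t • w) = hermitianAngle v w := by
    rw [key, inner_smul_right, ht', norm_smul, ht, hermitianAngle]
    simp
  have h3 : hermitianAngle u w ≤ InnerProductGeometry.angle (s • u) (t • w) := by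
    rw [key, norm_smul, norm_smul, hs, ht, one_mul, one_mul, hermitianAngle]
    refine Real.arccos_le_arccos (div_le_div_of_nonneg_right ?_ (by positivity))
    refine (Complex.re_le_norm _).trans (le_of_eq ?_)
    rw [inner_smul_left, inner_smul_right, norm_mul, norm_mul, ht, RCLike.norm_conj, hs]
    simp
  linarith

/-- The Riemannian distance of `(ℂℙ^m, ω_FS)`, where `ω_FS = (i/2π) ∂∂̄ log |w|²`.
The Kähler metric `g(u, v) = ω_FS(u, iv)` has the value `|v|² / (π |w|²)` on a tangent vector
at `[w]` with horizontal lift `v ⊥ w`, that is, it is `1/π` times the quotient metric of the unit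
sphere, whose distance is the Hermitian angle. -/
instance instMetricSpaceCP (m : ℕ) : MetricSpace (CP m) where
  dist p q := hermitianAngle p.rep q.rep / √Real.pi
  dist_self p := by simp [hermitianAngle_self p.rep_ne_zero]
  dist_comm p q := by rw [hermitianAngle_comm]
  dist_triangle p q r := by
    rw [← add_div]
    exact div_le_div_of_nonneg_right (hermitianAngle_triangle _ _ _) (Real.sqrt_nonneg _)
  eq_of_dist_eq_zero {p q} h := by
    have hpi : √Real.pi ≠ 0 := (Real.sqrt_pos.mpr Real.pi_pos).ne'
    have h0 : hermitianAngle p.rep q.rep = 0 := by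
      rcases div_eq_zero_iff.mp h with h | h
      · exact h
      · exact absurd h hpi
    have hp : 0 < ‖p.rep‖ := norm_pos_iff.mpr p.rep_ne_zero
    have hq : 0 < ‖q.rep‖ := norm_pos_iff.mpr q.rep_ne_zero
    rw [hermitianAngle, Real.arccos_eq_zero, le_div_iff₀ (mul_pos hp hq), one_mul] at h0
    have h1 := le_antisymm (norm_inner_le_norm (𝕜 := ℂ) p.rep q.rep) h0
    obtain ⟨r, -, hr⟩ := (norm_inner_eq_norm_iff p.rep_ne_zero q.rep_ne_zero).mp h1
    have h2 : Projectivization.mk ℂ q.rep q.rep_ne_zero = Projectivization.mk ℂ p.rep p.rep_ne_zero :=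
      (Projectivization.mk_eq_mk_iff' ℂ _ _ _ _).mpr ⟨r, hr.symm⟩
    exact ((Projectivization.mk_rep q).symm.trans (h2.trans (Projectivization.mk_rep p))).symm

instance instMeasurableSpaceCP (m : ℕ) : MeasurableSpace (CP m) := borel (CP m)

instance instBorelSpaceCP (m : ℕ) : BorelSpace (CP m) := ⟨rfl⟩

/-- Riemannian `d`-volume in `(ℂℙ^m, ω_FS)`: the `d`-dimensional Hausdorff measure of the
Fubini-Study distance, normalized to agree with Lebesgue measure on `ℝ^d`. -/
def vol (m d : ℕ) : Measure (CP m) := Measure.euclideanHausdorffMeasure d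

/-! ### Differential forms on projective space

A form on `ℂℙ^m` is given by its pullback to `ℂ^{m+1} ∖ {0}`. -/

/-- Complex-valued `n`-forms on `ℂ^{m+1}`; only the values away from `0` matter. -/
abbrev Form (m n : ℕ) : Type := V m → (V m) [⋀^Fin n]→ₗ[ℝ] ℂ

/-- Wedge product of alternating forms, in the convention `(α ∧ β)(u, v) = α u β v - α v β u`
for one-forms. -/
def wedgeAt {E : Type*} [AddCommGroup E] [Module ℝ E] {p q n : ℕ} (h : p + q = n)
    (α : E [⋀^Fin p]→ₗ[ℝ] ℂ) (β : E [⋀^Fin q]→ₗ[ℝ] ℂ) : E [⋀^Fin n]→ₗ[ℝ] ℂ :=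
  ((LinearMap.mul' ℝ ℂ).compAlternatingMap (α.domCoprod β)).domDomCongr
    (finSumFinEquiv.trans (finCongr h))

/-- Wedge product of differential forms. -/
def wedge {m p q n : ℕ} (h : p + q = n) (α : Form m p) (β : Form m q) : Form m n :=
  fun w => wedgeAt h (α w) (β w)

/-- The `ℓ`-fold wedge power of a two-form. -/
def wedgePow {m : ℕ} (α : Form m 2) : (ℓ : ℕ) → Form m (2 * ℓ)
  | 0 => fun _ => AlternatingMap.constOfIsEmpty ℝ (V m) (Fin 0) 1
  | ℓ + 1 => wedge (by ring) α (wedgePow α ℓ)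

/-- Multiplication by `i`, as a real-linear map. -/
def mulI (m : ℕ) : V m →L[ℝ] V m :=
  (Complex.I • ContinuousLinearMap.id ℂ (V m)).restrictScalars ℝ

/-- The one-form `d^c f = (i/4π) (∂̄ - ∂) f`, i.e. `v ↦ -(1/4π) df(iv)`. -/
def dC {m : ℕ} (f : V m → ℂ) (w : V m) : (V m) [⋀^Fin 1]→L[ℝ] ℂ :=
  (-(1 / (4 * Real.pi)) : ℝ) •
    ContinuousAlternatingMap.ofSubsingleton ℝ (V m) ℂ (0 : Fin 1) ((fderiv ℝ f w).comp (mulI m))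

/-- The Fubini-Study form `ω_FS = (i/2π) ∂∂̄ log |w|² = d d^c log |w|²`. -/
def fubiniStudy (m : ℕ) : Form m 2 := fun w =>
  (extDeriv (dC fun z : V m => ((Real.log (‖z‖ ^ 2) : ℝ) : ℂ)) w).toAlternatingMap

/-- Smooth `(k,k)`-forms on `ℂℙ^m`, given by their pullbacks to `ℂ^{m+1} ∖ {0}`: these are the
smooth forms there that are horizontal (they vanish as soon as one argument is tangent to the fibre
of `w ↦ [w]`) and invariant under `w ↦ c w` for `c ∈ ℂ ∖ {0}`. A `(p,q)`-form is one that is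
multiplied by `c^p c̄^q` when all its arguments are multiplied by `c`. -/
structure TestForm (m k : ℕ) where
  toFun : V m → (V m) [⋀^Fin (2 * k)]→L[ℝ] ℂ
  smooth : ContDiffOn ℝ ∞ toFun {0}ᶜ
  horizontal : ∀ w : V m, w ≠ 0 → ∀ v : Fin (2 * k) → V m, ∀ i, ∀ c : ℂ, v i = c • w →
    toFun w v = 0
  invariant : ∀ w : V m, w ≠ 0 → ∀ c : ℂ, c ≠ 0 → ∀ v : Fin (2 * k) → V m,
    toFun (c • w) (fun i => c • v i) = toFun w v
  bidegree : ∀ w : V m, w ≠ 0 → ∀ c : ℂ, ∀ v : Fin (2 * k) → V m,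
    toFun w (fun i => c • v i) = c ^ k * (starRingEnd ℂ c) ^ k * toFun w v

/-- The differential form underlying a test form. -/
def TestForm.form {m k : ℕ} (φ : TestForm m k) : Form m (2 * k) :=
  fun w => (φ.toFun w).toAlternatingMap

/-! ### Integration over complex submanifolds and analytic subsets -/

/-- The cone over `Z`, i.e. its preimage under `w ↦ [w]`. -/
def coneOver {m : ℕ} (Z : Set (CP m)) : Set (V m) := {w | ∃ hw : w ≠ 0, CP.mk w hw ∈ Z}

/-- The complex tangent space of `Z` at `p`, lifted to the orthogonal complement of `p.rep`. -/
def tangentAt {m : ℕ} (Z : Set (CP m)) (p : CP m) : Submodule ℂ (V m) :=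
  Submodule.span ℂ (tangentConeAt ℂ (coneOver Z) p.rep) ⊓ (Submodule.span ℂ {p.rep})ᗮ

/-- The real frame `(e₀, i e₀, e₁, i e₁, …)`, which is positive for the complex orientation. -/
def realFrame {m k : ℕ} (e : Fin k → V m) (j : Fin (2 * k)) : V m :=
  Complex.I ^ (j.val % 2) • e ⟨j.val / 2, Nat.div_lt_of_lt_mul j.isLt⟩

open Classical in
/-- The value at `p` of a `2k`-form on the positively oriented unit simple `2k`-vector of the
tangent space of `Z`: if `e` is a unitary basis of the lifted tangent space in the Hermitian metric
of `ℂ^{m+1}`, then the `√π |w| e_j` form a unitary basis in the Fubini-Study metric at `[w]`. The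
value does not depend on the basis. It is set to zero where the tangent space is not of complex
dimension `k`, which for an analytic set of pure dimension `k` happens at most at the singular
points, a null set for the `2k`-volume. -/
def density {m k : ℕ} (Z : Set (CP m)) (ψ : Form m (2 * k)) (p : CP m) : ℂ :=
  if h : ∃ e : Fin k → V m, Orthonormal ℂ e ∧ Submodule.span ℂ (Set.range e) = tangentAt Z p then
    ψ p.rep (realFrame fun j => ((√Real.pi * ‖p.rep‖ : ℝ) : ℂ) • h.choose j)
  else 0

/-- The integral of a `2k`-form over the `k`-dimensional complex analytic set `Z`, with the complex
orientation. As a function of the test form, this is the current of integration over `Z`. -/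
def integrate {m k : ℕ} (Z : Set (CP m)) (ψ : Form m (2 * k)) : ℂ :=
  ∫ p in Z, density Z ψ p ∂(vol m (2 * k))

/-! ### Random `SU(m+1)` polynomials -/

/-- Multi-indices `J = (j₀, …, j_m)` with `j₀ + ⋯ + j_m = N`. -/
abbrev MultiIndex (m N : ℕ) : Type := ↥(Finset.Nat.antidiagonalTuple (m + 1) N)

/-- The homogeneous polynomial `∑_{|J| = N} a_J / √(j₀! ⋯ j_m!) z^J`. -/
def suPolynomial {m N : ℕ} (a : MultiIndex m N → ℂ) : MvPolynomial (Fin (m + 1)) ℂ :=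
  ∑ J : MultiIndex m N,
    MvPolynomial.C (a J / ((√(∏ i, (Nat.factorial (J.val i) : ℝ)) : ℝ) : ℂ)) *
      ∏ i, MvPolynomial.X i ^ J.val i

/-- The standard complex Gaussian measure `π⁻¹ e^{-|z|²} dz` on `ℂ`. -/
def complexGaussian : Measure ℂ :=
  (volume : Measure ℂ).withDensity fun z => ENNReal.ofReal (Real.pi⁻¹ * Real.exp (-‖z‖ ^ 2))

/-- The set of common zeros in `ℂℙ^m` of a tuple of homogeneous polynomials. -/
def zeroSet {m ℓ : ℕ} (P : Fin ℓ → MvPolynomial (Fin (m + 1)) ℂ) : Set (CP m) :=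
  {p | ∀ i, MvPolynomial.eval (fun j => p.rep j) (P i) = 0}

/-- The common zero set of the polynomials `P_i = ∑_{|J| = N} a_{i,J}(x) / √(j₀! ⋯ j_m!) z^J` with
random coefficients `a_{i,J}`, at the outcome `x`. -/
def randomZeroSet {Ω : Type*} {m ℓ N : ℕ} (a : Fin ℓ → MultiIndex m N → Ω → ℂ) (x : Ω) :
    Set (CP m) :=
  zeroSet fun i => suPolynomial fun J => a i J x

end SUPoly

end

/-! In the affine chart `w_i = 1` the monomial `w_i^N` is constant, so each equation can be solved
for one coefficient: it reads `y_l = ∑ b_{l,J} r_J(z)`, with `y_l` the coefficient of `w_i^N` and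
`b_l` the remaining ones (`eval_suPolynomial_chartVec`). The zero set is thus the level set of a map
`g(b, ·)` at the value `y`. Averaging integrals over level sets with respect to `(b, y)` is a coarea
problem, and `coarea_family` and `lintegral_coeffLaw` turn it into an integral over pairs `(b, z)`,
weighted by `fibreDensity` times a coarea factor. On a level set, the integrand of a test form `φ`
times that factor is the top-degree form `β_{Y_1} ∧ ⋯ ∧ β_{Y_ℓ} ∧ φ`, where `Y_l` is the
differential in `z` of the `l`-th row and `β_λ(u, v) = Im (conj (λ u) λ v)`
(`density_coeffZeroSet`).

For fixed `z` the weight is a product over the rows, so the average of this wedge is the wedge of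
the averages (`integral_wedgeProd`). A single average is a second moment of a Gaussian row
constrained to vanish at `z`; a linear substitution reduces it to the standard Gaussian
(`integral_rowDensity_mul`), and the reproducing kernel `⟨y, w⟩^N / N!` of the normalized monomials
(`sum_suMonomial`) evaluates it as `N ω_FS` (`integral_rowDensity_rowDeriv`,
`fubiniStudy_eq_hform`). This gives `N^ℓ ω_FS^ℓ`. For the volume one takes `φ = ω_FS^k` with `k = m
- ℓ`: by Wirtinger (`wedge_hform_pow`) `ω_FS^k` is `k!` times the volume of complex `k`-planes and
`ω_FS^m` is `m!` times the volume, whence the ratio `m!/k!` (`lintegral_fibreDensity`).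

Three analytic inputs make this rigorous. Volumes are Hausdorff measures of the Fubini-Study
distance, and are computed by an area formula for maps into a metric space that are differentiable
in the metric sense (`dist_mk_strict`, `area_formula`). Almost every system has only nondegenerate
zeros, because for `N ≥ 1` the degenerate systems lie in finitely many `C^1` images of hyperplanes
of the coefficient space (`ae_isRegular`). Integrability holds because the density of a test form is
bounded and the chosen pieces of the charts are bounded (`integrable_fibreWeight_mul`). -/

noncomputable section

namespace SUPoly

/-! ### Linear algebra of wedge products -/

section Wedge

variable {E : Type*} [AddCommGroup E] [Module ℝ E]

/-- The identification of the disjoint union of `Fin p` and `Fin q` with `Fin n` that is used in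
the wedge product. -/
def wedgeIdx {p q n : ℕ} (h : p + q = n) : Fin p ⊕ Fin q ≃ Fin n :=
  finSumFinEquiv.trans (finCongr h)

theorem mul'_summand {p q n : ℕ} (h : p + q = n) (α : E [⋀^Fin p]→ₗ[ℝ] ℂ)
    (β : E [⋀^Fin q]→ₗ[ℝ] ℂ) (v : Fin n → E) (σ : Equiv.Perm (Fin p ⊕ Fin q)) :
    LinearMap.mul' ℝ ℂ (AlternatingMap.domCoprod.summand α β (Quotient.mk'' σ) (v ∘ wedgeIdx h)) =
      ((Equiv.Perm.sign σ : ℤ) : ℂ) * (α (fun i => v (wedgeIdx h (σ (Sum.inl i)))) *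
          β (fun j => v (wedgeIdx h (σ (Sum.inr j))))) := by
  rw [AlternatingMap.domCoprod.summand_mk'']
  rcases Int.units_eq_one_or (Equiv.Perm.sign σ) with hσ | hσ
  · rw [hσ, one_smul]
    simp [MultilinearMap.domCoprod_apply]
  · rw [hσ, Units.neg_smul, one_smul]
    rw [_root_.neg_apply, map_neg]
    simp [MultilinearMap.domCoprod_apply]

theorem wedgeAt_apply_sum {p q n : ℕ} (h : p + q = n) (α : E [⋀^Fin p]→ₗ[ℝ] ℂ)
    (β : E [⋀^Fin q]→ₗ[ℝ] ℂ) (v : Fin n → E) :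
    wedgeAt h α β v = ∑ σ : Equiv.Perm.ModSumCongr (Fin p) (Fin q),
      LinearMap.mul' ℝ ℂ (AlternatingMap.domCoprod.summand α β σ (v ∘ wedgeIdx h)) := by
  rw [← map_sum, wedgeAt, AlternatingMap.domDomCongr_apply, LinearMap.compAlternatingMap_apply,
    AlternatingMap.domCoprod_apply, _root_.sum_apply]
  rfl

/-- Fixing representatives of the shuffles by `Quotient.out` gives a finite signed sum of products,
from which bilinearity, continuity and integrability are read off term by term. -/
theorem wedgeAt_apply {p q n : ℕ} (h : p + q = n) (α : E [⋀^Fin p]→ₗ[ℝ] ℂ)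
    (β : E [⋀^Fin q]→ₗ[ℝ] ℂ) (v : Fin n → E) :
    wedgeAt h α β v = ∑ σ : Equiv.Perm.ModSumCongr (Fin p) (Fin q),
      ((Equiv.Perm.sign (Quotient.out σ) : ℤ) : ℂ) *
        (α (fun i => v (wedgeIdx h (Quotient.out σ (Sum.inl i)))) *
          β (fun j => v (wedgeIdx h (Quotient.out σ (Sum.inr j))))) := by
  rw [wedgeAt_apply_sum]
  refine Finset.sum_congr rfl fun σ _ => ?_
  conv_lhs => rw [← Quotient.out_eq' σ]
  exact mul'_summand h α β v _

/-- `α` vanishes as soon as one of its arguments is `x`. -/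
def Kills {p : ℕ} (α : E [⋀^Fin p]→ₗ[ℝ] ℂ) (x : E) : Prop :=
  ∀ (v : Fin p → E) (i : Fin p), v i = x → α v = 0

theorem Kills.wedgeAt {p q n : ℕ} (h : p + q = n) {α : E [⋀^Fin p]→ₗ[ℝ] ℂ}
    {β : E [⋀^Fin q]→ₗ[ℝ] ℂ} {x : E} (hα : Kills α x) (hβ : Kills β x) :
    Kills (wedgeAt h α β) x := by
  intro v i hv
  rw [wedgeAt_apply]
  refine Finset.sum_eq_zero fun σ _ => ?_
  obtain ⟨s, hs⟩ : ∃ s, wedgeIdx h (Quotient.out σ s) = i :=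
    ⟨(Quotient.out σ)⁻¹ ((wedgeIdx h).symm i), by simp⟩
  rcases s with s | s
  · rw [hα _ s (by rw [hs, hv])]; simp
  · rw [hβ _ s (by rw [hs, hv])]; simp

/-- If `α` is killed by the last arguments, then only one shuffle contributes to `α ∧ β`. -/
theorem wedgeAt_eq_mul_of_kills {p q n : ℕ} (h : p + q = n) (α : E [⋀^Fin p]→ₗ[ℝ] ℂ)
    (β : E [⋀^Fin q]→ₗ[ℝ] ℂ) (v : Fin n → E)
    (hk : ∀ j, Kills α (v (wedgeIdx h (Sum.inr j)))) :
    wedgeAt h α β v =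
      α (fun i => v (wedgeIdx h (Sum.inl i))) * β (fun j => v (wedgeIdx h (Sum.inr j))) := by
  rw [wedgeAt_apply_sum]
  refine (Finset.sum_eq_single (Quotient.mk'' 1) ?_ (by simp)).trans ?_
  · intro σ _ hσ
    induction σ using Quotient.inductionOn' with | _ σ
    rw [mul'_summand]
    -- A coset other than that of the identity is represented by a permutation that does not
    -- preserve the left block, so some argument of `α` is one of the vectors killing it.
    have hex : ∃ i j, σ (Sum.inl i) = Sum.inr j := by
      by_contra hcon
      push Not at hcon
      apply hσ
      refine (Quotient.sound' ?_).symm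
      rw [QuotientGroup.leftRel_apply, inv_one, one_mul]
      apply Equiv.Perm.mem_sumCongrHom_range_of_perm_mapsTo_inl
      rintro _ ⟨i, rfl⟩
      rcases hs : σ (Sum.inl i) with s | s
      · exact ⟨s, rfl⟩
      · exact absurd hs (hcon i s)
    obtain ⟨i, j, hij⟩ := hex
    rw [hk j _ i (by rw [hij])]
    simp
  · rw [mul'_summand]
    simp

theorem wedgeAt_compLinearMap {F : Type*} [AddCommGroup F] [Module ℝ F] {p q n : ℕ}
    (h : p + q = n) (α : E [⋀^Fin p]→ₗ[ℝ] ℂ) (β : E [⋀^Fin q]→ₗ[ℝ] ℂ) (T : F →ₗ[ℝ] E) :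
    (wedgeAt h α β).compLinearMap T =
      wedgeAt h (α.compLinearMap T) (β.compLinearMap T) := by
  ext v
  simp only [AlternatingMap.compLinearMap_apply, wedgeAt_apply]

theorem alternatingMap_sum_apply {ι : Type*} {p : ℕ} (s : Finset ι)
    (α : ι → E [⋀^Fin p]→ₗ[ℝ] ℂ) (v : Fin p → E) : (∑ i ∈ s, α i) v = ∑ i ∈ s, α i v := by
  classical
  induction s using Finset.induction_on with
  | empty => simp
  | insert a s ha ih => rw [Finset.sum_insert ha, AlternatingMap.add_apply, ih,
      Finset.sum_insert ha]

theorem wedgeAt_sum {ι κ : Type*} {p q n : ℕ} (h : p + q = n) (s : Finset ι) (t : Finset κ)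
    (α : ι → E [⋀^Fin p]→ₗ[ℝ] ℂ) (β : κ → E [⋀^Fin q]→ₗ[ℝ] ℂ) :
    wedgeAt h (∑ i ∈ s, α i) (∑ j ∈ t, β j) = ∑ i ∈ s, ∑ j ∈ t, wedgeAt h (α i) (β j) := by
  ext v
  simp only [alternatingMap_sum_apply, wedgeAt_apply]
  simp only [Finset.sum_mul_sum]
  simp only [Finset.mul_sum]
  rw [Finset.sum_comm]
  exact Finset.sum_congr rfl fun i _ => Finset.sum_comm

theorem wedgeAt_smul {p q n : ℕ} (h : p + q = n) (α : E [⋀^Fin p]→ₗ[ℝ] ℂ)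
    (β : E [⋀^Fin q]→ₗ[ℝ] ℂ) (c d : ℝ) :
    wedgeAt h (c • α) (d • β) = (c * d) • wedgeAt h α β := by
  ext v
  simp only [AlternatingMap.smul_apply, wedgeAt_apply, Finset.smul_sum]
  refine Finset.sum_congr rfl fun σ _ => ?_
  simp only [Complex.real_smul]
  push_cast
  ring

/-- The wedge product of a list of two-forms. -/
def wedgeProd : (ℓ : ℕ) → (Fin ℓ → E [⋀^Fin 2]→ₗ[ℝ] ℂ) → E [⋀^Fin (2 * ℓ)]→ₗ[ℝ] ℂ
  | 0, _ => AlternatingMap.constOfIsEmpty ℝ E (Fin 0) 1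
  | ℓ + 1, β => wedgeAt (by ring) (β 0) (wedgeProd ℓ (Fin.tail β))

theorem wedgePow_eq_wedgeProd {m : ℕ} (α : Form m 2) (ℓ : ℕ) (w : V m) :
    wedgePow α ℓ w = wedgeProd ℓ (fun _ => α w) := by
  induction ℓ with
  | zero => rfl
  | succ ℓ ih =>
    change wedgeAt _ (α w) (wedgePow α ℓ w) = _
    rw [ih]; rfl

theorem Kills.wedgeProd {x : E} : ∀ {ℓ : ℕ} {β : Fin ℓ → E [⋀^Fin 2]→ₗ[ℝ] ℂ},
    (∀ i, Kills (β i) x) → Kills (wedgeProd ℓ β) x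
  | 0, _, _ => fun _ i => i.elim0
  | _ + 1, _, h => Kills.wedgeAt _ (h 0) (Kills.wedgeProd fun i => h i.succ)

theorem wedgeProd_compLinearMap {F : Type*} [AddCommGroup F] [Module ℝ F] (T : F →ₗ[ℝ] E) :
    ∀ (ℓ : ℕ) (β : Fin ℓ → E [⋀^Fin 2]→ₗ[ℝ] ℂ),
    (wedgeProd ℓ β).compLinearMap T = wedgeProd ℓ fun i => (β i).compLinearMap T
  | 0, _ => by ext v; rfl
  | ℓ + 1, β => by
    rw [wedgeProd, wedgeAt_compLinearMap, wedgeProd_compLinearMap]; rfl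

theorem wedgeProd_smul (c : ℝ) : ∀ (ℓ : ℕ) (β : Fin ℓ → E [⋀^Fin 2]→ₗ[ℝ] ℂ),
    wedgeProd ℓ (fun i => c • β i) = c ^ ℓ • wedgeProd ℓ β
  | 0, _ => by simp [wedgeProd]
  | ℓ + 1, β => by
    have := wedgeProd_smul c ℓ (Fin.tail β)
    rw [wedgeProd, wedgeProd, pow_succ', ← wedgeAt_smul, ← this]; rfl

theorem wedgeProd_sum {ι : Type*} [Fintype ι] (β : ι → E [⋀^Fin 2]→ₗ[ℝ] ℂ) :
    ∀ ℓ : ℕ, wedgeProd ℓ (fun _ => ∑ i, β i) = ∑ J : Fin ℓ → ι, wedgeProd ℓ fun i => β (J i)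
  | 0 => by simp [wedgeProd]
  | ℓ + 1 => by
    have h := wedgeProd_sum β ℓ
    rw [wedgeProd]
    change wedgeAt _ _ (wedgeProd ℓ fun _ => ∑ i, β i) = _
    rw [h, wedgeAt_sum, ← Fintype.sum_prod_type', ← (Fin.consEquiv fun _ => ι).sum_comp]
    rfl

end Wedge

/-! ### Real frames of complex vector spaces -/

section Frames

/-- The real frame `(e₀, i e₀, e₁, i e₁, …)`. -/
def cframe {E : Type*} [AddCommGroup E] [Module ℂ E] {k : ℕ} (e : Fin k → E)
    (j : Fin (2 * k)) : E :=
  Complex.I ^ (j.val % 2) • e ⟨j.val / 2, Nat.div_lt_of_lt_mul j.isLt⟩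

theorem cframe_comp {E F : Type*} [AddCommGroup E] [Module ℂ E] [AddCommGroup F]
    [Module ℂ F] {k : ℕ} (T : F →ₗ[ℂ] E)
    (e : Fin k → F) (j : Fin (2 * k)) : T (cframe e j) = cframe (fun i => T (e i)) j := by
  simp [cframe]

variable {E : Type*} [AddCommGroup E] [Module ℝ E] [Module ℂ E] [IsScalarTower ℝ ℂ E]
  {W : Type*} [NormedAddCommGroup W] [InnerProductSpace ℂ W]

/-- The two-form `Im ⟨N u, N v⟩`. -/
def hform (N : E →ₗ[ℂ] W) : E [⋀^Fin 2]→ₗ[ℝ] ℂ where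
  toFun v := ((inner ℂ (N (v 0)) (N (v 1))).im : ℂ)
  map_update_add' v i x y := by
    fin_cases i
    · simp [Function.update]
    · simp [Function.update]
  map_update_smul' v i c x := by
    have hc : c • x = (c : ℂ) • x := by rw [← algebraMap_smul ℂ c x]; rfl
    fin_cases i
    · simp [Function.update, hc]
    · simp [Function.update, hc]
  map_eq_zero_of_eq' v i j h hij := by
    have h' : v 0 = v 1 := by
      fin_cases i <;> fin_cases j <;> simp_all
    rw [h', inner_self_eq_norm_sq_to_K]
    norm_cast

theorem hform_apply (N : E →ₗ[ℂ] W) (v : Fin 2 → E) :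
    hform N v = ((inner ℂ (N (v 0)) (N (v 1))).im : ℂ) := rfl

theorem hform_kills {N : E →ₗ[ℂ] W} {x : E} (hx : N x = 0) : Kills (hform N) x := by
  intro v i hv
  rw [hform_apply]
  fin_cases i
  · have : v 0 = x := hv
    simp [this, hx]
  · have : v 1 = x := hv
    simp [this, hx]

/-- The frame lists `f j` and `i f j` next to each other, and `2ℓ + j` has the parity of `j` and
half `ℓ + j / 2`. So the split of the real frame after `2ℓ` entries is the split of the complex
frame after `ℓ` vectors, and only the trivial shuffle survives. -/
theorem wedgeAt_cframe {E : Type*} [AddCommGroup E] [Module ℝ E] [Module ℂ E] {ℓ k m : ℕ} (hm : ℓ + k = m) (h : 2 * ℓ + 2 * k = 2 * m)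
    (α : E [⋀^Fin (2 * ℓ)]→ₗ[ℝ] ℂ) (β : E [⋀^Fin (2 * k)]→ₗ[ℝ] ℂ) (f : Fin m → E)
    (hk : ∀ j : Fin k, ∀ c : ℂ, Kills α (c • f (Fin.cast hm (Fin.natAdd ℓ j)))) :
    wedgeAt h α β (cframe f) =
      α (cframe fun i => f (Fin.cast hm (Fin.castAdd k i))) *
        β (cframe fun j => f (Fin.cast hm (Fin.natAdd ℓ j))) := by
  have hr : ∀ j : Fin (2 * k), cframe f (wedgeIdx h (Sum.inr j)) =
      cframe (fun j => f (Fin.cast hm (Fin.natAdd ℓ j))) j := by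
    intro j
    have h1 : (2 * ℓ + j.val) % 2 = j.val % 2 := by omega
    have h2 : (2 * ℓ + j.val) / 2 = ℓ + j.val / 2 := by omega
    simp [cframe, wedgeIdx, h1, h2]
  have hl : ∀ j : Fin (2 * ℓ), cframe f (wedgeIdx h (Sum.inl j)) =
      cframe (fun j => f (Fin.cast hm (Fin.castAdd k j))) j := by
    intro j
    simp [cframe, wedgeIdx]
  rw [wedgeAt_eq_mul_of_kills]
  · simp only [hr, hl]
  · intro j
    rw [hr]
    exact hk _ _

/-- Each coordinate form takes the value `Im (conj 1 · i) = 1` on its own pair `(f, i f)` and is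
killed by all the other vectors, so the factors peel off one at a time. -/
theorem wedgeProd_cframe_dual : ∀ {ℓ : ℕ} (lam : Fin ℓ → E →ₗ[ℂ] ℂ) (f : Fin ℓ → E),
    (∀ i j, lam i (f j) = if i = j then 1 else 0) →
    wedgeProd ℓ (fun i => hform (lam i)) (cframe f) = 1
  | 0, _, _, _ => rfl
  | ℓ + 1, lam, f, h => by
    have key := wedgeAt_cframe (ℓ := 1) (k := ℓ) (m := ℓ + 1) (by ring) (by ring)
      (hform (lam 0)) (wedgeProd ℓ (Fin.tail fun i => hform (lam i))) f ?_
    · refine key.trans ?_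
      have h1 := wedgeProd_cframe_dual (Fin.tail lam) (Fin.tail f) (fun i j => by
        have := h i.succ j.succ
        simpa [Fin.tail] using this)
      have h2 : (fun j => f (Fin.cast (by ring : 1 + ℓ = ℓ + 1) (Fin.natAdd 1 j))) =
          Fin.tail f := by
        ext j
        simp only [Fin.tail]
        congr 1
        ext; simp
      rw [h2]
      have h3 : hform (lam 0) (cframe fun i : Fin 1 =>
          f (Fin.cast (by ring : 1 + ℓ = ℓ + 1) (Fin.castAdd ℓ i))) = 1 := by
        rw [hform_apply]
        have h0 : f (Fin.cast (by ring : 1 + ℓ = ℓ + 1) (Fin.castAdd ℓ (0 : Fin 1))) = f 0 := by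
          congr 1
        have h00 := h 0 0
        simp [cframe]
        simp at h00
        rw [h0, h00]
        simp
      rw [h3, one_mul]
      exact h1
    · intro j c
      apply hform_kills
      rw [map_smul]
      have := h 0 (Fin.cast (by ring) (Fin.natAdd 1 j))
      rw [if_neg] at this
      · rw [this, smul_zero]
      · intro h0
        have := congrArg Fin.val h0
        simp at this

/-- The real basis `(ε₀, i ε₀, ε₁, i ε₁, …)` of `ℂ^m`. -/
theorem exists_basis_cframe (m : ℕ) : ∃ b : Module.Basis (Fin (2 * m)) ℝ (Fin m → ℂ),
    ∀ j, b j = cframe (fun i => (Pi.single i 1 : Fin m → ℂ)) j := by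
  let b0 := Complex.basisOneI.smulTower (Pi.basisFun ℂ (Fin m))
  let e : Fin 2 × Fin m ≃ Fin (2 * m) :=
    (Equiv.prodComm _ _).trans (finProdFinEquiv.trans (finCongr (by ring)))
  refine ⟨b0.reindex e, fun j => ?_⟩
  obtain ⟨⟨r, i⟩, rfl⟩ := e.surjective j
  have hv : (e (r, i)).val = r.val + 2 * i.val := by simp [e, finProdFinEquiv]
  have h1 : (e (r, i)).val % 2 = r.val := by omega
  have h2 : (e (r, i)).val / 2 = i.val := by omega
  rw [Module.Basis.reindex_apply, Equiv.symm_apply_apply, cframe, h1,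
    show (⟨(e (r, i)).val / 2, Nat.div_lt_of_lt_mul (e (r, i)).isLt⟩ : Fin m) = i from Fin.ext h2]
  simp only [b0, Module.Basis.smulTower_apply, Pi.basisFun_apply]
  fin_cases r <;> simp

/-- A complex-linear endomorphism with determinant `d` has real determinant `|d|²`. Pulling `τ` back
to `ℂ^m`, its real and imaginary parts are multiples of the determinant form; `f` itself need not be
independent. -/
theorem map_cframe_matrix {m : ℕ} (τ : E [⋀^Fin (2 * m)]→ₗ[ℝ] ℂ) (f : Fin m → E)
    (M : Matrix (Fin m) (Fin m) ℂ) :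
    τ (cframe fun j => ∑ i, M i j • f i) = ((‖M.det‖ ^ 2 : ℝ) : ℂ) * τ (cframe f) := by
  obtain ⟨b, hb⟩ := exists_basis_cframe m
  let T : (Fin m → ℂ) →ₗ[ℂ] E := Fintype.linearCombination ℂ f
  have hT : ∀ i, T (Pi.single i 1) = f i := fun i => by
    simp [T, Fintype.linearCombination_apply_single]
  let L : (Fin m → ℂ) →ₗ[ℂ] (Fin m → ℂ) := Matrix.toLin' M
  have hL : ∀ j, T (L (Pi.single j 1)) = ∑ i, M i j • f i := fun j => by
    simp [T, L, Fintype.linearCombination_apply]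
  have e1 : (cframe f) = fun j => T (b j) := by
    ext j; rw [hb, cframe_comp]; simp only [hT]
  have e2 : (cframe fun j => ∑ i, M i j • f i) = fun j => T (L (b j)) := by
    ext j; rw [hb, cframe_comp, cframe_comp]; simp only [hL]
  have hdet : LinearMap.det (L.restrictScalars ℝ) = ‖M.det‖ ^ 2 := by
    rw [LinearMap.det_restrictScalars, Algebra.norm_complex_apply, Complex.normSq_eq_norm_sq]
    simp [L]
  have key : ∀ ρ : (Fin m → ℂ) [⋀^Fin (2 * m)]→ₗ[ℝ] ℝ,
      ρ (fun j => L (b j)) = ‖M.det‖ ^ 2 * ρ b := by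
    intro ρ
    have h1 := AlternatingMap.eq_smul_basis_det b ρ
    have h2 : ρ (fun j => L (b j)) = ρ b * b.det (fun j => L (b j)) := by
      conv_lhs => rw [h1]
      simp
    rw [h2, show (fun j => L (b j)) = (L.restrictScalars ℝ) ∘ b from rfl,
      Module.Basis.det_comp, hdet, Module.Basis.det_self]
    ring
  let τ' := τ.compLinearMap (T.restrictScalars ℝ)
  have kre := key (Complex.reLm.compAlternatingMap τ')
  have kim := key (Complex.imLm.compAlternatingMap τ')
  rw [e1, e2]
  apply Complex.ext
  · rw [Complex.re_ofReal_mul]; exact kre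
  · rw [Complex.im_ofReal_mul]; exact kim

end Frames

/-! ### Averages of wedge products -/

section Average

variable {E : Type*} [AddCommGroup E] [Module ℝ E]

/-- The average of a wedge product of independent random two-forms is the wedge power of the
average. -/
theorem integral_wedgeProd {R : Type*} [MeasurableSpace R] (ν : Measure R) [SigmaFinite ν]
    (β : R → E [⋀^Fin 2]→ₗ[ℝ] ℂ) (b : E [⋀^Fin 2]→ₗ[ℝ] ℂ)
    (hβ : ∀ v, Integrable (fun r => β r v) ν) (hb : ∀ v, ∫ r, β r v ∂ν = b v) :
    ∀ (ℓ : ℕ) (v : Fin (2 * ℓ) → E),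
      Integrable (fun x : Fin ℓ → R => wedgeProd ℓ (fun i => β (x i)) v)
        (Measure.pi fun _ => ν) ∧
      ∫ x : Fin ℓ → R, wedgeProd ℓ (fun i => β (x i)) v ∂(Measure.pi fun _ => ν) =
        wedgeProd ℓ (fun _ => b) v
  | 0, v => by
    have : ∀ x : Fin 0 → R, wedgeProd 0 (fun i => β (x i)) v = 1 := fun _ => rfl
    have h1 : wedgeProd 0 (fun _ => b) v = 1 := rfl
    simp only [this, h1]
    rw [Measure.pi_of_empty]
    simp
  | ℓ + 1, v => by
    have ih := integral_wedgeProd ν β b hβ hb ℓ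
    have mp := measurePreserving_piFinSuccAbove (fun _ : Fin (ℓ + 1) => ν) 0
    have hfun : (fun x : Fin (ℓ + 1) → R => wedgeProd (ℓ + 1) (fun i => β (x i)) v) =
        (fun y : R × (Fin ℓ → R) => wedgeAt (by ring : 2 + 2 * ℓ = 2 * (ℓ + 1)) (β y.1)
          (wedgeProd ℓ fun i => β (y.2 i)) v) ∘
          (MeasurableEquiv.piFinSuccAbove (fun _ : Fin (ℓ + 1) => R) 0) := by
      ext x
      rfl
    -- Every shuffle term is a function of the first variable times a function of the others, so
    -- Fubini applies. Each variable is used exactly once, which is why `ν` need not have mass one;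
    -- the row densities used later do not.
    have hint : ∀ σ : Equiv.Perm.ModSumCongr (Fin 2) (Fin (2 * ℓ)), Integrable
        (fun y : R × (Fin ℓ → R) => ((Equiv.Perm.sign (Quotient.out σ) : ℤ) : ℂ) *
        (β y.1 (fun i => v (wedgeIdx (by ring : 2 + 2 * ℓ = 2 * (ℓ + 1))
            (Quotient.out σ (Sum.inl i)))) *
          (wedgeProd ℓ fun i => β (y.2 i)) (fun j => v (wedgeIdx (by ring)
            (Quotient.out σ (Sum.inr j))))))
        (ν.prod (Measure.pi fun _ => ν)) := fun σ =>
      ((hβ _).mul_prod (ih _).1).const_mul _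
    rw [hfun]
    constructor
    · rw [mp.integrable_comp_emb (MeasurableEquiv.measurableEmbedding _)]
      simp only [wedgeAt_apply]
      exact integrable_finsetSum _ fun σ _ => hint σ
    · simp only [Function.comp_def]
      rw [mp.integral_comp' (g := fun y : R × (Fin ℓ → R) =>
        wedgeAt (by ring : 2 + 2 * ℓ = 2 * (ℓ + 1)) (β y.1)
          (wedgeProd ℓ fun i => β (y.2 i)) v)]
      rw [wedgeProd]
      simp only [wedgeAt_apply]
      refine (integral_finsetSum _ fun σ _ => hint σ).trans ?_
      refine Finset.sum_congr rfl fun σ _ => ?_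
      rw [integral_const_mul]
      congr 1
      refine (integral_prod_mul (μ := ν) (ν := Measure.pi fun _ : Fin ℓ => ν)
        (fun r => β r fun i => v (wedgeIdx (by ring) (Quotient.out σ (Sum.inl i))))
        (fun x => wedgeProd ℓ (fun i => β (x i)) fun j => v (wedgeIdx (by ring)
            (Quotient.out σ (Sum.inr j))))).trans ?_
      rw [hb, (ih _).2]
      rfl

theorem integral_wedgeAt_wedgeProd {R : Type*} [MeasurableSpace R] (ν : Measure R) [SigmaFinite ν]
    (β : R → E [⋀^Fin 2]→ₗ[ℝ] ℂ) (b : E [⋀^Fin 2]→ₗ[ℝ] ℂ)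
    (hβ : ∀ v, Integrable (fun r => β r v) ν) (hb : ∀ v, ∫ r, β r v ∂ν = b v)
    {ℓ q n : ℕ} (h : 2 * ℓ + q = n) (φ : E [⋀^Fin q]→ₗ[ℝ] ℂ) (v : Fin n → E) :
    Integrable (fun x : Fin ℓ → R => wedgeAt h (wedgeProd ℓ (fun i => β (x i))) φ v)
        (Measure.pi fun _ => ν) ∧
      ∫ x : Fin ℓ → R, wedgeAt h (wedgeProd ℓ (fun i => β (x i))) φ v ∂(Measure.pi fun _ => ν) =
        wedgeAt h (wedgeProd ℓ (fun _ => b)) φ v := by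
  have ih := integral_wedgeProd ν β b hβ hb ℓ
  simp only [wedgeAt_apply]
  have hint : ∀ σ : Equiv.Perm.ModSumCongr (Fin (2 * ℓ)) (Fin q), Integrable
      (fun x : Fin ℓ → R => ((Equiv.Perm.sign (Quotient.out σ) : ℤ) : ℂ) *
        (wedgeProd ℓ (fun i => β (x i)) (fun i => v (wedgeIdx h (Quotient.out σ (Sum.inl i)))) *
          φ (fun j => v (wedgeIdx h (Quotient.out σ (Sum.inr j))))))
      (Measure.pi fun _ => ν) := fun σ => ((ih _).1.mul_const _).const_mul _
  refine ⟨integrable_finsetSum _ fun σ _ => hint σ,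
    (integral_finsetSum _ fun σ _ => hint σ).trans ?_⟩
  refine Finset.sum_congr rfl fun σ _ => ?_
  rw [integral_const_mul, integral_mul_const, (ih _).2]

end Average

/-! ### Wirtinger's theorem -/

section Wirtinger

variable {E : Type*} [AddCommGroup E] [Module ℝ E] [Module ℂ E] [IsScalarTower ℝ ℂ E]
  {W : Type*} [NormedAddCommGroup W] [InnerProductSpace ℂ W]

/-- Permuting complex directions permutes pairs of real ones, hence preserves the orientation:
`|det|² = 1` for a permutation matrix. -/
theorem map_cframe_perm {m : ℕ} (τ : E [⋀^Fin (2 * m)]→ₗ[ℝ] ℂ) (f : Fin m → E)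
    (σ : Equiv.Perm (Fin m)) : τ (cframe fun j => f (σ j)) = τ (cframe f) := by
  have h := map_cframe_matrix τ f (σ.permMatrix ℂ).transpose
  rw [Matrix.det_transpose, Matrix.det_permutation] at h
  have h1 : ‖(((Equiv.Perm.sign σ : ℤˣ) : ℤ) : ℂ)‖ = 1 := by
    rcases Int.units_eq_one_or (Equiv.Perm.sign σ) with hσ | hσ <;> simp [hσ]
  rw [h1] at h
  simp only [one_pow, Complex.ofReal_one, one_mul] at h
  rw [← h]
  congr 2
  ext j
  simp [Equiv.Perm.permMatrix, PEquiv.toMatrix_apply, Equiv.toPEquiv_apply]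

theorem cframe_two_mul {E : Type*} [AddCommGroup E] [Module ℂ E] {m : ℕ} (f : Fin m → E) (j : Fin m) :
    cframe f ⟨2 * j.val, by omega⟩ = f j := by
  simp [cframe]

/-- If the chosen indices form a permutation, the frame can be reordered so that forms and vectors
are dual. Otherwise some index `j` is missed, and `f j` is killed by every factor. -/
theorem wedge_coordinate_forms {ℓ k : ℕ} (h : 2 * ℓ + 2 * k = 2 * (ℓ + k))
    (lam : Fin (ℓ + k) → E →ₗ[ℂ] ℂ) (f : Fin (ℓ + k) → E)
    (hf : ∀ i j, lam i (f j) = if i = j then 1 else 0)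
    (J : (Fin ℓ → Fin (ℓ + k)) × (Fin k → Fin (ℓ + k))) [Decidable (Function.Bijective
      (Fin.append J.1 J.2))] :
    wedgeAt h (wedgeProd ℓ fun i => hform (lam (J.1 i)))
      (wedgeProd k fun i => hform (lam (J.2 i))) (cframe f) =
      if Function.Bijective (Fin.append J.1 J.2) then 1 else 0 := by
  split_ifs with hJ
  · let σ := Equiv.ofBijective _ hJ
    have hσl : ∀ i, σ (Fin.castAdd k i) = J.1 i := fun i => by simp [σ]
    have hσr : ∀ i, σ (Fin.natAdd ℓ i) = J.2 i := fun i => by simp [σ]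
    rw [← map_cframe_perm _ f σ, wedgeAt_cframe (hm := rfl)]
    · simp only [Fin.cast_refl, id, hσl, hσr]
      rw [wedgeProd_cframe_dual, wedgeProd_cframe_dual, one_mul]
      · intro i j
        rw [hf, ← hσr, ← hσr]
        simp
      · intro i j
        rw [hf, ← hσl, ← hσl]
        simp
    · intro j c
      refine Kills.wedgeProd fun i => hform_kills ?_
      rw [map_smul, hf, if_neg, smul_zero]
      rw [← hσl]
      intro hc
      have := congrArg Fin.val (σ.injective hc)
      simp at this
      omega
  · have hns : ¬ Function.Surjective (Fin.append J.1 J.2) := fun hs =>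
      hJ ⟨Finite.injective_iff_surjective.mpr hs, hs⟩
    simp only [Function.Surjective, not_forall, not_exists] at hns
    obtain ⟨j, hj⟩ := hns
    have hl : ∀ i, J.1 i ≠ j := fun i => by simpa using hj (Fin.castAdd k i)
    have hr : ∀ i, J.2 i ≠ j := fun i => by simpa using hj (Fin.natAdd ℓ i)
    refine Kills.wedgeAt h (x := f j) ?_ ?_ _ ⟨2 * j.val, by omega⟩ (cframe_two_mul f j)
    · refine Kills.wedgeProd fun i => hform_kills ?_
      rw [hf, if_neg (hl i)]
    · refine Kills.wedgeProd fun i => hform_kills ?_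
      rw [hf, if_neg (hr i)]

theorem card_bijective (m : ℕ) [DecidablePred fun f : Fin m → Fin m => Function.Bijective f] :
    ((∑ f : Fin m → Fin m, if Function.Bijective f then 1 else 0 : ℕ)) = m.factorial := by
  rw [Finset.sum_boole]
  have e : Equiv.Perm (Fin m) ≃ {f : Fin m → Fin m // Function.Bijective f} :=
    { toFun := fun σ => ⟨σ, σ.bijective⟩
      invFun := fun f => Equiv.ofBijective f.1 f.2
      left_inv := fun σ => by ext; rfl
      right_inv := fun f => rfl }
  have h := Fintype.card_congr e
  rw [Fintype.card_perm, Fintype.card_fin, Fintype.card_subtype] at h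
  simpa using h.symm

/-- In a unitary frame, a Hermitian two-form is the sum of the coordinate forms. -/
theorem hform_eq_sum {m : ℕ} (N : E →ₗ[ℂ] W) (f : Fin m → E)
    (ho : Orthonormal ℂ fun i => N (f i))
    (hs : ∀ x, N x ∈ Submodule.span ℂ (Set.range fun i => N (f i))) :
    hform N = ∑ i, hform ((innerₛₗ ℂ (N (f i))).comp N : E →ₗ[ℂ] ℂ) := by
  ext v
  rw [alternatingMap_sum_apply]
  simp only [hform_apply]
  have key : ∀ x, N x = ∑ i, inner ℂ (N (f i)) (N x) • N (f i) := by
    intro x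
    obtain ⟨c, hc⟩ := (Submodule.mem_span_range_iff_exists_fun ℂ).mp (hs x)
    rw [← hc]
    refine Finset.sum_congr rfl fun i _ => ?_
    rw [ho.inner_right_fintype]
  conv_lhs => rw [key (v 0)]
  rw [sum_inner, Complex.im_sum]
  push_cast
  refine Finset.sum_congr rfl fun i _ => ?_
  rw [inner_smul_left]
  simp [mul_comm]

/-- Wirtinger: powers of a Hermitian form on a unitary frame. -/
theorem wedge_hform_pow {ℓ k m : ℕ} (hm : ℓ + k = m) (h : 2 * ℓ + 2 * k = 2 * m)
    (N : E →ₗ[ℂ] W) (f : Fin m → E) (ho : Orthonormal ℂ fun i => N (f i))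
    (hs : ∀ x, N x ∈ Submodule.span ℂ (Set.range fun i => N (f i))) :
    wedgeAt h (wedgeProd ℓ fun _ => hform N) (wedgeProd k fun _ => hform N) (cframe f) =
      (m.factorial : ℂ) := by
  classical
  subst hm
  rw [hform_eq_sum N f ho hs, wedgeProd_sum, wedgeProd_sum, wedgeAt_sum, alternatingMap_sum_apply]
  simp only [alternatingMap_sum_apply]
  rw [← Fintype.sum_prod_type']
  have hf : ∀ i j, ((innerₛₗ ℂ (N (f i))).comp N : E →ₗ[ℂ] ℂ) (f j) = if i = j then 1 else 0 := by
    intro i j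
    exact orthonormal_iff_ite.mp ho i j
  -- After expanding both powers, each permutation of the `m` indices contributes one and everything
  -- else vanishes, so the sum counts permutations.
  rw [Finset.sum_congr rfl fun J _ => wedge_coordinate_forms h _ f hf J]
  refine ((Fin.appendEquiv ℓ k).sum_comp
    (fun J : Fin (ℓ + k) → Fin (ℓ + k) => if Function.Bijective J then (1 : ℂ) else 0)).trans ?_
  have := card_bijective (ℓ + k)
  rw [← this]
  push_cast
  rfl

theorem wedgeProd_hform_pow {k : ℕ} (N : E →ₗ[ℂ] W) (f : Fin k → E)
    (ho : Orthonormal ℂ fun i => N (f i))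
    (hs : ∀ x, N x ∈ Submodule.span ℂ (Set.range fun i => N (f i))) :
    wedgeProd k (fun _ => hform N) (cframe f) = (k.factorial : ℂ) := by
  rw [← wedge_hform_pow (zero_add k) (by ring) N f ho hs,
    wedgeAt_cframe (hm := zero_add k) (hk := fun j c v i => i.elim0)]
  have h1 : wedgeProd 0 (fun _ => hform N)
      (cframe fun i => f (Fin.cast (zero_add k) (Fin.castAdd k i))) = 1 := rfl
  rw [h1, one_mul]
  congr 2
  ext j
  congr 1
  ext
  simp

/-- If `M` holds the coordinates of `v` in the orthonormal family `o`, the Gram matrix is `Mᴴ M`,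
whose determinant is `|det M|²`. -/
theorem map_cframe_gram {k : ℕ} [Module ℝ W] [IsScalarTower ℝ ℂ W]
    (τ : W [⋀^Fin (2 * k)]→ₗ[ℝ] ℂ) (o v : Fin k → W)
    (ho : Orthonormal ℂ o) (hv : ∀ j, v j ∈ Submodule.span ℂ (Set.range o)) :
    τ (cframe v) = (Matrix.gram ℂ v).det * τ (cframe o) ∧
      ∃ r : ℝ, 0 ≤ r ∧ (Matrix.gram ℂ v).det = (r : ℂ) := by
  let M : Matrix (Fin k) (Fin k) ℂ := fun i j => inner ℂ (o i) (v j)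
  have key : ∀ j, v j = ∑ i, M i j • o i := by
    intro j
    obtain ⟨c, hc⟩ := (Submodule.mem_span_range_iff_exists_fun ℂ).mp (hv j)
    simp only [M]
    rw [← hc]
    refine Finset.sum_congr rfl fun i _ => ?_
    rw [ho.inner_right_fintype]
  have hg : Matrix.gram ℂ v = M.conjTranspose * M := by
    ext i j
    rw [Matrix.gram_apply, key i, sum_inner, Matrix.mul_apply]
    refine Finset.sum_congr rfl fun l _ => ?_
    rw [inner_smul_left]
    rfl
  have hd : (Matrix.gram ℂ v).det = ((‖M.det‖ ^ 2 : ℝ) : ℂ) := by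
    rw [hg, Matrix.det_mul, Matrix.det_conjTranspose]
    simpa using Complex.conj_mul' M.det
  refine ⟨?_, ‖M.det‖ ^ 2, by positivity, hd⟩
  rw [hd, ← map_cframe_matrix τ o M, funext key]

/-- A top-degree wedge with the pullback of the volume form by `Y`, in terms of a frame adapted to
the fibres of `Y`. -/
theorem wedge_pullback_volume {ℓ k m : ℕ} (hm : ℓ + k = m) (h : 2 * ℓ + 2 * k = 2 * m)
    (Y : Fin ℓ → E →ₗ[ℂ] ℂ) (φ : E [⋀^Fin (2 * k)]→ₗ[ℝ] ℂ) (b e : Fin m → E)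
    (M : Matrix (Fin m) (Fin m) ℂ) (hM : ∀ j, b j = ∑ i, M i j • e i)
    (hl : ∀ i j, Y i (e (Fin.cast hm (Fin.castAdd k j))) = if i = j then 1 else 0)
    (hr : ∀ i j, Y i (e (Fin.cast hm (Fin.natAdd ℓ j))) = 0) :
    wedgeAt h (wedgeProd ℓ fun i => hform (Y i)) φ (cframe b) =
      ((‖M.det‖ ^ 2 : ℝ) : ℂ) * φ (cframe fun j => e (Fin.cast hm (Fin.natAdd ℓ j))) := by
  rw [funext hM, map_cframe_matrix, wedgeAt_cframe (hm := hm), wedgeProd_cframe_dual _ _ hl,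
    one_mul]
  intro j c
  refine Kills.wedgeProd fun i => hform_kills ?_
  rw [map_smul, hr, smul_zero]

end Wirtinger

/-! ### The Fubini-Study form -/

/-- The complex-linear map on `ℂ^{m+1}` whose pullback of the Hermitian norm is the Fubini-Study
metric at `[w]`: the orthogonal projection to `w^⊥`, divided by `√π |w|`. -/
def fsMap {m : ℕ} (w : V m) : V m →L[ℂ] V m :=
  (((√Real.pi * ‖w‖)⁻¹ : ℝ) : ℂ) • (ContinuousLinearMap.id ℂ (V m) -
    (((‖w‖ ^ 2)⁻¹ : ℝ) : ℂ) • (innerSL ℂ w).smulRight w)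

theorem fsMap_apply {m : ℕ} (w v : V m) : fsMap w v =
    (((√Real.pi * ‖w‖)⁻¹ : ℝ) : ℂ) • (v - (((‖w‖ ^ 2)⁻¹ : ℝ) * inner ℂ w v : ℂ) • w) := by
  simp [fsMap, mul_smul]

theorem inner_fsMap {m : ℕ} {w : V m} (hw : w ≠ 0) (u v : V m) :
    inner ℂ (fsMap w u) (fsMap w v) = (((Real.pi * ‖w‖ ^ 2)⁻¹ : ℝ) : ℂ) *
      (inner ℂ u v - (((‖w‖ ^ 2)⁻¹ : ℝ) : ℂ) * (inner ℂ u w * inner ℂ w v)) := by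
  have h : ‖w‖ ≠ 0 := norm_ne_zero_iff.mpr hw
  have hπ : (√Real.pi) ^ 2 = Real.pi := Real.sq_sqrt Real.pi_pos.le
  have hww : inner ℂ w w = ((‖w‖ ^ 2 : ℝ) : ℂ) := by
    rw [inner_self_eq_norm_sq_to_K]; norm_cast
  rw [fsMap_apply, fsMap_apply, inner_smul_left, inner_smul_right, inner_sub_left,
    inner_sub_right, inner_sub_right, inner_smul_left, inner_smul_left, inner_smul_right,
    inner_smul_right, hww, map_mul, inner_conj_symm, Complex.conj_ofReal, Complex.conj_ofReal,
    ← mul_assoc, ← Complex.ofReal_mul]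
  have e1 : (√Real.pi * ‖w‖)⁻¹ * (√Real.pi * ‖w‖)⁻¹ = (Real.pi * ‖w‖ ^ 2)⁻¹ := by
    rw [← mul_inv]; congr 1; rw [← hπ, Real.sq_sqrt Real.pi_pos.le]
    nlinarith [Real.mul_self_sqrt Real.pi_pos.le]
  rw [e1]
  congr 1
  have hc : ((‖w‖ : ℂ)) ≠ 0 := by exact_mod_cast h
  push_cast
  field_simp
  ring

theorem inner_im_comm {m : ℕ} (u v : V m) : (inner ℂ u v).im = -(inner ℂ v u).im := by
  rw [← inner_conj_symm, Complex.conj_im]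

theorem inner_re_comm {m : ℕ} (u v : V m) : (inner ℂ u v).re = (inner ℂ v u).re := by
  rw [← inner_conj_symm, Complex.conj_re]

theorem hasFDerivAt_log_norm_sq {m : ℕ} {w : V m} (hw : w ≠ 0) :
    ∃ L : V m →L[ℝ] ℂ, HasFDerivAt (fun z : V m => ((Real.log (‖z‖ ^ 2) : ℝ) : ℂ)) L w ∧
      ∀ v, L v = ((2 * (inner ℂ w v).re / ‖w‖ ^ 2 : ℝ) : ℂ) := by
  have h : ‖w‖ ^ 2 ≠ 0 := pow_ne_zero _ (norm_ne_zero_iff.mpr hw)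
  let _ : InnerProductSpace ℝ (V m) := InnerProductSpace.rclikeToReal ℂ (V m)
  have h1 := ((hasStrictFDerivAt_norm_sq w).hasFDerivAt.log h)
  have h2 := (Complex.ofRealCLM.hasFDerivAt (x := Real.log (‖w‖ ^ 2))).comp w h1
  refine ⟨_, h2, fun v => ?_⟩
  have : (inner ℝ w v : ℝ) = (inner ℂ w v).re := rfl
  simp [this]
  ring

/-- The imaginary part and the sign come from `Re ⟨w, i u⟩ = -Im ⟨w, u⟩`. -/
theorem dC_log_norm_sq {m : ℕ} {w : V m} (hw : w ≠ 0) (u : Fin 1 → V m) :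
    dC (fun z : V m => ((Real.log (‖z‖ ^ 2) : ℝ) : ℂ)) w u =
      (((2 * Real.pi)⁻¹ * ((inner ℂ w (u 0)).im / ‖w‖ ^ 2) : ℝ) : ℂ) := by
  obtain ⟨L, hL, hLv⟩ := hasFDerivAt_log_norm_sq hw
  simp only [dC]
  rw [hL.fderiv]
  have h1 : ((-(1 / (4 * Real.pi)) : ℝ) • ContinuousAlternatingMap.ofSubsingleton ℝ (V m) ℂ
      (0 : Fin 1) (L.comp (mulI m))) u = (-(1 / (4 * Real.pi)) : ℝ) • L (Complex.I • u 0) := rfl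
  rw [h1, hLv, inner_smul_right]
  have hpi := Real.pi_ne_zero
  have hn : ‖w‖ ≠ 0 := norm_ne_zero_iff.mpr hw
  rw [Complex.real_smul, ← Complex.ofReal_mul]
  congr 1
  simp
  field_simp
  ring

theorem differentiableAt_dC_log {m : ℕ} {w : V m} (hw : w ≠ 0) :
    DifferentiableAt ℝ (dC (fun z : V m => ((Real.log (‖z‖ ^ 2) : ℝ) : ℂ))) w := by
  let _ : InnerProductSpace ℝ (V m) := InnerProductSpace.rclikeToReal ℂ (V m)
  have h : ‖w‖ ^ 2 ≠ 0 := pow_ne_zero _ (norm_ne_zero_iff.mpr hw)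
  have hs : ContDiffAt ℝ 2 (fun z : V m => ((Real.log (‖z‖ ^ 2) : ℝ) : ℂ)) w := by
    have h1 : ContDiffAt ℝ 2 (fun z : V m => ‖z‖ ^ 2) w := (contDiff_norm_sq ℝ).contDiffAt
    exact Complex.ofRealCLM.contDiff.contDiffAt.comp w (h1.log h)
  have hf : DifferentiableAt ℝ (fderiv ℝ fun z : V m => ((Real.log (‖z‖ ^ 2) : ℝ) : ℂ)) w :=
    (hs.fderiv_right (m := 1) (by norm_num)).differentiableAt (by norm_num)
  have hg : DifferentiableAt ℝ (fun z => (fderiv ℝ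
      (fun z : V m => ((Real.log (‖z‖ ^ 2) : ℝ) : ℂ)) z).comp (mulI m)) w :=
    hf.clm_comp (differentiableAt_const _)
  exact ((ContinuousAlternatingMap.ofSubsingletonLIE (𝕜 := ℝ) (E := V m) (F := ℂ)
    (0 : Fin 1)).toContinuousLinearEquiv.differentiable.differentiableAt.comp w hg).const_smul
    (-(1 / (4 * Real.pi)) : ℝ)

theorem fderiv_im_inner_div {m : ℕ} {w : V m} (hw : w ≠ 0) (u v : V m) :
    fderiv ℝ (fun z : V m => (((2 * Real.pi)⁻¹ * ((inner ℂ z u).im / ‖z‖ ^ 2) : ℝ) : ℂ)) w v =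
      (((2 * Real.pi)⁻¹ * ((inner ℂ v u).im / ‖w‖ ^ 2 -
        2 * (inner ℂ w v).re * (inner ℂ w u).im / (‖w‖ ^ 2) ^ 2) : ℝ) : ℂ) := by
  let _ : InnerProductSpace ℝ (V m) := InnerProductSpace.rclikeToReal ℂ (V m)
  have h : ‖w‖ ^ 2 ≠ 0 := pow_ne_zero _ (norm_ne_zero_iff.mpr hw)
  have h1 : HasFDerivAt (fun z : V m => (inner ℂ z u).im)
      (-(Complex.imCLM.comp ((innerSL ℂ u).restrictScalars ℝ))) w := by
    have : (fun z : V m => (inner ℂ z u).im) =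
        fun z => (-(Complex.imCLM.comp ((innerSL ℂ u).restrictScalars ℝ))) z := by
      ext z
      rw [inner_im_comm]
      simp
    rw [this]
    exact ContinuousLinearMap.hasFDerivAt _
  have hi := (hasDerivAt_inv h).comp_hasFDerivAt w (hasStrictFDerivAt_norm_sq w).hasFDerivAt
  have h2 := (h1.mul hi).const_mul (2 * Real.pi)⁻¹
  have h3 := (Complex.ofRealCLM.hasFDerivAt).comp w h2
  have h4 := h3.fderiv
  refine (DFunLike.congr_fun h4 v).trans ?_
  have e1 : (inner ℝ w v : ℝ) = (inner ℂ w v).re := rfl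
  have e2 : (inner ℂ v u).im = -(inner ℂ u v).im := inner_im_comm _ _
  simp [e1, e2]
  field_simp
  ring

/-- Differentiating `Im ⟨w, u⟩ / (2π |w|²)` and antisymmetrizing gives the imaginary part of the
Hermitian product of horizontal components, scaled by `1/(π|w|²)`. This bridges the form and the
distance, whose infinitesimal norm is that of the same map `fsMap w`. -/
theorem fubiniStudy_eq_hform {m : ℕ} {w : V m} (hw : w ≠ 0) :
    fubiniStudy m w = hform (fsMap w).toLinearMap := by
  ext v
  have e : fubiniStudy m w v =
    extDeriv (dC fun z : V m => ((Real.log (‖z‖ ^ 2) : ℝ) : ℂ)) w v := rfl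
  -- The explicit formula for `d^c log |z|²` is only available away from the origin, which suffices
  -- for the derivative at `w`.
  have hev : ∀ u : Fin 1 → V m,
      (fun z => dC (fun z : V m => ((Real.log (‖z‖ ^ 2) : ℝ) : ℂ)) z u) =ᶠ[nhds w]
      fun z => (((2 * Real.pi)⁻¹ * ((inner ℂ z (u 0)).im / ‖z‖ ^ 2) : ℝ) : ℂ) := fun u => by
    filter_upwards [isOpen_ne.mem_nhds hw] with z hz
    exact dC_log_norm_sq hz u
  rw [e, extDeriv_apply (differentiableAt_dC_log hw), Fin.sum_univ_two, (hev _).fderiv_eq,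
    (hev _).fderiv_eq, fderiv_im_inner_div hw, fderiv_im_inner_div hw, hform_apply]
  simp only [ContinuousLinearMap.coe_coe]
  rw [inner_fsMap hw]
  have h0 : (Fin.removeNth (0 : Fin 2) v) (0 : Fin 1) = v 1 := rfl
  have h1 : (Fin.removeNth (1 : Fin 2) v) (0 : Fin 1) = v 0 := rfl
  rw [h0, h1]
  have s1 : (inner ℂ (v 1) (v 0)).im = -(inner ℂ (v 0) (v 1)).im := inner_im_comm _ _
  have s2 : (inner ℂ (v 0) w).re = (inner ℂ w (v 0)).re := inner_re_comm _ _
  have s3 : (inner ℂ (v 0) w).im = -(inner ℂ w (v 0)).im := inner_im_comm _ _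
  have hpi := Real.pi_ne_zero
  have hn : ‖w‖ ≠ 0 := norm_ne_zero_iff.mpr hw
  simp only [Fin.val_zero, Fin.val_one, pow_zero, pow_one, one_smul, neg_smul]
  rw [← Complex.ofReal_neg, ← Complex.ofReal_add]
  congr 1
  rw [Complex.im_ofReal_mul, Complex.sub_im, Complex.im_ofReal_mul, Complex.mul_im, s1, s2, s3]
  field_simp
  ring

/-! ### The Fubini-Study distance in homogeneous coordinates -/

theorem hermitianAngle_smul_left {m : ℕ} {c : ℂ} (hc : c ≠ 0) (u v : V m) :
    hermitianAngle (c • u) v = hermitianAngle u v := by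
  have h : ‖c‖ ≠ 0 := norm_ne_zero_iff.mpr hc
  rw [hermitianAngle, hermitianAngle, inner_smul_left, norm_mul, norm_smul, RCLike.norm_conj,
    mul_assoc, mul_div_mul_left _ _ h]

theorem hermitianAngle_smul_right {m : ℕ} {c : ℂ} (hc : c ≠ 0) (u v : V m) :
    hermitianAngle u (c • v) = hermitianAngle u v := by
  rw [hermitianAngle_comm, hermitianAngle_smul_left hc, hermitianAngle_comm]

theorem CP.exists_rep_mk {m : ℕ} (w : V m) (hw : w ≠ 0) :
    ∃ c : ℂ, c ≠ 0 ∧ (CP.mk w hw).rep = c • w := by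
  obtain ⟨a, ha⟩ := Projectivization.exists_smul_eq_mk_rep ℂ w hw
  exact ⟨(a : ℂ), a.ne_zero, ha.symm⟩

theorem CP.mk_smul {m : ℕ} (w : V m) (hw : w ≠ 0) {c : ℂ} (hc : c ≠ 0) :
    CP.mk (c • w) (smul_ne_zero hc hw) = CP.mk w hw :=
  (Projectivization.mk_eq_mk_iff' ℂ _ _ _ _).mpr ⟨c, rfl⟩

theorem CP.mk_rep {m : ℕ} (p : CP m) : CP.mk p.rep p.rep_ne_zero = p :=
  Projectivization.mk_rep p

theorem CP.mk_eq_mk_iff {m : ℕ} (v w : V m) (hv : v ≠ 0) (hw : w ≠ 0) :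
    CP.mk v hv = CP.mk w hw ↔ ∃ c : ℂ, c • w = v :=
  Projectivization.mk_eq_mk_iff' ℂ _ _ _ _

theorem dist_mk {m : ℕ} {u v : V m} (hu : u ≠ 0) (hv : v ≠ 0) :
    dist (CP.mk u hu) (CP.mk v hv) = hermitianAngle u v / √Real.pi := by
  obtain ⟨c, hc, hcu⟩ := CP.exists_rep_mk u hu
  obtain ⟨d, hd, hdv⟩ := CP.exists_rep_mk v hv
  change hermitianAngle _ _ / _ = _
  rw [hcu, hdv, hermitianAngle_smul_left hc, hermitianAngle_smul_right hd]

theorem fsMap_self {m : ℕ} {w : V m} (hw : w ≠ 0) : fsMap w w = 0 := by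
  have h : ((‖w‖ : ℂ)) ≠ 0 := by exact_mod_cast norm_ne_zero_iff.mpr hw
  rw [fsMap_apply, inner_self_eq_norm_sq_to_K]
  have : ((((‖w‖ ^ 2)⁻¹ : ℝ) : ℂ) * ((‖w‖ : ℝ) : ℂ) ^ 2) = 1 := by
    push_cast
    field_simp
  erw [this]
  simp

theorem fsMap_inner_eq_zero {m : ℕ} {w : V m} (hw : w ≠ 0) (v : V m) :
    inner ℂ w (fsMap w v) = 0 := by
  have h : ((‖w‖ : ℂ)) ≠ 0 := by exact_mod_cast norm_ne_zero_iff.mpr hw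
  have hww : inner ℂ w w = (‖w‖ : ℂ) ^ 2 := inner_self_eq_norm_sq_to_K w
  rw [fsMap_apply, inner_smul_right, inner_sub_right, inner_smul_right, hww]
  push_cast
  field_simp
  simp

theorem norm_fsMap_sq {m : ℕ} {w : V m} (hw : w ≠ 0) (v : V m) :
    ‖fsMap w v‖ ^ 2 = (Real.pi * ‖w‖ ^ 2)⁻¹ * (‖v‖ ^ 2 - ‖inner ℂ w v‖ ^ 2 / ‖w‖ ^ 2) := by
  have h1 := inner_fsMap hw v v
  have h2 : inner ℂ (fsMap w v) (fsMap w v) = ((‖fsMap w v‖ ^ 2 : ℝ) : ℂ) := by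
    rw [inner_self_eq_norm_sq_to_K]; norm_cast
  have h3 : inner ℂ v v = ((‖v‖ ^ 2 : ℝ) : ℂ) := by
    rw [inner_self_eq_norm_sq_to_K]; norm_cast
  have h4 : inner ℂ v w * inner ℂ w v = ((‖inner ℂ w v‖ ^ 2 : ℝ) : ℂ) := by
    rw [← inner_conj_symm v w, Complex.conj_mul']; norm_cast
  rw [h2, h3, h4] at h1
  have h5 : ‖fsMap w v‖ ^ 2 = (Real.pi * ‖w‖ ^ 2)⁻¹ *
      (‖v‖ ^ 2 - (‖w‖ ^ 2)⁻¹ * ‖inner ℂ w v‖ ^ 2) := by exact_mod_cast h1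
  rw [h5, div_eq_inv_mul]

/-- The sine of the angle is the normalized length of the component of `v` orthogonal to `u`. Since
`fsMap u` kills `u`, one may insert `v - u`, which makes the right side visibly small near the
diagonal. -/
theorem sin_hermitianAngle {m : ℕ} {u v : V m} (hu : u ≠ 0) (hv : v ≠ 0) :
    Real.sin (hermitianAngle u v) = √Real.pi * (‖u‖ / ‖v‖ * ‖fsMap u (v - u)‖) := by
  have h1 : 0 < ‖u‖ := norm_pos_iff.mpr hu
  have h2 : 0 < ‖v‖ := norm_pos_iff.mpr hv
  rw [map_sub, fsMap_self hu, sub_zero, hermitianAngle, Real.sin_arccos]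
  have h3 : (√Real.pi * (‖u‖ / ‖v‖ * ‖fsMap u v‖)) ^ 2 =
      1 - (‖inner ℂ u v‖ / (‖u‖ * ‖v‖)) ^ 2 := by
    rw [mul_pow, mul_pow, norm_fsMap_sq hu, Real.sq_sqrt Real.pi_pos.le]
    have := Real.pi_ne_zero
    field_simp
  rw [← h3, Real.sqrt_sq (by positivity)]

theorem hermitianAngle_nonneg {m : ℕ} (u v : V m) : 0 ≤ hermitianAngle u v :=
  Real.arccos_nonneg _

theorem hermitianAngle_le {m : ℕ} (u v : V m) : hermitianAngle u v ≤ Real.pi / 2 :=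
  Real.arccos_le_pi_div_two.mpr (by positivity)

theorem continuousAt_fsMap {m : ℕ} {u : V m} (hu : u ≠ 0) : ContinuousAt (fsMap (m := m)) u := by
  have h : √Real.pi * ‖u‖ ≠ 0 :=
    mul_ne_zero (Real.sqrt_pos.mpr Real.pi_pos).ne' (norm_ne_zero_iff.mpr hu)
  have h' : ‖u‖ ^ 2 ≠ 0 := pow_ne_zero _ (norm_ne_zero_iff.mpr hu)
  unfold fsMap
  have h1 : ContinuousAt (fun w : V m => (((√Real.pi * ‖w‖)⁻¹ : ℝ) : ℂ)) u :=
    Complex.continuous_ofReal.continuousAt.comp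
      ((continuousAt_const.mul continuous_norm.continuousAt).inv₀ h)
  have h2 : ContinuousAt (fun w : V m => (((‖w‖ ^ 2)⁻¹ : ℝ) : ℂ)) u :=
    Complex.continuous_ofReal.continuousAt.comp
      ((continuous_norm.pow 2).continuousAt.inv₀ h')
  have h3 : Continuous fun w : V m => (innerSL ℂ w).smulRight w := by
    have : Continuous fun w : V m => ContinuousLinearMap.smulRightL ℂ (V m) (V m) (innerSL ℂ w) w :=
      ((ContinuousLinearMap.smulRightL ℂ (V m) (V m)).continuous.comp
        (innerSL ℂ).continuous).clm_apply continuous_id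
    exact this
  exact h1.smul (continuousAt_const.sub (h2.smul h3.continuousAt))

/-- The Fubini-Study distance is differentiable along the diagonal, with derivative the norm of
`fsMap`. -/
theorem dist_mk_strict {m : ℕ} {u₀ : V m} (hu₀ : u₀ ≠ 0) {ε : ℝ} (hε : 0 < ε) :
    ∀ᶠ p : V m × V m in nhds (u₀, u₀), ∀ (hu : p.1 ≠ 0) (hv : p.2 ≠ 0),
      |dist (CP.mk p.1 hu) (CP.mk p.2 hv) - ‖fsMap u₀ (p.2 - p.1)‖| ≤ ε * ‖p.2 - p.1‖ := by
  have hn : ‖u₀‖ ≠ 0 := norm_ne_zero_iff.mpr hu₀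
  have hpi : 0 < √Real.pi := Real.sqrt_pos.mpr Real.pi_pos
  have hcont : ContinuousAt (fun p : V m × V m => ((‖p.1‖ / ‖p.2‖ : ℝ) : ℂ) • fsMap p.1)
      (u₀, u₀) := by
    have c1 : ContinuousAt (fun p : V m × V m => ((‖p.1‖ / ‖p.2‖ : ℝ) : ℂ)) (u₀, u₀) :=
      Complex.continuous_ofReal.continuousAt.comp
        (ContinuousAt.div (by fun_prop) (by fun_prop) hn)
    have c2 : ContinuousAt (fun p : V m × V m => fsMap p.1) (u₀, u₀) :=
      (continuousAt_fsMap hu₀).comp (f := Prod.fst) (x := (u₀, u₀)) continuousAt_fst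
    exact c1.smul c2
  have hval : ((‖u₀‖ / ‖u₀‖ : ℝ) : ℂ) • fsMap u₀ = fsMap u₀ := by
    rw [div_self hn]; simp
  have e1 : ∀ᶠ p : V m × V m in nhds (u₀, u₀),
      ‖((‖p.1‖ / ‖p.2‖ : ℝ) : ℂ) • fsMap p.1 - fsMap u₀‖ < min (ε / 2) 1 := by
    have h0 : (0 : ℝ) < min (ε / 2) 1 := by positivity
    have := Metric.tendsto_nhds.mp hcont _ h0
    filter_upwards [this] with p hp
    rwa [dist_eq_norm, hval] at hp
  set C : ℝ := ‖fsMap u₀‖ + 1 with hC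
  have hCpos : 0 < C := by positivity
  -- From `θ ≤ (π/2) sin θ` on `[0, π/2]` and `sin θ = √π s` with `s ≤ C d`, it follows that `θ ≤ K
  -- d`. Then `θ - sin θ ≤ θ³/4` is of third order in `d`, and the smallness condition on `d` below
  -- makes it at most `√π (ε/2) d`.
  set K : ℝ := Real.pi / 2 * (√Real.pi * C) with hK
  have hKpos : 0 < K := by positivity
  have e2 : ∀ᶠ p : V m × V m in nhds (u₀, u₀),
      ‖p.2 - p.1‖ < √Real.pi * ε / K ^ 3 ∧ ‖p.2 - p.1‖ < 1 := by
    have hc : ContinuousAt (fun p : V m × V m => ‖p.2 - p.1‖) (u₀, u₀) := by fun_prop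
    have h0 : Filter.Tendsto (fun p : V m × V m => ‖p.2 - p.1‖) (nhds (u₀, u₀)) (nhds 0) := by
      simpa [ContinuousAt] using hc
    exact (h0.eventually_lt_const (by positivity)).and (h0.eventually_lt_const one_pos)
  filter_upwards [e1, e2] with p hp1 hp2 hu hv
  obtain ⟨u, v⟩ := p
  simp only at hp1 hp2 hu hv ⊢
  set d := ‖v - u‖ with hd
  have hd0 : 0 ≤ d := norm_nonneg _
  set θ := hermitianAngle u v with hθ
  have hθ0 := hermitianAngle_nonneg u v
  have hθ1 := hermitianAngle_le u v
  have hsin := sin_hermitianAngle hu hv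
  rw [dist_mk]
  set s := ‖u‖ / ‖v‖ * ‖fsMap u (v - u)‖ with hs
  have hs' : s = ‖(((‖u‖ / ‖v‖ : ℝ) : ℂ) • fsMap u) (v - u)‖ := by
    rw [_root_.smul_apply, norm_smul, Complex.norm_real, Real.norm_of_nonneg
      (by positivity)]
  have hdiff : |s - ‖fsMap u₀ (v - u)‖| ≤ min (ε / 2) 1 * d := by
    rw [hs']
    refine (abs_norm_sub_norm_le _ _).trans ?_
    rw [← _root_.sub_apply]
    refine (ContinuousLinearMap.le_opNorm _ _).trans ?_
    exact mul_le_mul_of_nonneg_right hp1.le hd0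
  have hsC : s ≤ C * d := by
    have h1 := (abs_le.mp hdiff).2
    have h2 := ContinuousLinearMap.le_opNorm (fsMap u₀) (v - u)
    have h3 : min (ε / 2) 1 * d ≤ 1 * d := mul_le_mul_of_nonneg_right (min_le_right _ _) hd0
    rw [hC]; linarith
  have hθK : θ ≤ K * d := by
    have h1 := Real.mul_le_sin hθ0 hθ1
    rw [hsin] at h1
    have h2 : θ ≤ Real.pi / 2 * (√Real.pi * s) := by
      have := mul_le_mul_of_nonneg_left h1 (by positivity : 0 ≤ Real.pi / 2)
      have hh : Real.pi / 2 * (2 / Real.pi * θ) = θ := by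
        field_simp
      linarith
    refine h2.trans ?_
    rw [hK, mul_assoc, mul_assoc]
    gcongr
  have hcube : θ - Real.sin θ ≤ θ ^ 3 / 4 := by
    rcases hθ0.eq_or_lt with h | h
    · rw [← hθ] at h; rw [← h]; simp
    · have := Real.sin_gt_sub_cube h
      have := pow_pos h 3
      linarith
  have hsinle : Real.sin θ ≤ θ := Real.sin_le hθ0
  have hDs : |θ / √Real.pi - s| ≤ ε / 2 * d := by
    have h1 : s = Real.sin θ / √Real.pi := by rw [hsin]; field_simp
    rw [h1, ← sub_div, abs_div, abs_of_nonneg (sub_nonneg.mpr hsinle), abs_of_pos hpi,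
      div_le_iff₀ hpi]
    refine hcube.trans ?_
    have h2 : θ ^ 3 ≤ (K * d) ^ 3 := pow_le_pow_left₀ hθ0 hθK 3
    have h3 : d * K ^ 3 ≤ √Real.pi * ε := by
      have h := hp2.1.le
      rwa [le_div_iff₀ (by positivity)] at h
    have h4 : (K * d) ^ 3 ≤ √Real.pi * ε * d := by
      have h5 : (K * d) ^ 3 = (d * K ^ 3) * (d * d) := by ring
      have h6 : d * d ≤ d := by nlinarith [hp2.2]
      rw [h5]
      calc (d * K ^ 3) * (d * d) ≤ (√Real.pi * ε) * (d * d) := by gcongr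
        _ ≤ √Real.pi * ε * d := by gcongr
    nlinarith [mul_nonneg (mul_nonneg hpi.le hε.le) hd0]
  have h3 : min (ε / 2) 1 * d ≤ ε / 2 * d := mul_le_mul_of_nonneg_right (min_le_left _ _) hd0
  calc |θ / √Real.pi - ‖fsMap u₀ (v - u)‖|
      ≤ |θ / √Real.pi - s| + |s - ‖fsMap u₀ (v - u)‖| := abs_sub_le _ _ _
    _ ≤ ε * d := by linarith

/-! ### An area formula for maps into metric spaces -/

/-- The normalization that identifies Lebesgue measure on `ℂ^k` with the Haar measure of the real
basis formed by `1` and `i` in each coordinate. -/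
theorem volume_parallelepiped_complex (k : ℕ) :
    volume (parallelepiped (Complex.basisOneI.smulTower (Pi.basisFun ℂ (Fin k)))) = 1 := by
  have h1 : parallelepiped (Complex.basisOneI.smulTower (Pi.basisFun ℂ (Fin k))) =
      Set.pi Set.univ fun _ : Fin k =>
        Complex.measurableEquivRealProd ⁻¹' (Set.Icc (0 : ℝ) 1 ×ˢ Set.Icc (0 : ℝ) 1) := by
    rw [parallelepiped_basis_eq]
    ext x
    simp only [Set.mem_ofPred_eq, Module.Basis.smulTower_repr, Pi.basisFun_repr, Set.mem_pi,
      Set.mem_univ, true_imp_iff, Prod.forall, Set.mem_preimage, Set.mem_prod]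
    constructor
    · intro h i
      have h0 := h 0 i
      have h1 := h 1 i
      simpa using And.intro h0 h1
    · intro h r i
      have := h i
      fin_cases r
      · simpa using this.1
      · simpa using this.2
  rw [h1, volume_pi_pi]
  refine Finset.prod_eq_one fun i _ => ?_
  rw [Complex.volume_preserving_equiv_real_prod.measure_preimage
    (measurableSet_Icc.prod measurableSet_Icc).nullMeasurableSet, Measure.volume_eq_prod,
    Measure.prod_prod]
  simp

/-- `Fin k → ℂ` carries the supremum norm, so its own Hausdorff measure is not the Euclidean one.
The comparison passes to `EuclideanSpace`, where the same real basis is orthonormal. -/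
theorem euclideanHausdorffMeasure_complex (k : ℕ) (S : Set (Fin k → ℂ)) :
    Measure.euclideanHausdorffMeasure (2 * k)
      (WithLp.toLp 2 '' S : Set (EuclideanSpace ℂ (Fin k))) = volume S := by
  let _ : InnerProductSpace ℝ (EuclideanSpace ℂ (Fin k)) :=
    InnerProductSpace.rclikeToReal ℂ (EuclideanSpace ℂ (Fin k))
  let b := Complex.basisOneI.smulTower (Pi.basisFun ℂ (Fin k))
  let f : (Fin k → ℂ) ≃L[ℝ] EuclideanSpace ℂ (Fin k) :=
    (PiLp.continuousLinearEquiv 2 ℝ (fun _ : Fin k => ℂ)).symm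
  let b' : Module.Basis (Fin 2 × Fin k) ℝ (EuclideanSpace ℂ (Fin k)) := b.map f.toLinearEquiv
  have hb' : ∀ r i, b' (r, i) = EuclideanSpace.single i (Complex.basisOneI r) := by
    intro r i
    simp only [b', b, Module.Basis.map_apply, Module.Basis.smulTower_apply, Pi.basisFun_apply]
    ext j
    simp [f, EuclideanSpace.single]
  have ho : Orthonormal ℝ b' := by
    rw [orthonormal_iff_ite]
    rintro ⟨r, i⟩ ⟨s, j⟩
    rw [hb', hb']
    have : inner ℝ (EuclideanSpace.single i (Complex.basisOneI r))
        (EuclideanSpace.single j (Complex.basisOneI s)) =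
        (inner ℂ (EuclideanSpace.single i (Complex.basisOneI r))
        (EuclideanSpace.single j (Complex.basisOneI s))).re := rfl
    rw [this, EuclideanSpace.inner_single_left]
    by_cases hij : i = j
    · subst hij
      fin_cases r <;> fin_cases s <;> simp
    · have : ¬ ((r, i) = (s, j)) := fun h => hij (congrArg Prod.snd h)
      simp [this, hij]
  let o := b'.toOrthonormalBasis ho
  have hv1 : (volume : Measure (Fin k → ℂ)) = b.addHaar :=
    ((Module.Basis.addHaar_eq_iff b volume).mpr (volume_parallelepiped_complex k)).symm
  have hfin : Module.finrank ℝ (EuclideanSpace ℂ (Fin k)) = 2 * k := by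
    rw [Module.finrank_eq_card_basis b']
    simp
  have hv2 : (Measure.euclideanHausdorffMeasure (2 * k) : Measure (EuclideanSpace ℂ (Fin k))) =
      b'.addHaar := by
    rw [← hfin, InnerProductSpace.euclideanHausdorffMeasure_eq_volume,
      ← o.addHaar_eq_volume, Module.Basis.toBasis_toOrthonormalBasis]
  rw [hv2, ← Module.Basis.map_addHaar, ← hv1]
  have : (WithLp.toLp 2 '' S : Set (EuclideanSpace ℂ (Fin k))) = f '' S := rfl
  have h2 : Measure.map f (volume : Measure (Fin k → ℂ)) (f '' S) = volume (f ⁻¹' (f '' S)) :=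
    f.toHomeomorph.toMeasurableEquiv.map_apply (μ := volume) (f '' S)
  rw [this, h2, Set.preimage_image_eq S f.injective]

/-- The Jacobian of a complex-linear map, computed from the Gram determinant. -/
def gramDet {k : ℕ} {W : Type*} [NormedAddCommGroup W] [InnerProductSpace ℂ W]
    (N : (Fin k → ℂ) →L[ℂ] W) : ℝ :=
  (Matrix.gram ℂ fun j => N (Pi.single j 1)).det.re

/-- Through an orthonormal basis of its range, `N` is an isometric embedding of `EuclideanSpace ℂ
(Fin k)` after an automorphism `L` of `ℂ^k`. Isometries preserve Hausdorff measure, and `L` scales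
volume by its real determinant `|det L|²`, which is the Gram determinant. -/
theorem hausdorff_image_linear {k : ℕ} {W : Type*} [NormedAddCommGroup W] [InnerProductSpace ℂ W]
    [MeasurableSpace W] [BorelSpace W] (N : (Fin k → ℂ) →L[ℂ] W) (hN : Function.Injective N) :
    0 < gramDet N ∧ ∀ S : Set (Fin k → ℂ),
      Measure.euclideanHausdorffMeasure (2 * k) (N '' S) =
        ENNReal.ofReal (gramDet N) * volume S := by
  let R := N.toLinearMap.range
  let N' : (Fin k → ℂ) ≃ₗ[ℂ] R := LinearEquiv.ofInjective N.toLinearMap hN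
  have : FiniteDimensional ℂ R := N'.finiteDimensional
  have hfin : Module.finrank ℂ R = k := by
    rw [← N'.finrank_eq]; simp
  let o : OrthonormalBasis (Fin k) ℂ R := (stdOrthonormalBasis ℂ R).reindex (finCongr hfin)
  let L : (Fin k → ℂ) ≃ₗ[ℂ] (Fin k → ℂ) :=
    (N'.trans o.repr.toLinearEquiv).trans (WithLp.linearEquiv 2 ℂ (Fin k → ℂ))
  have hL : ∀ x, (o.repr.symm (WithLp.toLp 2 (L x)) : W) = N x := by
    intro x
    simp [L, N']
    rfl
  have hdet : gramDet N = ‖LinearMap.det L.toLinearMap‖ ^ 2 := by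
    have hg : Matrix.gram ℂ (fun j => N (Pi.single j 1)) =
        (LinearMap.toMatrix' L.toLinearMap).conjTranspose * LinearMap.toMatrix' L.toLinearMap := by
      ext i j
      rw [Matrix.gram_apply, ← hL, ← hL]
      rw [← Submodule.coe_inner, LinearIsometryEquiv.inner_map_map, Matrix.mul_apply]
      simp [PiLp.inner_apply, LinearMap.toMatrix'_apply, mul_comm]
    rw [gramDet, hg, Matrix.det_mul, Matrix.det_conjTranspose, LinearMap.det_toMatrix']
    have := Complex.conj_mul' (LinearMap.det L.toLinearMap)
    rw [show star (LinearMap.det L.toLinearMap) =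
      (starRingEnd ℂ) (LinearMap.det L.toLinearMap) from rfl, this]
    norm_cast
  have hne : LinearMap.det L.toLinearMap ≠ 0 := L.isUnit_det'.ne_zero
  refine ⟨by rw [hdet]; positivity, fun S => ?_⟩
  have himg : N '' S = (fun x : EuclideanSpace ℂ (Fin k) => (o.repr.symm x : W)) ''
      (WithLp.toLp 2 '' (L '' S)) := by
    simp only [Set.image_image, hL]
  have hiso : Isometry fun x : EuclideanSpace ℂ (Fin k) => (o.repr.symm x : W) :=
    isometry_subtype_coe.comp o.repr.symm.isometry
  rw [himg, hiso.euclideanHausdorffMeasure_image, euclideanHausdorffMeasure_complex]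
  have h1 := Measure.addHaar_image_linearMap (volume : Measure (Fin k → ℂ))
    (L.toLinearMap.restrictScalars ℝ) S
  rw [LinearMap.det_restrictScalars, Algebra.norm_complex_apply, Complex.normSq_eq_norm_sq,
    abs_of_nonneg (by positivity), ← hdet] at h1
  exact h1

/-- The hypothesis makes `f` factor through `g` on `S`: points with equal `g` have equal `f`, and
the induced map from `g '' S` to `f '' S` is `K`-Lipschitz. -/
theorem hausdorff_image_le_of_dist_le {X Y Y' : Type*} [MetricSpace Y] [MeasurableSpace Y]
    [BorelSpace Y] [MetricSpace Y'] [MeasurableSpace Y'] [BorelSpace Y'] (d : ℕ) (K : NNReal)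
    (f : X → Y) (g : X → Y') (S : Set X)
    (h : ∀ x ∈ S, ∀ y ∈ S, dist (f x) (f y) ≤ K * dist (g x) (g y)) :
    Measure.euclideanHausdorffMeasure d (f '' S) ≤
      (K : ℝ≥0∞) ^ d * Measure.euclideanHausdorffMeasure d (g '' S) := by
  rcases S.eq_empty_or_nonempty with rfl | ⟨x0, hx0⟩
  · simp
  have : Nonempty X := ⟨x0⟩
  let q : Y' → Y := fun y => f (Function.invFunOn g S y)
  have hq : ∀ x ∈ S, q (g x) = f x := by
    intro x hx
    have hex : ∃ a ∈ S, g a = g x := ⟨x, hx, rfl⟩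
    have h1 := Function.invFunOn_mem hex
    have h2 := Function.invFunOn_eq hex
    have h3 := h _ h1 x hx
    rw [h2, dist_self, mul_zero] at h3
    exact dist_le_zero.mp h3
  have hlip : LipschitzOnWith K q (g '' S) := by
    refine LipschitzOnWith.of_dist_le_mul ?_
    rintro _ ⟨x, hx, rfl⟩ _ ⟨y, hy, rfl⟩
    rw [hq x hx, hq y hy]
    exact h x hx y hy
  have himg : q '' (g '' S) = f '' S := by
    rw [Set.image_image]
    exact Set.image_congr hq
  have h1 := hlip.hausdorffMeasure_image_le (d := (d : ℝ)) (by positivity)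
  rw [himg, ENNReal.rpow_natCast] at h1
  rw [Measure.euclideanHausdorffMeasure_def, Measure.euclideanHausdorffMeasure_def,
    Measure.smul_apply, Measure.smul_apply, ENNReal.smul_def, ENNReal.smul_def, smul_eq_mul,
    smul_eq_mul, mul_left_comm]
  gcongr

/-- Second countability extracts a countable subcover from the neighbourhoods, and making it
disjoint lets the local inequalities be added. -/
theorem measure_le_of_locally_le {X : Type*} [TopologicalSpace X] [SecondCountableTopology X]
    [MeasurableSpace X] [OpensMeasurableSpace X] (μ ν : Measure X) (c : ℝ≥0∞) (O : Set X)
    (h : ∀ x ∈ O, ∃ U, IsOpen U ∧ x ∈ U ∧ ∀ S ⊆ U ∩ O, MeasurableSet S → μ S ≤ c * ν S)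
    {S : Set X} (hS : MeasurableSet S) (hSO : S ⊆ O) : μ S ≤ c * ν S := by
  rcases O.eq_empty_or_nonempty with rfl | hne
  · rw [Set.subset_empty_iff.mp hSO]; simp
  choose! U hUo hxU hU using h
  obtain ⟨t, htO, htc, hcov⟩ := TopologicalSpace.countable_cover_nhdsWithin (f := U) (s := O)
    fun x hx => mem_nhdsWithin_of_mem_nhds ((hUo x hx).mem_nhds (hxU x hx))
  have htne : t.Nonempty := by
    by_contra hcon
    rw [Set.not_nonempty_iff_eq_empty] at hcon
    obtain ⟨x, hx⟩ := hne
    have := hcov hx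
    simp [hcon] at this
  obtain ⟨e, he⟩ := htc.exists_eq_range htne
  have hmem : ∀ n, e n ∈ O := fun n => htO (he ▸ ⟨n, rfl⟩)
  let P : ℕ → Set X := disjointed fun n => U (e n)
  have hPm : ∀ n, MeasurableSet (P n) := fun n =>
    MeasurableSet.disjointed (fun n => (hUo _ (hmem n)).measurableSet) n
  have hPd : Pairwise (Function.onFun Disjoint P) := disjoint_disjointed _
  have hPU : ⋃ n, P n = ⋃ n, U (e n) := iUnion_disjointed
  have hSP : S = ⋃ n, S ∩ P n := by
    rw [← Set.inter_iUnion, hPU, eq_comm, Set.inter_eq_left]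
    refine (hSO.trans hcov).trans ?_
    rw [he]
    simp
  have hdis : Pairwise (Function.onFun Disjoint fun n => S ∩ P n) := fun i j hij =>
    (hPd hij).mono Set.inter_subset_right Set.inter_subset_right
  rw [hSP, measure_iUnion hdis fun n => hS.inter (hPm n), measure_iUnion hdis
    fun n => hS.inter (hPm n), ← ENNReal.tsum_mul_left]
  refine ENNReal.tsum_le_tsum fun n => hU _ (hmem n) _ ?_ (hS.inter (hPm n))
  exact fun x hx => ⟨disjointed_subset (fun n => U (e n)) n hx.2, hSO hx.1⟩

/-- The map `f` into a metric space is strictly differentiable at `x` in the metric sense, with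
derivative the seminorm `‖N ·‖`. -/
def HasMetricDerivAt {E Y W : Type*} [NormedAddCommGroup E] [NormedSpace ℂ E] [MetricSpace Y]
    [NormedAddCommGroup W] [NormedSpace ℂ W] (f : E → Y) (N : E →L[ℂ] W) (x : E) : Prop :=
  ∀ ε : ℝ, 0 < ε → ∀ᶠ p : E × E in nhds (x, x),
    |dist (f p.1) (f p.2) - ‖N (p.2 - p.1)‖| ≤ ε * ‖p.2 - p.1‖

theorem HasMetricDerivAt.continuousAt {E Y W : Type*} [NormedAddCommGroup E] [NormedSpace ℂ E]
    [MetricSpace Y] [NormedAddCommGroup W] [NormedSpace ℂ W] {f : E → Y} {N : E →L[ℂ] W} {x : E}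
    (h : HasMetricDerivAt f N x) : ContinuousAt f x := by
  have h1 := h 1 one_pos
  have h2 : ∀ᶠ y in nhds x, dist (f y) (f x) ≤ ‖N (x - y)‖ + ‖x - y‖ := by
    have h3 : Filter.Tendsto (fun y : E => (y, x)) (nhds x) (nhds (x, x)) :=
      (continuous_id.prodMk continuous_const).tendsto x
    filter_upwards [h3.eventually h1] with y hy
    have := (abs_le.mp hy).2
    linarith
  have h4 : Filter.Tendsto (fun y => ‖N (x - y)‖ + ‖x - y‖) (nhds x) (nhds 0) := by
    have : Continuous fun y => ‖N (x - y)‖ + ‖x - y‖ := by fun_prop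
    simpa using this.tendsto x
  exact tendsto_iff_dist_tendsto_zero.mpr
    (squeeze_zero' (Filter.Eventually.of_forall fun _ => dist_nonneg) h2 h4)

variable {k : ℕ} {Y : Type*} [MetricSpace Y] [MeasurableSpace Y] [BorelSpace Y]
  {W : Type*} [NormedAddCommGroup W] [InnerProductSpace ℂ W]

/-- Injectivity gives `‖v‖ ≤ K ‖N v‖`, so the error `(δ/K) ‖v‖` in the metric derivative becomes a
relative error `δ`. Near `x` the distances of `f` and of `N` are then comparable up to factors `1 ±
δ`, and so are the measures of images. -/
theorem area_local {f : (Fin k → ℂ) → Y} {N : (Fin k → ℂ) →L[ℂ] W} {x : Fin k → ℂ}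
    (hf : HasMetricDerivAt f N x) (hN : Function.Injective N) {δ : ℝ} (hδ : 0 < δ) (hδ1 : δ < 1) :
    ∃ U, IsOpen U ∧ x ∈ U ∧ ∀ S ⊆ U,
      Measure.euclideanHausdorffMeasure (2 * k) (f '' S) ≤
        ENNReal.ofReal (1 + δ) ^ (2 * k) * (ENNReal.ofReal (gramDet N) * volume S) ∧
      ENNReal.ofReal (gramDet N) * volume S ≤ ENNReal.ofReal ((1 - δ)⁻¹) ^ (2 * k) *
        Measure.euclideanHausdorffMeasure (2 * k) (f '' S) := by
  let _ : MeasurableSpace W := borel W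
  have : BorelSpace W := ⟨rfl⟩
  obtain ⟨K, hK0, hK⟩ := (LinearMap.injective_iff_antilipschitz (f := N.toLinearMap)).mp hN
  have hK' : ∀ v, ‖v‖ ≤ K * ‖N v‖ := fun v => by
    simpa using hK.le_mul_norm_sub v 0
  have hε : 0 < δ / K := by positivity
  have h1 := hf _ hε
  rw [nhds_prod_eq] at h1
  obtain ⟨U', hU', hd⟩ := Filter.eventually_prod_self_iff'.mp h1
  obtain ⟨U, hUU', hUo, hxU⟩ := mem_nhds_iff.mp hU'
  refine ⟨U, hUo, hxU, fun S hS => ?_⟩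
  have key : ∀ a ∈ S, ∀ b ∈ S, |dist (f a) (f b) - dist (N a) (N b)| ≤ δ * dist (N a) (N b) := by
    intro a ha b hb
    have h2 := hd a (hUU' (hS ha)) b (hUU' (hS hb))
    have h3 : ‖N (b - a)‖ = dist (N a) (N b) := by
      rw [map_sub, dist_comm, dist_eq_norm]
    rw [h3] at h2
    refine h2.trans ?_
    have h4 := hK' (b - a)
    rw [h3] at h4
    have hKpos : (0 : ℝ) < K := by exact_mod_cast hK0
    calc δ / K * ‖b - a‖ ≤ δ / K * (K * dist (N a) (N b)) := by gcongr
      _ = δ * dist (N a) (N b) := by field_simp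
  obtain ⟨hpos, himg⟩ := hausdorff_image_linear N hN
  rw [← himg S]
  constructor
  · refine hausdorff_image_le_of_dist_le (2 * k) (Real.toNNReal (1 + δ)) f N S
      fun a ha b hb => ?_
    have := (abs_le.mp (key a ha b hb)).2
    rw [Real.coe_toNNReal _ (by positivity)]
    linarith
  · refine hausdorff_image_le_of_dist_le (2 * k) (Real.toNNReal ((1 - δ)⁻¹)) N f S
      fun a ha b hb => ?_
    have h1 := (abs_le.mp (key a ha b hb)).1
    have h2 : 0 < 1 - δ := by linarith
    rw [Real.coe_toNNReal _ (by positivity), inv_mul_eq_div, le_div_iff₀ h2]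
    linarith

/-- Two errors multiply in the area formula: the `d`-th power of the distortion of distances, and
the oscillation of the Gram determinant. Both products tend to `1` with `δ`. -/
theorem exists_small_distortion (d : ℕ) {η : ℝ} (hη : 1 < η) :
    ∃ δ : ℝ, 0 < δ ∧ δ < 1 ∧ (1 + δ) ^ d * (1 - δ)⁻¹ ≤ η ∧ (1 + δ) * ((1 - δ)⁻¹) ^ d ≤ η := by
  have h1 : ContinuousAt (fun δ : ℝ => (1 + δ) ^ d * (1 - δ)⁻¹) 0 := by
    refine ContinuousAt.mul (by fun_prop) (ContinuousAt.inv₀ (by fun_prop) (by norm_num))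
  have h2 : ContinuousAt (fun δ : ℝ => (1 + δ) * ((1 - δ)⁻¹) ^ d) 0 := by
    refine ContinuousAt.mul (by fun_prop)
      (ContinuousAt.pow (ContinuousAt.inv₀ (by fun_prop) (by norm_num)) d)
  have e1 := h1.eventually_lt_const (u := η) (by simpa using hη)
  have e2 := h2.eventually_lt_const (u := η) (by simpa using hη)
  have e3 : ∀ᶠ δ : ℝ in nhdsWithin 0 (Set.Ioi 0), δ < 1 :=
    (eventually_lt_nhds one_pos).filter_mono nhdsWithin_le_nhds
  have e4 : ∀ᶠ δ : ℝ in nhdsWithin 0 (Set.Ioi 0), 0 < δ := eventually_mem_nhdsWithin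
  obtain ⟨δ, ⟨⟨h3, h4⟩, h5⟩, h6⟩ := ((((e1.filter_mono nhdsWithin_le_nhds).and
    (e2.filter_mono nhdsWithin_le_nhds)).and e3).and e4).exists
  exact ⟨δ, h6, h5, h3.le, h4.le⟩

/-- The area formula for injective maps that are strictly differentiable in the metric sense. -/
theorem area_formula {f : (Fin k → ℂ) → Y} {O : Set (Fin k → ℂ)} (hO : IsOpen O)
    {N : (Fin k → ℂ) → (Fin k → ℂ) →L[ℂ] W} (hN : ∀ x ∈ O, Function.Injective (N x))
    (hf : ∀ x ∈ O, HasMetricDerivAt f (N x) x) (hinj : Set.InjOn f O)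
    (hJ : ContinuousOn (fun x => gramDet (N x)) O) {S : Set (Fin k → ℂ)} (hS : MeasurableSet S)
    (hSO : S ⊆ O) :
    Measure.euclideanHausdorffMeasure (2 * k) (f '' S) =
      ∫⁻ x in S, ENNReal.ofReal (gramDet (N x)) := by
  let _ : MeasurableSpace W := borel W
  have : BorelSpace W := ⟨rfl⟩
  have hcont : ContinuousOn f O := fun x hx => (hf x hx).continuousAt.continuousWithinAt
  have emb := hcont.measurableEmbedding hO.measurableSet hinj
  -- `ρ` is the Hausdorff measure of the image, transported back to the parameter space; injectivity
  -- and continuity of `f` on `O` make this a measure. It is compared with the weighted Lebesgue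
  -- measure `ν`.
  let ρ : Measure (Fin k → ℂ) := Measure.map Subtype.val
    (Measure.comap (O.domRestrict f) (Measure.euclideanHausdorffMeasure (2 * k)))
  have hρ : ∀ T, MeasurableSet T → T ⊆ O →
      ρ T = Measure.euclideanHausdorffMeasure (2 * k) (f '' T) := by
    intro T hT hTO
    rw [Measure.map_apply measurable_subtype_coe hT, emb.comap_apply]
    congr 1
    ext y
    constructor
    · rintro ⟨x, hx, rfl⟩
      exact ⟨x, hx, rfl⟩
    · rintro ⟨x, hx, rfl⟩
      exact ⟨⟨x, hTO hx⟩, hx, rfl⟩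
  let ν : Measure (Fin k → ℂ) := volume.withDensity fun x => ENNReal.ofReal (gramDet (N x))
  have hν : ∀ T, MeasurableSet T → ν T = ∫⁻ x in T, ENNReal.ofReal (gramDet (N x)) :=
    fun T hT => withDensity_apply _ hT
  have local_bound : ∀ η : ℝ, 1 < η → ∀ x ∈ O, ∃ U, IsOpen U ∧ x ∈ U ∧ ∀ T ⊆ U ∩ O,
      MeasurableSet T → ρ T ≤ ENNReal.ofReal η * ν T ∧ ν T ≤ ENNReal.ofReal η * ρ T := by
    intro η hη x hx
    obtain ⟨δ, hδ, hδ1, hη1, hη2⟩ := exists_small_distortion (2 * k) hη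
    obtain ⟨U, hUo, hxU, hU⟩ := area_local (hf x hx) (hN x hx) hδ hδ1
    have hpos : 0 < gramDet (N x) := (hausdorff_image_linear _ (hN x hx)).1
    have hJx : ContinuousAt (fun x => gramDet (N x)) x := hJ.continuousAt (hO.mem_nhds hx)
    have e1 : ∀ᶠ y in nhds x, (1 - δ) * gramDet (N x) < gramDet (N y) ∧
        gramDet (N y) < (1 + δ) * gramDet (N x) :=
      (hJx.eventually_const_lt (by nlinarith)).and (hJx.eventually_lt_const (by nlinarith))
    obtain ⟨U', hU', hUo', hxU'⟩ := mem_nhds_iff.mp e1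
    refine ⟨U ∩ U', hUo.inter hUo', ⟨hxU, hxU'⟩, fun T hT hTm => ?_⟩
    obtain ⟨h1, h2⟩ := hU T fun y hy => (hT hy).1.1
    have hbd : ∀ y ∈ T, (1 - δ) * gramDet (N x) < gramDet (N y) ∧
        gramDet (N y) < (1 + δ) * gramDet (N x) := fun y hy => hU' (hT hy).1.2
    have h3 : ν T ≤ ENNReal.ofReal (1 + δ) * (ENNReal.ofReal (gramDet (N x)) * volume T) := by
      rw [hν T hTm, ← mul_assoc, ← ENNReal.ofReal_mul (by positivity)]
      calc ∫⁻ y in T, ENNReal.ofReal (gramDet (N y))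
          ≤ ∫⁻ y in T, ENNReal.ofReal ((1 + δ) * gramDet (N x)) :=
            setLIntegral_mono' hTm fun y hy => ENNReal.ofReal_le_ofReal (hbd y hy).2.le
        _ = _ := by rw [setLIntegral_const]
    have h4 : ENNReal.ofReal (gramDet (N x)) * volume T ≤ ENNReal.ofReal ((1 - δ)⁻¹) * ν T := by
      have hd : 0 < 1 - δ := by linarith
      have h5 : ENNReal.ofReal (1 - δ) * (ENNReal.ofReal (gramDet (N x)) * volume T) ≤ ν T := by
        rw [hν T hTm, ← mul_assoc, ← ENNReal.ofReal_mul hd.le]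
        calc _ = ∫⁻ y in T, ENNReal.ofReal ((1 - δ) * gramDet (N x)) := by rw [setLIntegral_const]
          _ ≤ _ := setLIntegral_mono' hTm fun y hy => ENNReal.ofReal_le_ofReal (hbd y hy).1.le
      calc ENNReal.ofReal (gramDet (N x)) * volume T
          = ENNReal.ofReal ((1 - δ)⁻¹) *
            (ENNReal.ofReal (1 - δ) * (ENNReal.ofReal (gramDet (N x)) * volume T)) := by
            rw [← mul_assoc (ENNReal.ofReal ((1 - δ)⁻¹)), ← ENNReal.ofReal_mul (by positivity),
              inv_mul_cancel₀ hd.ne']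
            simp
        _ ≤ _ := by gcongr
    rw [hρ T hTm fun y hy => (hT hy).2]
    have hd : 0 < 1 - δ := by linarith
    constructor
    · refine h1.trans ?_
      calc ENNReal.ofReal (1 + δ) ^ (2 * k) * (ENNReal.ofReal (gramDet (N x)) * volume T)
          ≤ ENNReal.ofReal (1 + δ) ^ (2 * k) * (ENNReal.ofReal ((1 - δ)⁻¹) * ν T) := by gcongr
        _ = ENNReal.ofReal ((1 + δ) ^ (2 * k) * (1 - δ)⁻¹) * ν T := by
            rw [← mul_assoc, ENNReal.ofReal_mul (by positivity),
              ENNReal.ofReal_pow (by positivity)]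
        _ ≤ _ := by gcongr
    · refine h3.trans ?_
      calc ENNReal.ofReal (1 + δ) * (ENNReal.ofReal (gramDet (N x)) * volume T)
          ≤ ENNReal.ofReal (1 + δ) * (ENNReal.ofReal ((1 - δ)⁻¹) ^ (2 * k) *
              Measure.euclideanHausdorffMeasure (2 * k) (f '' T)) := by gcongr
        _ = ENNReal.ofReal ((1 + δ) * ((1 - δ)⁻¹) ^ (2 * k)) *
              Measure.euclideanHausdorffMeasure (2 * k) (f '' T) := by
            rw [← mul_assoc, ENNReal.ofReal_mul (by positivity),
              ENNReal.ofReal_pow (by positivity)]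
        _ ≤ _ := by gcongr
  have glob : ∀ η : ℝ, 1 < η → ρ S ≤ ENNReal.ofReal η * ν S ∧ ν S ≤ ENNReal.ofReal η * ρ S := by
    intro η hη
    constructor
    · refine measure_le_of_locally_le ρ ν _ O (fun x hx => ?_) hS hSO
      obtain ⟨U, h1, h2, h3⟩ := local_bound η hη x hx
      exact ⟨U, h1, h2, fun T hT hTm => (h3 T hT hTm).1⟩
    · refine measure_le_of_locally_le ν ρ _ O (fun x hx => ?_) hS hSO
      obtain ⟨U, h1, h2, h3⟩ := local_bound η hη x hx
      exact ⟨U, h1, h2, fun T hT hTm => (h3 T hT hTm).2⟩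
  -- The two-sided comparison holds with every factor `η > 1`; letting `η` decrease to `1` gives
  -- equality.
  have lim : ∀ a b : ℝ≥0∞, (∀ η : ℝ, 1 < η → a ≤ ENNReal.ofReal η * b) → a ≤ b := by
    intro a b hab
    have ht : Filter.Tendsto (fun η : ℝ => ENNReal.ofReal η * b) (nhdsWithin 1 (Set.Ioi 1))
        (nhds (ENNReal.ofReal 1 * b)) := by
      refine ENNReal.Tendsto.mul_const ?_ (Or.inl (by simp))
      exact ((ENNReal.continuous_ofReal.tendsto 1).mono_left nhdsWithin_le_nhds)
    have := ge_of_tendsto ht (by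
      filter_upwards [eventually_mem_nhdsWithin] with η hη
      exact hab η hη)
    simpa using this
  rw [← hρ S hS hSO, ← hν S hS]
  exact le_antisymm (lim _ _ fun η hη => (glob η hη).1) (lim _ _ fun η hη => (glob η hη).2)

/-! ### Affine charts of projective space -/

theorem continuous_gramDet {k : ℕ} {W : Type*} [NormedAddCommGroup W] [InnerProductSpace ℂ W] :
    Continuous (gramDet : ((Fin k → ℂ) →L[ℂ] W) → ℝ) := by
  have h : Continuous fun N : (Fin k → ℂ) →L[ℂ] W =>
      (Matrix.gram ℂ fun j => N (Pi.single j 1)) := by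
    refine continuous_matrix fun a b => ?_
    simp only [Matrix.gram_apply]
    exact (ContinuousLinearMap.apply ℂ W (Pi.single a 1)).continuous.inner
      (ContinuousLinearMap.apply ℂ W (Pi.single b 1)).continuous
  exact Complex.continuous_re.comp h.matrix_det

/-- The linear part of the `i`-th affine chart. -/
def chartLin {m : ℕ} (i : Fin (m + 1)) : (Fin m → ℂ) →L[ℂ] V m :=
  LinearMap.toContinuousLinearMap
    { toFun := fun z => WithLp.toLp 2 (i.insertNth (0 : ℂ) z)
      map_add' := fun x y => by
        ext j
        refine Fin.succAboveCases i ?_ (fun j => ?_) j <;> simp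
      map_smul' := fun c x => by
        ext j
        refine Fin.succAboveCases i ?_ (fun j => ?_) j <;> simp }

@[simp] theorem chartLin_same {m : ℕ} (i : Fin (m + 1)) (z : Fin m → ℂ) : chartLin i z i = 0 := by
  simp [chartLin]

@[simp] theorem chartLin_succAbove {m : ℕ} (i : Fin (m + 1)) (z : Fin m → ℂ) (j : Fin m) :
    chartLin i z (i.succAbove j) = z j := by
  simp [chartLin]

/-- The homogeneous coordinates with `i`-th entry one of a point in the `i`-th affine chart. -/
def chartVec {m : ℕ} (i : Fin (m + 1)) (z : Fin m → ℂ) : V m :=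
  EuclideanSpace.single i 1 + chartLin i z

@[simp] theorem chartVec_same {m : ℕ} (i : Fin (m + 1)) (z : Fin m → ℂ) : chartVec i z i = 1 := by
  simp [chartVec]

@[simp] theorem chartVec_succAbove {m : ℕ} (i : Fin (m + 1)) (z : Fin m → ℂ) (j : Fin m) :
    chartVec i z (i.succAbove j) = z j := by
  simp [chartVec]

theorem chartVec_ne_zero {m : ℕ} (i : Fin (m + 1)) (z : Fin m → ℂ) : chartVec i z ≠ 0 := by
  intro h
  have := chartVec_same i z
  rw [h] at this
  simp at this

theorem chartVec_sub {m : ℕ} (i : Fin (m + 1)) (z z' : Fin m → ℂ) :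
    chartVec i z - chartVec i z' = chartLin i (z - z') := by
  simp [chartVec]

theorem continuous_chartVec {m : ℕ} (i : Fin (m + 1)) : Continuous (chartVec i) :=
  continuous_const.add (chartLin i).continuous

/-- The `i`-th affine chart `ℂ^m → ℂℙ^m`. -/
def chart {m : ℕ} (i : Fin (m + 1)) (z : Fin m → ℂ) : CP m :=
  CP.mk (chartVec i z) (chartVec_ne_zero i z)

/-- Affine coordinates in the `i`-th chart. -/
def chartInv {m : ℕ} (i : Fin (m + 1)) (p : CP m) : Fin m → ℂ :=
  fun j => p.rep (i.succAbove j) / p.rep i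

theorem chartInv_chart {m : ℕ} (i : Fin (m + 1)) (z : Fin m → ℂ) :
    chartInv i (chart i z) = z := by
  obtain ⟨c, hc, h⟩ := CP.exists_rep_mk (chartVec i z) (chartVec_ne_zero i z)
  ext j
  simp only [chartInv, chart, h]
  simp [hc]

theorem chartVec_chartInv {m : ℕ} (i : Fin (m + 1)) (p : CP m) (hp : p.rep i ≠ 0) :
    chartVec i (chartInv i p) = (p.rep i)⁻¹ • p.rep := by
  ext j
  refine Fin.succAboveCases i ?_ (fun j => ?_) j
  · simp [hp]
  · simp [chartInv, div_eq_inv_mul]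

theorem chart_chartInv {m : ℕ} (i : Fin (m + 1)) (p : CP m) (hp : p.rep i ≠ 0) :
    chart i (chartInv i p) = p := by
  rw [← CP.mk_rep p]
  conv_rhs => rw [← CP.mk_smul p.rep p.rep_ne_zero (inv_ne_zero hp)]
  simp only [chart]
  rw [CP.mk_eq_mk_iff]
  refine ⟨1, ?_⟩
  rw [one_smul, CP.mk_rep, chartVec_chartInv i p hp]

theorem chart_injective {m : ℕ} (i : Fin (m + 1)) : Function.Injective (chart (m := m) i) :=
  Function.LeftInverse.injective (chartInv_chart i)

/-- The affine lift makes differences of homogeneous coordinates exactly `chartLin` of differences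
of `ζ`. Half of `ε` is spent on the strict derivative of the distance and half on that of `ζ`. -/
theorem hasMetricDerivAt_chart_comp {m k : ℕ} (i : Fin (m + 1)) {ζ : (Fin k → ℂ) → Fin m → ℂ}
    {L : (Fin k → ℂ) →L[ℂ] (Fin m → ℂ)} {t : Fin k → ℂ} (hζ : HasStrictFDerivAt ζ L t) :
    HasMetricDerivAt (fun t => chart i (ζ t))
      ((fsMap (chartVec i (ζ t))).comp ((chartLin i).comp L)) t := by
  intro ε hε
  set A := (fsMap (chartVec i (ζ t))).comp (chartLin i) with hA
  -- A Lipschitz constant near `t` for the lifted map; the summand `1` in the factor with `‖L‖`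
  -- absorbs the linearization error, and the last `1` keeps `B` positive.
  set B := ‖chartLin (m := m) i‖ * (‖L‖ + 1) + 1 with hB
  have hBpos : 0 < B := by positivity
  set δ := min 1 (ε / (2 * (‖A‖ + 1))) with hδ
  have hδpos : 0 < δ := by positivity
  have hψ : Filter.Tendsto (fun p : (Fin k → ℂ) × (Fin k → ℂ) =>
      (chartVec i (ζ p.1), chartVec i (ζ p.2))) (nhds (t, t))
      (nhds (chartVec i (ζ t), chartVec i (ζ t))) := by
    have h1 : ContinuousAt (fun t => chartVec i (ζ t)) t :=
      (continuous_chartVec i).continuousAt.comp hζ.continuousAt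
    exact h1.prodMap' h1
  have e1 := hψ.eventually (dist_mk_strict (chartVec_ne_zero i (ζ t))
    (by positivity : 0 < ε / (2 * B)))
  have e2 := hζ.isLittleO.def hδpos
  filter_upwards [e1, e2] with p h1 h2
  have h1 := h1 (chartVec_ne_zero i _) (chartVec_ne_zero i _)
  simp only [chartVec_sub] at h1
  set d := ‖p.2 - p.1‖ with hd
  have hd' : ‖p.1 - p.2‖ = d := norm_sub_rev _ _
  have hd0 : 0 ≤ d := norm_nonneg _
  rw [hd'] at h2
  have h3 : ‖ζ p.2 - ζ p.1 - L (p.2 - p.1)‖ ≤ δ * d := by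
    have : ζ p.2 - ζ p.1 - L (p.2 - p.1) = -(ζ p.1 - ζ p.2 - L (p.1 - p.2)) := by
      simp only [map_sub]; abel
    rw [this, norm_neg]; exact h2
  have h4 : ‖ζ p.2 - ζ p.1‖ ≤ (‖L‖ + 1) * d := by
    have h5 := norm_le_norm_add_norm_sub' (ζ p.2 - ζ p.1) (L (p.2 - p.1))
    have h6 := L.le_opNorm (p.2 - p.1)
    have h7 : δ * d ≤ 1 * d := mul_le_mul_of_nonneg_right (min_le_left _ _) hd0
    rw [← hd] at h6
    linarith
  have h5 : ‖chartLin i (ζ p.2 - ζ p.1)‖ ≤ B * d := by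
    refine ((chartLin i).le_opNorm _).trans ?_
    calc ‖chartLin (m := m) i‖ * ‖ζ p.2 - ζ p.1‖
        ≤ ‖chartLin (m := m) i‖ * ((‖L‖ + 1) * d) := by gcongr
      _ ≤ B * d := by rw [hB]; nlinarith
  have h6 : |‖A (ζ p.2 - ζ p.1)‖ - ‖A (L (p.2 - p.1))‖| ≤ ε / 2 * d := by
    refine (abs_norm_sub_norm_le _ _).trans ?_
    rw [← map_sub]
    refine (A.le_opNorm _).trans ?_
    calc ‖A‖ * ‖ζ p.2 - ζ p.1 - L (p.2 - p.1)‖ ≤ (‖A‖ + 1) * (δ * d) := by gcongr; linarith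
      _ ≤ (‖A‖ + 1) * ((ε / (2 * (‖A‖ + 1))) * d) := by
        gcongr
        exact min_le_right _ _
      _ = ε / 2 * d := by field_simp
  have h7 : ε / (2 * B) * ‖chartLin i (ζ p.2 - ζ p.1)‖ ≤ ε / 2 * d := by
    calc ε / (2 * B) * ‖chartLin i (ζ p.2 - ζ p.1)‖ ≤ ε / (2 * B) * (B * d) := by gcongr
      _ = ε / 2 * d := by field_simp
  have h8 := abs_sub_le (dist (chart i (ζ p.1)) (chart i (ζ p.2))) ‖A (ζ p.2 - ζ p.1)‖
    ‖A (L (p.2 - p.1))‖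
  have h9 : |dist (chart i (ζ p.1)) (chart i (ζ p.2)) - ‖A (ζ p.2 - ζ p.1)‖| ≤ ε / 2 * d :=
    h1.trans h7
  change |dist (chart i (ζ p.1)) (chart i (ζ p.2)) - ‖A (L (p.2 - p.1))‖| ≤ ε * d
  linarith

/-- The kernel of `fsMap w` is the line through `w`. Here `w` has `i`-th coordinate `1`, while the
image of `chartLin i` has `i`-th coordinate `0`. -/
theorem fsMap_chartLin_injective {m : ℕ} (i : Fin (m + 1)) (z : Fin m → ℂ) :
    Function.Injective ((fsMap (chartVec i z)).comp (chartLin i)) := by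
  rw [injective_iff_map_eq_zero]
  intro v hv
  have hw := chartVec_ne_zero i z
  have hn : (((√Real.pi * ‖chartVec i z‖)⁻¹ : ℝ) : ℂ) ≠ 0 := by
    have := norm_pos_iff.mpr hw
    have := Real.sqrt_pos.mpr Real.pi_pos
    exact_mod_cast (by positivity : (√Real.pi * ‖chartVec i z‖)⁻¹ ≠ 0)
  rw [ContinuousLinearMap.comp_apply, fsMap_apply, smul_eq_zero] at hv
  have h1 := sub_eq_zero.mp (hv.resolve_left hn)
  have h2 := congrArg (fun x : V m => x i) h1
  simp only [chartLin_same, PiLp.smul_apply, chartVec_same, smul_eq_mul, mul_one] at h2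
  rw [← h2, zero_smul] at h1
  ext j
  have h3 := congrArg (fun x : V m => x (i.succAbove j)) h1
  simpa using h3

theorem continuous_chart {m : ℕ} (i : Fin (m + 1)) : Continuous (chart (m := m) i) :=
  continuous_iff_continuousAt.mpr fun z =>
    (hasMetricDerivAt_chart_comp i (ζ := id) (hasStrictFDerivAt_id z)).continuousAt

theorem measurableEmbedding_chart {m : ℕ} (i : Fin (m + 1)) :
    MeasurableEmbedding (chart (m := m) i) :=
  (continuous_chart i).measurableEmbedding (chart_injective i)

theorem continuous_fsMap_chart {m : ℕ} (i : Fin (m + 1)) :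
    Continuous fun z : Fin m → ℂ => (fsMap (chartVec i z)).comp (chartLin i) := by
  have h : Continuous fun z : Fin m → ℂ => fsMap (chartVec i z) :=
    continuous_iff_continuousAt.mpr fun z =>
      (continuousAt_fsMap (chartVec_ne_zero i z)).comp (continuous_chartVec i).continuousAt
  exact h.clm_comp continuous_const

/-- A measurable piece of the `i`-th chart: the points at which the `i`-th homogeneous coordinate
is the first one of maximal absolute value. -/
def chartPiece {m : ℕ} (i : Fin (m + 1)) : Set (Fin m → ℂ) :=
  {z | ∀ j, ‖z j‖ ≤ 1 ∧ (i.succAbove j < i → ‖z j‖ < 1)}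

theorem measurableSet_chartPiece {m : ℕ} (i : Fin (m + 1)) : MeasurableSet (chartPiece i) := by
  have : chartPiece i = ⋂ j, ({z : Fin m → ℂ | ‖z j‖ ≤ 1} ∩
      {z : Fin m → ℂ | i.succAbove j < i → ‖z j‖ < 1}) := by
    ext z; simp [chartPiece]
  rw [this]
  refine MeasurableSet.iInter fun j => MeasurableSet.inter ?_ ?_
  · exact measurableSet_le (measurable_pi_apply j).norm measurable_const
  · by_cases h : i.succAbove j < i
    · simp only [h, true_imp_iff]
      exact measurableSet_lt (measurable_pi_apply j).norm measurable_const
    · simp [h]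

theorem mem_chart_image_chartPiece {m : ℕ} (i : Fin (m + 1)) (p : CP m) :
    p ∈ chart i '' chartPiece i ↔
      ∀ j, ‖p.rep j‖ ≤ ‖p.rep i‖ ∧ (j < i → ‖p.rep j‖ < ‖p.rep i‖) := by
  constructor
  · rintro ⟨z, hz, rfl⟩ j
    obtain ⟨c, hc, h⟩ := CP.exists_rep_mk (chartVec i z) (chartVec_ne_zero i z)
    have hc' : 0 < ‖c‖ := norm_pos_iff.mpr hc
    simp only [chart, h]
    refine Fin.succAboveCases i ?_ (fun j => ?_) j
    · simp
    · have := hz j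
      simp only [PiLp.smul_apply, chartVec_succAbove, chartVec_same, smul_eq_mul, mul_one, norm_mul]
      exact ⟨by nlinarith [this.1], fun hj => by nlinarith [this.2 hj]⟩
  · intro h
    have hi : p.rep i ≠ 0 := by
      intro h0
      apply p.rep_ne_zero
      ext j
      have := (h j).1
      rw [h0, norm_zero] at this
      simpa using this
    have hi' : 0 < ‖p.rep i‖ := norm_pos_iff.mpr hi
    refine ⟨chartInv i p, fun j => ?_, chart_chartInv i p hi⟩
    simp only [chartInv, norm_div]
    rw [div_le_one hi', div_lt_one hi']
    exact h _

theorem iUnion_chart_image {m : ℕ} : ⋃ i : Fin (m + 1), chart i '' chartPiece i = Set.univ := by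
  rw [Set.eq_univ_iff_forall]
  intro p
  obtain ⟨i0, hi0⟩ := Finite.exists_max fun j => ‖p.rep j‖
  have hne : (Finset.univ.filter fun i => ∀ j, ‖p.rep j‖ ≤ ‖p.rep i‖).Nonempty :=
    ⟨i0, by simpa using hi0⟩
  -- The smallest among the maximizing indices, so that all earlier coordinates are strictly
  -- smaller.
  let i := Finset.min' _ hne
  have hi : ∀ j, ‖p.rep j‖ ≤ ‖p.rep i‖ := by
    simpa using Finset.min'_mem _ hne
  rw [Set.mem_iUnion]
  refine ⟨i, (mem_chart_image_chartPiece i p).mpr fun j => ⟨hi j, fun hj => ?_⟩⟩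
  refine lt_of_le_of_ne (hi j) fun heq => ?_
  have : i ≤ j := Finset.min'_le _ _ (by simpa [heq] using hi)
  exact absurd hj (not_lt.mpr this)

theorem disjoint_chart_image {m : ℕ} :
    Pairwise (Function.onFun Disjoint fun i : Fin (m + 1) => chart i '' chartPiece i) := by
  intro i j hij
  rw [Function.onFun, Set.disjoint_left]
  intro p hp hq
  rw [mem_chart_image_chartPiece] at hp hq
  rcases lt_or_gt_of_ne hij with h | h
  · exact absurd (hp j).1 (not_le.mpr ((hq i).2 h))
  · exact absurd (hq i).1 (not_le.mpr ((hp j).2 h))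

theorem chartPiece_subset {m : ℕ} (i : Fin (m + 1)) :
    chartPiece i ⊆ Metric.closedBall 0 1 := by
  intro z hz
  rw [mem_closedBall_zero_iff, pi_norm_le_iff_of_nonneg zero_le_one]
  exact fun j => (hz j).1

/-! ### Gram determinants and powers of Hermitian forms -/

section Gram

variable {W : Type*} [NormedAddCommGroup W] [InnerProductSpace ℂ W]

/-- An orthonormal basis of the range is pulled back along `N`. The matrix `M` expresses the
standard basis in it, and the Gram matrix of `N` is `Mᴴ M`. -/
theorem exists_unitary_frame {m : ℕ} (N : (Fin m → ℂ) →L[ℂ] W) (hN : Function.Injective N) :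
    ∃ (f : Fin m → Fin m → ℂ) (M : Matrix (Fin m) (Fin m) ℂ),
      (Orthonormal ℂ fun i => N (f i)) ∧
      (∀ x, N x ∈ Submodule.span ℂ (Set.range fun i => N (f i))) ∧
      (∀ j, (Pi.single j 1 : Fin m → ℂ) = ∑ i, M i j • f i) ∧
      gramDet N = ‖M.det‖ ^ 2 := by
  let R := N.toLinearMap.range
  let N' : (Fin m → ℂ) ≃ₗ[ℂ] R := LinearEquiv.ofInjective N.toLinearMap hN
  have : FiniteDimensional ℂ R := N'.finiteDimensional
  have hfin : Module.finrank ℂ R = m := by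
    rw [← N'.finrank_eq]; simp
  let o : OrthonormalBasis (Fin m) ℂ R := (stdOrthonormalBasis ℂ R).reindex (finCongr hfin)
  have hNf : ∀ x : R, N (N'.symm x) = (x : W) := fun x =>
    congrArg Subtype.val (N'.apply_symm_apply x)
  let M : Matrix (Fin m) (Fin m) ℂ := fun i j => inner ℂ (o i) (N' (Pi.single j 1))
  have hM : ∀ j, (Pi.single j 1 : Fin m → ℂ) = ∑ i, M i j • N'.symm (o i) := by
    intro j
    apply N'.injective
    rw [map_sum]
    simp only [map_smul, LinearEquiv.apply_symm_apply, M]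
    exact (o.sum_repr' _).symm
  refine ⟨fun i => N'.symm (o i), M, ?_, ?_, hM, ?_⟩
  · simp only [hNf]
    exact o.orthonormal.comp_linearIsometry R.subtypeₗᵢ
  · intro x
    simp only [hNf]
    have : N x = ((N' x : R) : W) := rfl
    rw [this, ← o.sum_repr (N' x)]
    push_cast
    exact Submodule.sum_mem _ fun i _ => Submodule.smul_mem _ _ (Submodule.subset_span ⟨i, rfl⟩)
  · have hg : Matrix.gram ℂ (fun j => N (Pi.single j 1)) = M.conjTranspose * M := by
      ext i j
      have : ∀ j, N (Pi.single j 1) = ((N' (Pi.single j 1) : R) : W) := fun _ => rfl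
      rw [Matrix.gram_apply, this, this, ← Submodule.coe_inner, Matrix.mul_apply,
        ← o.sum_inner_mul_inner]
      refine Finset.sum_congr rfl fun l _ => ?_
      rw [← inner_conj_symm]
      rfl
    rw [gramDet, hg, Matrix.det_mul, Matrix.det_conjTranspose]
    have := Complex.conj_mul' M.det
    rw [show star M.det = (starRingEnd ℂ) M.det from rfl, this]
    norm_cast

theorem wedge_hform_eq_gramDet {ℓ k m : ℕ} (hm : ℓ + k = m) (h : 2 * ℓ + 2 * k = 2 * m)
    (N : (Fin m → ℂ) →L[ℂ] W) (hN : Function.Injective N) :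
    wedgeAt h (wedgeProd ℓ fun _ => hform N.toLinearMap) (wedgeProd k fun _ => hform N.toLinearMap)
      (cframe fun j => (Pi.single j 1 : Fin m → ℂ)) = (m.factorial : ℂ) * (gramDet N : ℂ) := by
  obtain ⟨f, M, ho, hs, hM, hg⟩ := exists_unitary_frame N hN
  rw [funext hM, map_cframe_matrix, wedge_hform_pow hm h N.toLinearMap f ho hs, hg]
  push_cast
  ring

theorem wedgeProd_hform_eq_gramDet {k : ℕ}
    (N : (Fin k → ℂ) →L[ℂ] W) (hN : Function.Injective N) :
    wedgeProd k (fun _ => hform N.toLinearMap) (cframe fun j => (Pi.single j 1 : Fin k → ℂ)) =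
      (k.factorial : ℂ) * (gramDet N : ℂ) := by
  obtain ⟨f, M, ho, hs, hM, hg⟩ := exists_unitary_frame N hN
  rw [funext hM, map_cframe_matrix, wedgeProd_hform_pow N.toLinearMap f ho hs, hg]
  push_cast
  ring

/-- The identification of `ℂ^ℓ × ℂ^k` with `ℂ^m`. -/
def splitEquiv {ℓ k m : ℕ} (hm : ℓ + k = m) :
    ((Fin ℓ → ℂ) × (Fin k → ℂ)) ≃L[ℂ] (Fin m → ℂ) :=
  LinearEquiv.toContinuousLinearEquiv
    { toFun := fun p j => Fin.append p.1 p.2 (Fin.cast hm.symm j)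
      map_add' := fun p q => by
        ext j
        obtain ⟨j, rfl⟩ : ∃ j', j = Fin.cast hm j' := ⟨Fin.cast hm.symm j, by simp⟩
        refine Fin.addCases (fun a => ?_) (fun a => ?_) j <;> simp
      map_smul' := fun c p => by
        ext j
        obtain ⟨j, rfl⟩ : ∃ j', j = Fin.cast hm j' := ⟨Fin.cast hm.symm j, by simp⟩
        refine Fin.addCases (fun a => ?_) (fun a => ?_) j <;> simp
      invFun := fun z => (fun a => z (Fin.cast hm (Fin.castAdd k a)),
        fun a => z (Fin.cast hm (Fin.natAdd ℓ a)))
      left_inv := fun p => by ext <;> simp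
      right_inv := fun z => by
        ext j
        obtain ⟨j, rfl⟩ : ∃ j', j = Fin.cast hm j' := ⟨Fin.cast hm.symm j, by simp⟩
        refine Fin.addCases (fun a => ?_) (fun a => ?_) j <;> simp }

theorem splitEquiv_castAdd {ℓ k m : ℕ} (hm : ℓ + k = m) (p : (Fin ℓ → ℂ) × (Fin k → ℂ))
    (a : Fin ℓ) : splitEquiv hm p (Fin.cast hm (Fin.castAdd k a)) = p.1 a := by
  simp [splitEquiv]

theorem splitEquiv_natAdd {ℓ k m : ℕ} (hm : ℓ + k = m) (p : (Fin ℓ → ℂ) × (Fin k → ℂ))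
    (a : Fin k) : splitEquiv hm p (Fin.cast hm (Fin.natAdd ℓ a)) = p.2 a := by
  simp [splitEquiv]

theorem splitEquiv_single_left {ℓ k m : ℕ} (hm : ℓ + k = m) (a : Fin ℓ) :
    splitEquiv hm (Pi.single a 1, 0) = Pi.single (Fin.cast hm (Fin.castAdd k a)) 1 := by
  subst hm
  ext j
  refine Fin.addCases (fun b => ?_) (fun b => ?_) j
  · have := splitEquiv_castAdd (k := k) rfl (Pi.single a 1, 0) b
    simp only [Fin.cast_eq_self] at this ⊢
    rw [this]
    simp [Pi.single_apply]
  · have := splitEquiv_natAdd (ℓ := ℓ) (k := k) rfl (Pi.single a 1, 0) b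
    simp only [Fin.cast_eq_self] at this ⊢
    rw [this]
    have hne : Fin.natAdd ℓ b ≠ Fin.castAdd k a := fun h => by
      have := congrArg Fin.val h; simp at this; omega
    simp [hne]

theorem splitEquiv_single_right {ℓ k m : ℕ} (hm : ℓ + k = m) (a : Fin k) :
    splitEquiv hm (0, Pi.single a 1) = Pi.single (Fin.cast hm (Fin.natAdd ℓ a)) 1 := by
  subst hm
  ext j
  refine Fin.addCases (fun b => ?_) (fun b => ?_) j
  · have := splitEquiv_castAdd (ℓ := ℓ) (k := k) rfl (0, Pi.single a 1) b
    simp only [Fin.cast_eq_self] at this ⊢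
    rw [this]
    have hne : Fin.castAdd k b ≠ Fin.natAdd ℓ a := fun h => by
      have := congrArg Fin.val h; simp at this; omega
    simp [hne]
  · have := splitEquiv_natAdd (ℓ := ℓ) (k := k) rfl (0, Pi.single a 1) b
    simp only [Fin.cast_eq_self] at this ⊢
    rw [this]
    simp [Pi.single_apply]

theorem splitEquiv_measurePreserving {ℓ k m : ℕ} (hm : ℓ + k = m) :
    MeasurePreserving (splitEquiv hm) := by
  subst hm
  have h1 := (volume_measurePreserving_sumPiEquivProdPi_symm
    (fun _ : Fin ℓ ⊕ Fin k => ℂ))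
  have h2 := volume_measurePreserving_piCongrLeft (fun _ : Fin (ℓ + k) => ℂ) finSumFinEquiv
  have h3 := h2.comp h1
  have hfun : ⇑(splitEquiv (rfl : ℓ + k = ℓ + k)) =
      (MeasurableEquiv.piCongrLeft (fun _ : Fin (ℓ + k) => ℂ) finSumFinEquiv) ∘
        (MeasurableEquiv.sumPiEquivProdPi fun _ : Fin ℓ ⊕ Fin k => ℂ).symm := by
    ext p j
    refine Fin.addCases (fun b => ?_) (fun b => ?_) j
    · have := splitEquiv_castAdd (ℓ := ℓ) (k := k) rfl p b
      simp only [Fin.cast_eq_self] at this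
      rw [this]
      have e : Fin.castAdd k b = finSumFinEquiv (Sum.inl b) := by simp
      rw [e]
      simp only [Function.comp_apply, MeasurableEquiv.coe_piCongrLeft,
        Equiv.piCongrLeft_apply_apply]
      rfl
    · have := splitEquiv_natAdd (ℓ := ℓ) (k := k) rfl p b
      simp only [Fin.cast_eq_self] at this
      rw [this]
      have e : Fin.natAdd ℓ b = finSumFinEquiv (Sum.inr b) := by simp
      rw [e]
      simp only [Function.comp_apply, MeasurableEquiv.coe_piCongrLeft,
        Equiv.piCongrLeft_apply_apply]
      rfl
  rw [hfun]
  exact h3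

/-- The top-degree form `β_{Y₁} ∧ ⋯ ∧ β_{Y_ℓ} ∧ φ` on the standard frame, for two maps `(Y, π)` that
are jointly invertible. -/
theorem wedge_split {ℓ k m : ℕ} (hm : ℓ + k = m) (h : 2 * ℓ + 2 * k = 2 * m)
    (Λ : (Fin m → ℂ) ≃L[ℂ] (Fin m → ℂ)) (Y : (Fin m → ℂ) →L[ℂ] (Fin ℓ → ℂ))
    (hY : ∀ v, ((splitEquiv hm).symm (Λ v)).1 = Y v)
    (φ : (Fin m → ℂ) [⋀^Fin (2 * k)]→ₗ[ℝ] ℂ) :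
    wedgeAt h (wedgeProd ℓ fun i => hform ((LinearMap.proj i).comp Y.toLinearMap)) φ
        (cframe fun j => (Pi.single j 1 : Fin m → ℂ)) =
      ((‖LinearMap.det Λ.toLinearMap‖ ^ 2 : ℝ) : ℂ) *
        φ (cframe fun j => Λ.symm (splitEquiv hm (0, Pi.single j 1))) := by
  let e : Fin m → Fin m → ℂ := fun j => Λ.symm (Pi.single j 1)
  have hYe : ∀ p, Y (Λ.symm (splitEquiv hm p)) = p.1 := by
    intro p
    rw [← hY]; simp
  rw [wedge_pullback_volume hm h _ φ _ e (LinearMap.toMatrix' Λ.toLinearMap)]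
  · rw [LinearMap.det_toMatrix']
    simp only [e, splitEquiv_single_right]
  · intro j
    apply Λ.injective
    rw [map_sum]
    simp only [map_smul, e, ContinuousLinearEquiv.apply_symm_apply]
    ext i
    simp [Finset.sum_apply, Pi.single_apply, LinearMap.toMatrix'_apply]
  · intro i j
    simp only [e, ← splitEquiv_single_left, LinearMap.comp_apply, ContinuousLinearMap.coe_coe]
    rw [hYe]
    simp [Pi.single_apply]
  · intro i j
    simp only [e, ← splitEquiv_single_right, LinearMap.comp_apply, ContinuousLinearMap.coe_coe]
    rw [hYe]
    simp

end Gram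

/-! ### Families of level sets -/

section Families

variable {ℓ k m : ℕ} {B : Type*} [NormedAddCommGroup B] [NormedSpace ℂ B]

/-- The partial derivative of `g` in the second variable. -/
def vertDeriv (g : B × (Fin m → ℂ) → Fin ℓ → ℂ) (x : B × (Fin m → ℂ)) :
    (Fin m → ℂ) →L[ℂ] (Fin ℓ → ℂ) :=
  (fderiv ℂ g x).comp (ContinuousLinearMap.inr ℂ B (Fin m → ℂ))

theorem continuous_vertDeriv {g : B × (Fin m → ℂ) → Fin ℓ → ℂ} (hg : ContDiff ℂ 1 g) :
    Continuous (vertDeriv g) :=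
  (hg.continuous_fderiv (by simp)).clm_comp continuous_const

/-- The endomorphism `(Y, π)` of `ℂ^m`. -/
def splitEndo (hm : ℓ + k = m) (Y : (Fin m → ℂ) →L[ℂ] (Fin ℓ → ℂ))
    (π : (Fin m → ℂ) →L[ℂ] (Fin k → ℂ)) : (Fin m → ℂ) →L[ℂ] (Fin m → ℂ) :=
  (splitEquiv hm).toContinuousLinearMap.comp (Y.prod π)

theorem splitEndo_apply (hm : ℓ + k = m) (Y : (Fin m → ℂ) →L[ℂ] (Fin ℓ → ℂ))
    (π : (Fin m → ℂ) →L[ℂ] (Fin k → ℂ)) (v : Fin m → ℂ) :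
    splitEndo hm Y π v = splitEquiv hm (Y v, π v) := rfl

theorem continuous_splitEndo (hm : ℓ + k = m) {T : Type*} [TopologicalSpace T]
    {Y : T → (Fin m → ℂ) →L[ℂ] (Fin ℓ → ℂ)} (hY : Continuous Y)
    (π : (Fin m → ℂ) →L[ℂ] (Fin k → ℂ)) : Continuous fun t => splitEndo hm (Y t) π := by
  have h : Continuous fun t => (ContinuousLinearMap.prodₗᵢ ℂ) (Y t, π) :=
    (LinearIsometryEquiv.continuous _).comp (hY.prodMk continuous_const)
  exact continuous_const.clm_comp h

/-- Take for `π` a projection onto the kernel of `Y`, identified with `ℂ^k` by a dimension count. A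
vector annihilated by both `Y` and `π` lies in the kernel and projects to zero, so vanishes. -/
theorem exists_complementary_map (hm : ℓ + k = m) (Y : (Fin m → ℂ) →L[ℂ] (Fin ℓ → ℂ))
    (hY : Function.Surjective Y) :
    ∃ π : (Fin m → ℂ) →L[ℂ] (Fin k → ℂ), (splitEndo hm Y π).det ≠ 0 := by
  have hdim : Module.finrank ℂ Y.toLinearMap.ker = Module.finrank ℂ (Fin k → ℂ) := by
    have h1 := Y.toLinearMap.finrank_range_add_finrank_ker
    have h2 : Y.toLinearMap.range = ⊤ := LinearMap.range_eq_top.mpr hY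
    rw [h2] at h1
    simp only [finrank_top, Module.finrank_fintype_fun_eq_card, Fintype.card_fin] at h1 ⊢
    omega
  let θ := LinearEquiv.ofFinrankEq _ _ hdim
  obtain ⟨p, hp⟩ := Y.toLinearMap.ker.subtype.exists_leftInverse_of_injective
    (Submodule.ker_subtype _)
  let π : (Fin m → ℂ) →L[ℂ] (Fin k → ℂ) := LinearMap.toContinuousLinearMap (θ.toLinearMap.comp p)
  refine ⟨π, ?_⟩
  have hinj : Function.Injective (splitEndo hm Y π) := by
    rw [injective_iff_map_eq_zero]
    intro v hv
    rw [splitEndo_apply, map_eq_zero_iff _ (splitEquiv hm).injective] at hv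
    have h1 : Y v = 0 := congrArg Prod.fst hv
    have h2 : θ (p v) = 0 := congrArg Prod.snd hv
    have h3 : p v = ⟨v, h1⟩ := LinearMap.congr_fun hp ⟨v, h1⟩
    rw [map_eq_zero_iff _ θ.injective, h3] at h2
    exact congrArg Subtype.val h2
  have := LinearMap.isUnit_iff_ker_eq_bot (splitEndo hm Y π).toLinearMap |>.mpr
    (LinearMap.ker_eq_bot.mpr hinj)
  exact (LinearMap.isUnit_iff_isUnit_det _).mp this |>.ne_zero

theorem splitEndo_injective {hm : ℓ + k = m} {Y : (Fin m → ℂ) →L[ℂ] (Fin ℓ → ℂ)}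
    {π : (Fin m → ℂ) →L[ℂ] (Fin k → ℂ)} (h : (splitEndo hm Y π).det ≠ 0) :
    Function.Injective (splitEndo hm Y π) := by
  have := (LinearMap.isUnit_iff_isUnit_det (splitEndo hm Y π).toLinearMap).mpr
    (isUnit_iff_ne_zero.mpr h)
  exact LinearMap.ker_eq_bot.mp ((LinearMap.isUnit_iff_ker_eq_bot _).mp this)

theorem surjective_of_splitEndo {hm : ℓ + k = m} {Y : (Fin m → ℂ) →L[ℂ] (Fin ℓ → ℂ)}
    {π : (Fin m → ℂ) →L[ℂ] (Fin k → ℂ)} (h : (splitEndo hm Y π).det ≠ 0) :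
    Function.Surjective Y := by
  intro y
  obtain ⟨v, hv⟩ := LinearMap.injective_iff_surjective (f := (splitEndo hm Y π).toLinearMap) |>.mp
    (splitEndo_injective h) (splitEquiv hm (y, 0))
  have : splitEquiv hm (Y v, π v) = splitEquiv hm (y, 0) := hv
  exact ⟨v, congrArg Prod.fst ((splitEquiv hm).injective this)⟩

/-- This is the inverse function theorem for `(b, z) ↦ (b, g(b, z), π z)`. Its derivative is block
triangular with vertical block `(∂_z g, π)`, so invertibility is a condition on that determinant
alone, and vertical vectors are carried to vertical vectors. -/
theorem exists_local_chart [FiniteDimensional ℂ B] (hm : ℓ + k = m)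
    {g : B × (Fin m → ℂ) → Fin ℓ → ℂ}
    (hg : ContDiff ℂ 1 g) (x₀ : B × (Fin m → ℂ)) (hs : Function.Surjective (vertDeriv g x₀)) :
    ∃ (π : (Fin m → ℂ) →L[ℂ] (Fin k → ℂ))
      (e : OpenPartialHomeomorph (B × (Fin m → ℂ)) (B × (Fin m → ℂ))), x₀ ∈ e.source ∧
      (∀ x, e x = (x.1, splitEquiv hm (g x, π x.2))) ∧
      (∀ x ∈ e.source, (splitEndo hm (vertDeriv g x) π).det ≠ 0) ∧
      ∀ q ∈ e.target, ∃ E' : (B × (Fin m → ℂ)) →L[ℂ] (B × (Fin m → ℂ)),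
        HasStrictFDerivAt e.symm E' q ∧
        ∀ v, E' (0, splitEndo hm (vertDeriv g (e.symm q)) π v) = (0, v) := by
  have : CompleteSpace B := FiniteDimensional.complete ℂ B
  obtain ⟨π, hπ⟩ := exists_complementary_map hm _ hs
  let Ψ : B × (Fin m → ℂ) → B × (Fin m → ℂ) := fun x => (x.1, splitEquiv hm (g x, π x.2))
  let Ψ' : B × (Fin m → ℂ) → (B × (Fin m → ℂ)) →L[ℂ] (B × (Fin m → ℂ)) := fun x =>
    (ContinuousLinearMap.fst ℂ _ _).prod ((splitEquiv hm).toContinuousLinearMap.comp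
      ((fderiv ℂ g x).prod (π.comp (ContinuousLinearMap.snd ℂ _ _))))
  have hΨ : ∀ x, HasStrictFDerivAt Ψ (Ψ' x) x := fun x =>
    hasStrictFDerivAt_fst.prodMk ((splitEquiv hm).hasStrictFDerivAt.comp x
      ((hg.contDiffAt.hasStrictFDerivAt (by simp)).prodMk
        (π.hasStrictFDerivAt.comp x hasStrictFDerivAt_snd)))
  have hΨv : ∀ x v, Ψ' x (0, v) = (0, splitEndo hm (vertDeriv g x) π v) := fun x v => rfl
  have hinj : ∀ x, (splitEndo hm (vertDeriv g x) π).det ≠ 0 → Function.Injective (Ψ' x) := by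
    intro x hx
    rw [injective_iff_map_eq_zero]
    rintro ⟨β, v⟩ hv
    have h1 : β = 0 := congrArg Prod.fst hv
    subst h1
    rw [hΨv] at hv
    have := (injective_iff_map_eq_zero _).mp (splitEndo_injective hx) v (congrArg Prod.snd hv)
    rw [this]; rfl
  have hequiv : ∀ x, (splitEndo hm (vertDeriv g x) π).det ≠ 0 →
      ∃ f : (B × (Fin m → ℂ)) ≃L[ℂ] (B × (Fin m → ℂ)), (f : _ →L[ℂ] _) = Ψ' x := fun x hx =>
    ⟨(LinearEquiv.ofInjectiveEndo (Ψ' x).toLinearMap (hinj x hx)).toContinuousLinearEquiv, by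
      ext v <;> rfl⟩
  obtain ⟨f, hf⟩ := hequiv x₀ hπ
  have hs0 : HasStrictFDerivAt Ψ (f : _ →L[ℂ] _) x₀ := by rw [hf]; exact hΨ x₀
  have hcont : Continuous fun x => (splitEndo hm (vertDeriv g x) π).det :=
    ContinuousLinearMap.continuous_det.comp (continuous_splitEndo hm (continuous_vertDeriv hg) π)
  have hU : IsOpen {x | (splitEndo hm (vertDeriv g x) π).det ≠ 0} :=
    isOpen_ne.preimage hcont
  -- Restricting to the open set where the vertical determinant is nonzero makes the inverse
  -- strictly differentiable at every point of the target, not only at the image of `x₀`.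
  let e := (hs0.toOpenPartialHomeomorph Ψ).restrOpen _ hU
  have he : ∀ x, e x = Ψ x := fun x => rfl
  have hsrc : ∀ x ∈ e.source, (splitEndo hm (vertDeriv g x) π).det ≠ 0 := by
    intro x hx
    have : x ∈ (hs0.toOpenPartialHomeomorph Ψ).source ∩
        {x | (splitEndo hm (vertDeriv g x) π).det ≠ 0} := by
      simpa [e] using hx
    exact this.2
  refine ⟨π, e, ?_, he, hsrc, ?_⟩
  · have : x₀ ∈ (hs0.toOpenPartialHomeomorph Ψ).source ∩
        {x | (splitEndo hm (vertDeriv g x) π).det ≠ 0} :=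
      ⟨hs0.mem_toOpenPartialHomeomorph_source, hπ⟩
    simpa [e] using this
  · intro q hq
    have hx := hsrc _ (e.map_target hq)
    obtain ⟨F, hF⟩ := hequiv _ hx
    refine ⟨F.symm, e.hasStrictFDerivAt_symm hq ?_, ?_⟩
    · rw [hF]; exact hΨ _
    · intro v
      have h1 : F (0, v) = Ψ' (e.symm q) (0, v) := by rw [← hF]; rfl
      rw [hΨv] at h1
      rw [← h1]
      simp

theorem abs_det_restrictScalars {ι : Type*} [Fintype ι] (f : (ι → ℂ) →L[ℂ] (ι → ℂ)) :
    |(f.restrictScalars ℝ).det| = ‖f.det‖ ^ 2 := by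
  have h : (f.restrictScalars ℝ).det = Algebra.norm ℝ f.det := by
    have := LinearMap.det_restrictScalars (R := ℝ) (f := f.toLinearMap)
    exact this
  rw [h, Algebra.norm_complex_apply, Complex.normSq_eq_norm_sq, abs_of_nonneg (by positivity)]

/-- The form is pulled back by `Y` from `ℂ^ℓ`, whose real dimension `2ℓ` equals its degree. A
nonzero value would exhibit a basis of `ℂ^ℓ` in the range of `Y`. -/
theorem wedgeProd_eq_zero_of_not_surjective (Y : (Fin m → ℂ) →L[ℂ] (Fin ℓ → ℂ))
    (hY : ¬ Function.Surjective Y) :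
    (wedgeProd ℓ fun i => hform ((LinearMap.proj i).comp Y.toLinearMap)) = 0 := by
  have h : (wedgeProd ℓ fun i => hform ((LinearMap.proj i).comp Y.toLinearMap)) =
      (wedgeProd ℓ fun i => hform (LinearMap.proj i : (Fin ℓ → ℂ) →ₗ[ℂ] ℂ)).compLinearMap
        (Y.toLinearMap.restrictScalars ℝ) := by
    rw [wedgeProd_compLinearMap]; rfl
  rw [h]
  ext v
  simp only [AlternatingMap.compLinearMap_apply, AlternatingMap.zero_apply]
  refine AlternatingMap.map_linearDependent _ _ fun hli => hY ?_
  let Yr := Y.toLinearMap.restrictScalars ℝ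
  have h1 : Submodule.span ℝ (Set.range fun i => Yr (v i)) = ⊤ :=
    hli.span_eq_top_of_card_eq_finrank' (by simp [Module.finrank_pi_fintype]; ring)
  have h2 : Yr.range = ⊤ := by
    rw [eq_top_iff, ← h1, Submodule.span_le]
    rintro _ ⟨i, rfl⟩
    exact ⟨v i, rfl⟩
  exact (LinearMap.range_eq_top (f := Yr)).mp h2

end Families

/-! ### The coarea factor -/

section Families

variable {ℓ k m : ℕ} {B : Type*} [NormedAddCommGroup B] [NormedSpace ℂ B]

/-- The form `β_{Y₁} ∧ ⋯ ∧ β_{Y_ℓ}`, where `β_λ(u, v) = Im (conj (λ u) λ v)`. -/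
def levelForm (Y : (Fin m → ℂ) →L[ℂ] (Fin ℓ → ℂ)) : (Fin m → ℂ) [⋀^Fin (2 * ℓ)]→ₗ[ℝ] ℂ :=
  wedgeProd ℓ fun i => hform ((LinearMap.proj i).comp Y.toLinearMap)

/-- The standard real frame of `ℂ^m`. -/
def stdFrame (m : ℕ) : Fin (2 * m) → Fin m → ℂ := cframe fun j => (Pi.single j 1 : Fin m → ℂ)

theorem two_mul_add {ℓ k m : ℕ} (hm : ℓ + k = m) : 2 * ℓ + 2 * k = 2 * m := by omega

/-- `D` is the inverse of `(Y, π)` restricted to `0 × ℂ^k`, hence a parametrization of the kernel of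
`Y`. In the frame adapted to `(Y, π)` the first factor of the wedge only sees the first block, which
leaves `φ` on the kernel times the real Jacobian `|det (Y, π)|²`. -/
theorem exists_kernel_frame (hm : ℓ + k = m) (Y : (Fin m → ℂ) →L[ℂ] (Fin ℓ → ℂ))
    (π : (Fin m → ℂ) →L[ℂ] (Fin k → ℂ)) (hd : (splitEndo hm Y π).det ≠ 0) :
    ∃ D : (Fin k → ℂ) →L[ℂ] (Fin m → ℂ), Function.Injective D ∧
      (∀ t, splitEndo hm Y π (D t) = splitEquiv hm (0, t)) ∧
      ∀ φ : (Fin m → ℂ) [⋀^Fin (2 * k)]→ₗ[ℝ] ℂ,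
        wedgeAt (two_mul_add hm) (levelForm Y) φ (stdFrame m) =
          ((‖(splitEndo hm Y π).det‖ ^ 2 : ℝ) : ℂ) * φ (cframe fun j => D (Pi.single j 1)) := by
  let Λ : (Fin m → ℂ) ≃L[ℂ] (Fin m → ℂ) :=
    (LinearEquiv.ofInjectiveEndo (splitEndo hm Y π).toLinearMap
      (splitEndo_injective hd)).toContinuousLinearEquiv
  have hΛ : ∀ v, Λ v = splitEndo hm Y π v := fun v => rfl
  let D : (Fin k → ℂ) →L[ℂ] (Fin m → ℂ) := Λ.symm.toContinuousLinearMap.comp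
    ((splitEquiv hm).toContinuousLinearMap.comp (ContinuousLinearMap.inr ℂ _ _))
  have hD : ∀ t, D t = Λ.symm (splitEquiv hm (0, t)) := fun t => rfl
  refine ⟨D, ?_, ?_, ?_⟩
  · intro s t hst
    rw [hD, hD] at hst
    have := (splitEquiv hm).injective (Λ.symm.injective hst)
    exact congrArg Prod.snd this
  · intro t
    rw [← hΛ, hD, ContinuousLinearEquiv.apply_symm_apply]
  · intro φ
    exact wedge_split hm (two_mul_add hm) Λ Y (fun v => by rw [hΛ, splitEndo_apply]; simp) φ

/-- The coarea factor of a map with derivative `Y`, for the metric with unitary frame map `A`. -/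
def coareaFactor {W : Type*} [NormedAddCommGroup W] [InnerProductSpace ℂ W] (hm : ℓ + k = m)
    (Y : (Fin m → ℂ) →L[ℂ] (Fin ℓ → ℂ)) (A : (Fin m → ℂ) →L[ℂ] W) : ℝ :=
  (wedgeAt (two_mul_add hm) (levelForm Y) (wedgeProd k fun _ => hform A.toLinearMap)
    (stdFrame m)).re / k.factorial

theorem wedgeProd_hform_cframe {W : Type*} [NormedAddCommGroup W] [InnerProductSpace ℂ W]
    (A : (Fin m → ℂ) →L[ℂ] W) (D : (Fin k → ℂ) →L[ℂ] (Fin m → ℂ))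
    (h : Function.Injective (A.comp D)) :
    wedgeProd k (fun _ => hform A.toLinearMap) (cframe fun j => D (Pi.single j 1)) =
      (k.factorial : ℂ) * (gramDet (A.comp D) : ℂ) := by
  rw [← wedgeProd_hform_eq_gramDet _ h]
  have h1 : (wedgeProd k fun _ => hform (A.comp D).toLinearMap) =
      (wedgeProd k fun _ => hform A.toLinearMap).compLinearMap (D.toLinearMap.restrictScalars ℝ) := by
    rw [wedgeProd_compLinearMap]; rfl
  rw [h1, AlternatingMap.compLinearMap_apply]
  congr 1
  exact funext fun j => (cframe_comp D.toLinearMap _ j).symm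

/-- The point is that the wedge is real, so passing to the real part in `coareaFactor` loses
nothing. -/
theorem wedge_levelForm_hform {W : Type*} [NormedAddCommGroup W] [InnerProductSpace ℂ W]
    (hm : ℓ + k = m) (Y : (Fin m → ℂ) →L[ℂ] (Fin ℓ → ℂ)) (hY : Function.Surjective Y)
    (A : (Fin m → ℂ) →L[ℂ] W) (hA : Function.Injective A) :
    wedgeAt (two_mul_add hm) (levelForm Y) (wedgeProd k fun _ => hform A.toLinearMap)
      (stdFrame m) = (k.factorial : ℂ) * (coareaFactor hm Y A : ℂ) := by
  obtain ⟨π, hd⟩ := exists_complementary_map hm Y hY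
  obtain ⟨D, hD, hDs, hφ⟩ := exists_kernel_frame hm Y π hd
  rw [coareaFactor, hφ, wedgeProd_hform_cframe A D (hA.comp hD)]
  have : (k.factorial : ℂ) ≠ 0 := by exact_mod_cast k.factorial_ne_zero
  rw [show ((‖(splitEndo hm Y π).det‖ ^ 2 : ℝ) : ℂ) * ((k.factorial : ℂ) * (gramDet (A.comp D) : ℂ))
    = ((‖(splitEndo hm Y π).det‖ ^ 2 * ((k.factorial : ℝ) * gramDet (A.comp D)) : ℝ) : ℂ) by
      push_cast; ring, Complex.ofReal_re]
  push_cast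
  field_simp

/-- The factor splits into the Jacobian of the coordinates `(Y, π)` and the volume density of the
level set in the parametrization `D`. The left side does not involve `π`, which allows local charts
to be glued. Uniqueness of `D` given `π` lets the frame of `exists_kernel_frame` be used. -/
theorem coareaFactor_eq {W : Type*} [NormedAddCommGroup W] [InnerProductSpace ℂ W]
    (hm : ℓ + k = m) (Y : (Fin m → ℂ) →L[ℂ] (Fin ℓ → ℂ))
    (π : (Fin m → ℂ) →L[ℂ] (Fin k → ℂ)) (hd : (splitEndo hm Y π).det ≠ 0)
    (A : (Fin m → ℂ) →L[ℂ] W) (hA : Function.Injective A) (D : (Fin k → ℂ) →L[ℂ] (Fin m → ℂ))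
    (hD : ∀ t, splitEndo hm Y π (D t) = splitEquiv hm (0, t)) :
    coareaFactor hm Y A = ‖(splitEndo hm Y π).det‖ ^ 2 * gramDet (A.comp D) ∧
      0 < gramDet (A.comp D) := by
  let _ : MeasurableSpace W := borel W
  have : BorelSpace W := ⟨rfl⟩
  obtain ⟨D', hD', hDs, hφ⟩ := exists_kernel_frame hm Y π hd
  have hDD : D = D' := by
    ext1 t
    exact splitEndo_injective hd ((hD t).trans (hDs t).symm)
  subst hDD
  have hinj : Function.Injective (A.comp D) := hA.comp hD'
  refine ⟨?_, (hausdorff_image_linear _ hinj).1⟩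
  have h1 := wedge_levelForm_hform hm Y (surjective_of_splitEndo hd) A hA
  rw [hφ, wedgeProd_hform_cframe A D hinj] at h1
  have h2 : (k.factorial : ℂ) ≠ 0 := by exact_mod_cast k.factorial_ne_zero
  have h3 : (coareaFactor hm Y A : ℂ) =
      ((‖(splitEndo hm Y π).det‖ ^ 2 * gramDet (A.comp D) : ℝ) : ℂ) := by
    apply mul_left_cancel₀ h2
    rw [← h1]; push_cast; ring
  exact_mod_cast h3

theorem continuous_wedgeAt {T E : Type*} [TopologicalSpace T] [AddCommGroup E] [Module ℝ E]
    {p q n : ℕ} (h : p + q = n) {α : T → E [⋀^Fin p]→ₗ[ℝ] ℂ} {β : T → E [⋀^Fin q]→ₗ[ℝ] ℂ}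
    (hα : ∀ v, Continuous fun t => α t v) (hβ : ∀ v, Continuous fun t => β t v) (v : Fin n → E) :
    Continuous fun t => wedgeAt h (α t) (β t) v := by
  simp only [wedgeAt_apply]
  exact continuous_finsetSum _ fun σ _ => continuous_const.mul ((hα _).mul (hβ _))

theorem continuous_wedgeProd {T E : Type*} [TopologicalSpace T] [AddCommGroup E] [Module ℝ E] :
    ∀ (ℓ : ℕ) (β : T → Fin ℓ → E [⋀^Fin 2]→ₗ[ℝ] ℂ) (_ : ∀ i v, Continuous fun t => β t i v)
      (v : Fin (2 * ℓ) → E), Continuous fun t => wedgeProd ℓ (β t) v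
  | 0, _, _, _ => continuous_const
  | ℓ + 1, _, hβ, v => continuous_wedgeAt _ (hβ 0)
      (continuous_wedgeProd ℓ _ fun i => hβ i.succ) v

theorem continuous_hform {T E W : Type*} [TopologicalSpace T] [NormedAddCommGroup E]
    [NormedSpace ℂ E] [NormedAddCommGroup W] [InnerProductSpace ℂ W] {A : T → E →L[ℂ] W}
    (hA : Continuous A) (v : Fin 2 → E) : Continuous fun t => hform (A t).toLinearMap v := by
  simp only [hform_apply]
  have h : ∀ u, Continuous fun t => A t u := fun u =>
    (ContinuousLinearMap.apply ℂ W u).continuous.comp hA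
  exact Complex.continuous_ofReal.comp (Complex.continuous_im.comp ((h _).inner (h _)))

theorem continuous_levelForm {T : Type*} [TopologicalSpace T]
    {Y : T → (Fin m → ℂ) →L[ℂ] (Fin ℓ → ℂ)} (hY : Continuous Y) (v : Fin (2 * ℓ) → Fin m → ℂ) :
    Continuous fun t => levelForm (Y t) v := by
  refine continuous_wedgeProd ℓ _ (fun i v => ?_) v
  have : Continuous fun t => (ContinuousLinearMap.proj (R := ℂ) (φ := fun _ : Fin ℓ => ℂ) i).comp
      (Y t) := continuous_const.clm_comp hY
  exact continuous_hform this v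

theorem continuous_coareaFactor {T W : Type*} [TopologicalSpace T] [NormedAddCommGroup W]
    [InnerProductSpace ℂ W] (hm : ℓ + k = m) {Y : T → (Fin m → ℂ) →L[ℂ] (Fin ℓ → ℂ)}
    (hY : Continuous Y) {A : T → (Fin m → ℂ) →L[ℂ] W} (hA : Continuous A) :
    Continuous fun t => coareaFactor hm (Y t) (A t) := by
  refine (Complex.continuous_re.comp (continuous_wedgeAt _ (continuous_levelForm hY)
    (fun v => continuous_wedgeProd k _ (fun _ v => continuous_hform hA v) v) _)).div_const _

end Families

/-! ### The coarea formula for families -/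

/-- The hypothesis on sets says that `ρ` restricted to the image is the pushforward of the weighted
measure. `ζ` is controlled only on `O`, hence the globally measurable substitute `ζ'`. -/
theorem lintegral_image_of_measure_image {T X : Type*} [MeasurableSpace T] [MeasurableSpace X]
    {ρ : Measure X} {ν : Measure T} {O : Set T} (hO : MeasurableSet O) {ζ : T → X}
    {ζ' : T → X} (hζ' : Measurable ζ') (hζζ' : Set.EqOn ζ ζ' O)
    {G : T → ℝ≥0∞} (hG : Measurable G)
    (h : ∀ S, MeasurableSet S → S ⊆ O → ρ (ζ '' S) = ∫⁻ t in S, G t ∂ν)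
    {H : X → ℝ≥0∞} (hH : Measurable H) :
    ∫⁻ z in ζ '' O, H z ∂ρ = ∫⁻ t in O, H (ζ t) * G t ∂ν := by
  have key : ρ.restrict (ζ '' O) = Measure.map ζ' ((ν.restrict O).withDensity G) := by
    ext S hS
    have himg' : ζ '' O ∩ S = ζ '' (O ∩ ζ' ⁻¹' S) := by
      ext z
      constructor
      · rintro ⟨⟨t, ht, rfl⟩, hz⟩
        exact ⟨t, ⟨ht, by rwa [Set.mem_preimage, ← hζζ' ht]⟩, rfl⟩
      · rintro ⟨t, ⟨ht, hz⟩, rfl⟩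
        exact ⟨⟨t, ht, rfl⟩, by rwa [Set.mem_preimage, ← hζζ' ht] at hz⟩
    rw [Measure.restrict_apply hS, Set.inter_comm, himg', h _ (hO.inter (hζ' hS))
      Set.inter_subset_left, Measure.map_apply hζ' hS, withDensity_apply _ (hζ' hS),
      Measure.restrict_restrict (hζ' hS), Set.inter_comm]
  rw [key, lintegral_map hH hζ']
  refine (lintegral_withDensity_eq_lintegral_mul _ hG (hH.comp hζ')).trans ?_
  refine setLIntegral_congr_fun hO fun t ht => ?_
  simp only [Pi.mul_apply, Function.comp_apply]
  rw [hζζ' ht, mul_comm]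

variable {ℓ k m : ℕ} {B : Type*} [NormedAddCommGroup B] [NormedSpace ℂ B]

/-- The metric of `ℂℙ^m` in the `i`-th chart: `chartFS i z` is an isometry onto its image from the
tangent space at `z` with the Fubini-Study metric. -/
def chartFS (i : Fin (m + 1)) (z : Fin m → ℂ) : (Fin m → ℂ) →L[ℂ] V m :=
  (fsMap (chartVec i z)).comp (chartLin i)

/-- The `2k`-volume of `ℂℙ^m` in the `i`-th chart. -/
def chartVol (k : ℕ) (i : Fin (m + 1)) : Measure (Fin m → ℂ) :=
  (vol m (2 * k)).comap (chart i)

/-- The coarea factor of the family `g` in the `i`-th chart. -/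
def familyFactor (hm : ℓ + k = m) (i : Fin (m + 1)) (g : B × (Fin m → ℂ) → Fin ℓ → ℂ)
    (x : B × (Fin m → ℂ)) : ℝ :=
  coareaFactor hm (vertDeriv g x) (chartFS i x.2)

theorem continuous_familyFactor (hm : ℓ + k = m) (i : Fin (m + 1))
    {g : B × (Fin m → ℂ) → Fin ℓ → ℂ} (hg : ContDiff ℂ 1 g) :
    Continuous (familyFactor hm i g) :=
  continuous_coareaFactor hm (continuous_vertDeriv hg)
    ((continuous_fsMap_chart i).comp continuous_snd)

/-- The points where the members of the family are submersions. -/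
def regularSet (g : B × (Fin m → ℂ) → Fin ℓ → ℂ) : Set (B × (Fin m → ℂ)) :=
  {x | Function.Surjective (vertDeriv g x)}

/-- Local coordinates `(b, z) ↦ (b, g (b, z), π z)`. -/
structure LevelChart (hm : ℓ + k = m) (g : B × (Fin m → ℂ) → Fin ℓ → ℂ)
    (π : (Fin m → ℂ) →L[ℂ] (Fin k → ℂ))
    (e : OpenPartialHomeomorph (B × (Fin m → ℂ)) (B × (Fin m → ℂ))) : Prop where
  apply : ∀ x, e x = (x.1, splitEquiv hm (g x, π x.2))
  det_ne_zero : ∀ x ∈ e.source, (splitEndo hm (vertDeriv g x) π).det ≠ 0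
  symm_deriv : ∀ q ∈ e.target, ∃ E' : (B × (Fin m → ℂ)) →L[ℂ] (B × (Fin m → ℂ)),
    HasStrictFDerivAt e.symm E' q ∧
      ∀ v, E' (0, splitEndo hm (vertDeriv g (e.symm q)) π v) = (0, v)

/-! ### The coarea formula in a local chart -/

namespace LevelChart

variable {hm : ℓ + k = m} {g : B × (Fin m → ℂ) → Fin ℓ → ℂ} {π : (Fin m → ℂ) →L[ℂ] (Fin k → ℂ)}
  {e : OpenPartialHomeomorph (B × (Fin m → ℂ)) (B × (Fin m → ℂ))}

theorem symm_fst (he : LevelChart hm g π e) {q : B × (Fin m → ℂ)} (hq : q ∈ e.target) :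
    (e.symm q).1 = q.1 := by
  have := congrArg Prod.fst (e.right_inv hq)
  rwa [he.apply] at this

theorem symm_snd (he : LevelChart hm g π e) {q : B × (Fin m → ℂ)} (hq : q ∈ e.target) :
    splitEquiv hm (g (e.symm q), π (e.symm q).2) = q.2 := by
  have := congrArg Prod.snd (e.right_inv hq)
  rwa [he.apply] at this

theorem source_subset (he : LevelChart hm g π e) : e.source ⊆ regularSet g := fun x hx =>
  surjective_of_splitEndo (he.det_ne_zero x hx)

variable (hm g π) in
/-- The density in the local coordinates of the `2k`-volume of the level sets. -/
def factor (i : Fin (m + 1)) (x : B × (Fin m → ℂ)) : ℝ :=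
  familyFactor hm i g x / ‖(splitEndo hm (vertDeriv g x) π).det‖ ^ 2

variable (hm π) in
theorem measurable_factor [MeasurableSpace B] [BorelSpace B] [SecondCountableTopology B]
    (hg : ContDiff ℂ 1 g) (i : Fin (m + 1)) : Measurable (factor hm g π i) := by
  refine (continuous_familyFactor hm i hg).measurable.div (Continuous.measurable ?_)
  exact (ContinuousLinearMap.continuous_det.comp
    (continuous_splitEndo hm (continuous_vertDeriv hg) π)).norm.pow 2

theorem fibre_image (he : LevelChart hm g π e) (b : B) (y : Fin ℓ → ℂ) :
    (fun t => (e.symm (b, splitEquiv hm (y, t))).2) '' {t | (b, splitEquiv hm (y, t)) ∈ e.target} =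
      {z | (b, z) ∈ e.source ∧ g (b, z) = y} := by
  ext z
  constructor
  · rintro ⟨t, ht, rfl⟩
    have h1 := he.symm_fst ht
    have h2 : (b, (e.symm (b, splitEquiv hm (y, t))).2) = e.symm (b, splitEquiv hm (y, t)) :=
      Prod.ext h1.symm rfl
    have h3 := (splitEquiv hm).injective (he.symm_snd ht)
    simp only [Set.mem_ofPred_eq, h2]
    exact ⟨e.map_target ht, congrArg Prod.fst h3⟩
  · rintro ⟨hz, hy⟩
    have h1 : e (b, z) = (b, splitEquiv hm (y, π z)) := by rw [he.apply, hy]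
    refine ⟨π z, ?_, ?_⟩
    · simp only [Set.mem_ofPred_eq]
      rw [← h1]
      exact e.map_source hz
    · simp only
      rw [← h1, e.left_inv hz]

theorem fibre_injOn (he : LevelChart hm g π e) (b : B) (y : Fin ℓ → ℂ) :
    Set.InjOn (fun t => (e.symm (b, splitEquiv hm (y, t))).2)
      {t | (b, splitEquiv hm (y, t)) ∈ e.target} := by
  intro s hs t ht hst
  have h1 : e.symm (b, splitEquiv hm (y, s)) = e.symm (b, splitEquiv hm (y, t)) :=
    Prod.ext ((he.symm_fst hs).trans (he.symm_fst ht).symm) hst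
  have h2 := e.symm.injOn hs ht h1
  exact congrArg Prod.snd ((splitEquiv hm).injective (congrArg Prod.snd h2))

/-- With `b` and `y` fixed, the last `k` coordinates parametrize the fibre, and the area formula
applies to this parametrization followed by the projective chart. Its Gram determinant is the coarea
factor divided by `|det (Y, π)|²`, by `coareaFactor_eq`. -/
theorem fibre_lintegral [MeasurableSpace B] [BorelSpace B] [SecondCountableTopology B]
    (he : LevelChart hm g π e) (hg : ContDiff ℂ 1 g) (i : Fin (m + 1)) (b : B) (y : Fin ℓ → ℂ)
    {H : B × (Fin m → ℂ) → ℝ≥0∞} (hH : Measurable H) :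
    ∫⁻ z in {z | (b, z) ∈ e.source ∧ g (b, z) = y}, H (b, z) ∂(chartVol k i) =
      ∫⁻ t in {t | (b, splitEquiv hm (y, t)) ∈ e.target},
        H (e.symm (b, splitEquiv hm (y, t))) *
          ENNReal.ofReal (factor hm g π i (e.symm (b, splitEquiv hm (y, t)))) := by
  classical
  set q : (Fin k → ℂ) → B × (Fin m → ℂ) := fun t => (b, splitEquiv hm (y, t)) with hq
  have hqc : Continuous q := continuous_const.prodMk
    ((splitEquiv hm).continuous.comp (continuous_const.prodMk continuous_id))
  set O : Set (Fin k → ℂ) := {t | q t ∈ e.target} with hOdef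
  have hO : IsOpen O := e.open_target.preimage hqc
  set ζ : (Fin k → ℂ) → Fin m → ℂ := fun t => (e.symm (q t)).2 with hζ
  have hbζ : ∀ t ∈ O, (b, ζ t) = e.symm (q t) := fun t ht => Prod.ext (he.symm_fst ht).symm rfl
  have hcont : ContinuousOn (fun t => e.symm (q t)) O :=
    e.continuousOn_symm.comp hqc.continuousOn fun t ht => ht
  have hζcont : ContinuousOn ζ O := continuous_snd.comp_continuousOn hcont
  -- The inverse chart is only continuous on the target; a constant value outside `O` makes it
  -- measurable everywhere.
  have hm1 : Measurable (O.piecewise (fun t => e.symm (q t)) fun _ => (b, 0)) :=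
    hcont.measurable_piecewise continuousOn_const hO.measurableSet
  have hderiv : ∀ t ∈ O, ∃ D : (Fin k → ℂ) →L[ℂ] (Fin m → ℂ), HasStrictFDerivAt ζ D t ∧
      ∀ s, splitEndo hm (vertDeriv g (e.symm (q t))) π (D s) = splitEquiv hm (0, s) := by
    intro t ht
    obtain ⟨E', hE', hEv⟩ := he.symm_deriv _ ht
    have hd := he.det_ne_zero _ (e.map_target ht)
    obtain ⟨D, -, hD, -⟩ := exists_kernel_frame hm _ π hd
    refine ⟨D, ?_, hD⟩
    have hqd : HasStrictFDerivAt q ((0 : (Fin k → ℂ) →L[ℂ] B).prod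
        ((splitEquiv hm).toContinuousLinearMap.comp
          ((0 : (Fin k → ℂ) →L[ℂ] (Fin ℓ → ℂ)).prod (ContinuousLinearMap.id ℂ _)))) t :=
      (hasStrictFDerivAt_const b t).prodMk ((splitEquiv hm).hasStrictFDerivAt.comp t
        ((hasStrictFDerivAt_const y t).prodMk (hasStrictFDerivAt_id t)))
    have h1 := hasStrictFDerivAt_snd.comp t (hE'.comp t hqd)
    refine h1.congr_fderiv ?_
    ext1 s
    have h2 := hEv (D s)
    rw [hD] at h2
    exact congrArg Prod.snd h2
  choose! D hDd hDs using hderiv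
  have hfac : ∀ t ∈ O, gramDet ((chartFS i (ζ t)).comp (D t)) = factor hm g π i (e.symm (q t)) := by
    intro t ht
    have hd := he.det_ne_zero _ (e.map_target ht)
    have h1 := (coareaFactor_eq hm _ π hd (chartFS i (e.symm (q t)).2)
      (fsMap_chartLin_injective i _) (D t) (hDs t ht)).1
    have h2 : ‖(splitEndo hm (vertDeriv g (e.symm (q t))) π).det‖ ^ 2 ≠ 0 := by
      have := norm_pos_iff.mpr hd
      positivity
    rw [factor, familyFactor, h1, mul_div_cancel_left₀ _ h2]
  have hinjD : ∀ t ∈ O, Function.Injective (D t) := by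
    intro t ht s s' hss
    have := hDs t ht s
    rw [hss, hDs t ht s'] at this
    exact congrArg Prod.snd ((splitEquiv hm).injective this).symm
  have harea : ∀ S, MeasurableSet S → S ⊆ O → chartVol k i (ζ '' S) =
      ∫⁻ t in S, ENNReal.ofReal (factor hm g π i
        (O.piecewise (fun t => e.symm (q t)) (fun _ => (b, 0)) t)) := by
    intro S hS hSO
    rw [chartVol, (measurableEmbedding_chart i).comap_apply, ← Set.image_comp]
    have hJc : ContinuousOn (fun t => gramDet ((chartFS i (ζ t)).comp (D t))) O := by
      refine ContinuousOn.congr (f := fun t => factor hm g π i (e.symm (q t))) ?_ hfac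
      refine ContinuousOn.div ((continuous_familyFactor hm i hg).comp_continuousOn hcont)
        (((ContinuousLinearMap.continuous_det.comp
          (continuous_splitEndo hm (continuous_vertDeriv hg) π)).norm.pow 2).comp_continuousOn
            hcont) ?_
      intro t ht
      have := norm_pos_iff.mpr (he.det_ne_zero _ (e.map_target ht))
      exact (pow_pos this 2).ne'
    have := area_formula (f := chart i ∘ ζ) hO
      (N := fun t => (chartFS i (ζ t)).comp (D t))
      (fun t ht => (fsMap_chartLin_injective i _).comp (hinjD t ht))
      (fun t ht => hasMetricDerivAt_chart_comp i (hDd t ht))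
      ((chart_injective i).comp_injOn (he.fibre_injOn b y)) hJc hS hSO
    rw [vol, this]
    refine setLIntegral_congr_fun hS fun t ht => ?_
    simp only
    rw [hfac t (hSO ht), Set.piecewise_eq_of_mem _ _ _ (hSO ht)]
  have himg := he.fibre_image b y
  have := lintegral_image_of_measure_image (ρ := chartVol k i) (ν := volume) hO.measurableSet
    (ζ := ζ)
    (ζ' := fun t => (O.piecewise (fun t => e.symm (q t)) (fun _ => (b, 0)) t).2)
    (measurable_snd.comp hm1) (fun t ht => by simp only [Set.piecewise_eq_of_mem _ _ _ ht]; rfl)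
    ((measurable_factor hm π hg i).comp hm1).ennreal_ofReal harea
    (H := fun z => H (b, z)) (hH.comp measurable_prodMk_left)
  rw [← himg, this]
  refine setLIntegral_congr_fun hO.measurableSet fun t ht => ?_
  rw [hbζ t ht, Function.comp_apply, Set.piecewise_eq_of_mem _ _ _ ht]

theorem measurable_indicator_symm [MeasurableSpace B] [BorelSpace B] [SecondCountableTopology B]
    {F : B × (Fin m → ℂ) → ℝ≥0∞} (hF : Measurable F) :
    Measurable (e.target.indicator fun q => F (e.symm q)) := by
  classical
  have h1 : Measurable (e.target.piecewise e.symm fun _ => 0) :=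
    e.continuousOn_symm.measurable_piecewise continuousOn_const e.open_target.measurableSet
  have h2 : (e.target.indicator fun q => F (e.symm q)) =
      e.target.indicator fun q => F (e.target.piecewise e.symm (fun _ => 0) q) := by
    refine Set.indicator_congr fun q hq => ?_
    rw [Set.piecewise_eq_of_mem _ _ _ hq]
  rw [h2]
  exact (hF.comp h1).indicator e.open_target.measurableSet

/-- For fixed `b` this is the change of variables `z ↦ (g(b, z), π z)`, whose real Jacobian is the
squared modulus of the complex determinant. -/
theorem lintegral_target [MeasurableSpace B] [BorelSpace B] [SecondCountableTopology B]
    (he : LevelChart hm g π e) (hg : ContDiff ℂ 1 g) (b : B) (F : B × (Fin m → ℂ) → ℝ≥0∞) :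
    ∫⁻ q in {q | (b, q) ∈ e.target}, F (e.symm (b, q)) =
      ∫⁻ z in {z | (b, z) ∈ e.source},
        ENNReal.ofReal (‖(splitEndo hm (vertDeriv g (b, z)) π).det‖ ^ 2) * F (b, z) := by
  set S : Set (Fin m → ℂ) := {z | (b, z) ∈ e.source} with hS
  have hSo : IsOpen S := e.open_source.preimage (Continuous.prodMk_right b)
  let h : (Fin m → ℂ) → Fin m → ℂ := fun z => splitEquiv hm (g (b, z), π z)
  have heh : ∀ z, e (b, z) = (b, h z) := fun z => he.apply _
  have himg : {q | (b, q) ∈ e.target} = h '' S := by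
    ext q
    constructor
    · intro hq
      have h1 : e.symm (b, q) = (b, (e.symm (b, q)).2) := Prod.ext (he.symm_fst hq) rfl
      refine ⟨(e.symm (b, q)).2, ?_, ?_⟩
      · rw [hS, Set.mem_ofPred_eq, ← h1]; exact e.map_target hq
      · have := e.right_inv hq
        rw [h1, heh] at this
        exact congrArg Prod.snd this
    · rintro ⟨z, hz, rfl⟩
      rw [Set.mem_ofPred_eq, ← heh]
      exact e.map_source hz
  have hinj : Set.InjOn h S := by
    intro z hz z' hz' hzz
    have : e (b, z) = e (b, z') := by rw [heh, heh, hzz]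
    exact congrArg Prod.snd (e.injOn hz hz' this)
  have hd : ∀ z ∈ S, HasFDerivWithinAt h
      ((splitEndo hm (vertDeriv g (b, z)) π).restrictScalars ℝ) S z := by
    intro z _
    have h1 : HasFDerivAt h (splitEndo hm (vertDeriv g (b, z)) π) z := by
      have h2 : HasFDerivAt (fun z : Fin m → ℂ => (b, z))
          (ContinuousLinearMap.inr ℂ B (Fin m → ℂ)) z :=
        (hasFDerivAt_const b z).prodMk (hasFDerivAt_id z)
      have h3 := (hg.differentiable (by simp)).differentiableAt.hasFDerivAt.comp z h2
      exact (splitEquiv hm).hasFDerivAt.comp z (h3.prodMk π.hasFDerivAt)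
    exact (h1.restrictScalars ℝ).hasFDerivWithinAt
  rw [himg, lintegral_image_eq_lintegral_abs_det_fderiv_mul volume hSo.measurableSet hd hinj]
  refine setLIntegral_congr_fun hSo.measurableSet fun z hz => ?_
  rw [abs_det_restrictScalars, ← heh, e.left_inv hz]

/-- The Jacobian from the change of variables in `z` cancels the denominator of the fibre density
`factor`. What remains is `familyFactor`, which no longer refers to the auxiliary projection `π`. -/
theorem coarea [MeasurableSpace B] [BorelSpace B] [SecondCountableTopology B]
    (he : LevelChart hm g π e) (hg : ContDiff ℂ 1 g) (i : Fin (m + 1)) (ν : Measure B) [SFinite ν]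
    {H : B × (Fin m → ℂ) → ℝ≥0∞} (hH : Measurable H) :
    Measurable (fun p : B × (Fin ℓ → ℂ) =>
      ∫⁻ z in {z | (p.1, z) ∈ e.source ∧ g (p.1, z) = p.2}, H (p.1, z) ∂(chartVol k i)) ∧
    ∫⁻ p, (∫⁻ z in {z | (p.1, z) ∈ e.source ∧ g (p.1, z) = p.2}, H (p.1, z) ∂(chartVol k i))
        ∂(ν.prod volume) =
      ∫⁻ x in e.source, H x * ENNReal.ofReal (familyFactor hm i g x) ∂(ν.prod volume) := by
  set F : B × (Fin m → ℂ) → ℝ≥0∞ := fun x => H x * ENNReal.ofReal (factor hm g π i x) with hF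
  have hFm : Measurable F := hH.mul (measurable_factor hm π hg i).ennreal_ofReal
  set K : B × (Fin m → ℂ) → ℝ≥0∞ := e.target.indicator fun q => F (e.symm q) with hK
  have hKm : Measurable K := measurable_indicator_symm hFm
  let s : (B × (Fin ℓ → ℂ)) × (Fin k → ℂ) → B × (Fin m → ℂ) := fun p =>
    (p.1.1, splitEquiv hm (p.1.2, p.2))
  have hs : Measurable s := by
    have : Continuous s := by
      refine (continuous_fst.comp continuous_fst).prodMk ((splitEquiv hm).continuous.comp ?_)
      fun_prop
    exact this.measurable
  have hT : ∀ p : B × (Fin ℓ → ℂ),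
      ∫⁻ z in {z | (p.1, z) ∈ e.source ∧ g (p.1, z) = p.2}, H (p.1, z) ∂(chartVol k i) =
        ∫⁻ t, K (s (p, t)) := by
    intro p
    rw [he.fibre_lintegral hg i p.1 p.2 hH, ← lintegral_indicator]
    · rfl
    · exact (e.open_target.preimage (continuous_const.prodMk
        ((splitEquiv hm).continuous.comp (Continuous.prodMk_right p.2)))).measurableSet
  simp only [hT]
  have hKs : Measurable fun p => K (s p) := hKm.comp hs
  refine ⟨hKs.lintegral_prod_right', ?_⟩
  rw [lintegral_prod _ hKs.lintegral_prod_right'.aemeasurable,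
    ← lintegral_indicator e.open_source.measurableSet, lintegral_prod]
  swap
  · exact ((hH.mul (continuous_familyFactor hm i hg).measurable.ennreal_ofReal).indicator
      e.open_source.measurableSet).aemeasurable
  refine lintegral_congr fun b => ?_
  have h1 : ∫⁻ y, ∫⁻ t, K (s ((b, y), t)) = ∫⁻ q, K (b, q) := by
    have hKb : Measurable fun q => K (b, q) := hKm.comp measurable_prodMk_left
    rw [← (splitEquiv_measurePreserving hm).lintegral_comp hKb, Measure.volume_eq_prod,
      lintegral_prod]
    exact (hKb.comp (splitEquiv hm).continuous.measurable).aemeasurable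
  have h2 : ∫⁻ q, K (b, q) = ∫⁻ q in {q | (b, q) ∈ e.target}, F (e.symm (b, q)) := by
    have hTm : MeasurableSet {q | (b, q) ∈ e.target} :=
      (e.open_target.preimage (Continuous.prodMk_right b)).measurableSet
    rw [← lintegral_indicator hTm]
    rfl
  have hSm : MeasurableSet {z | (b, z) ∈ e.source} :=
    (e.open_source.preimage (Continuous.prodMk_right b)).measurableSet
  rw [h1, h2, he.lintegral_target hg b F, ← lintegral_indicator hSm]
  refine lintegral_congr fun z => ?_
  by_cases hz : (b, z) ∈ e.source
  · rw [Set.indicator_of_mem (show z ∈ {z | (b, z) ∈ e.source} from hz), Set.indicator_of_mem hz]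
    simp only [hF]
    have h3 : 0 < ‖(splitEndo hm (vertDeriv g (b, z)) π).det‖ ^ 2 :=
      pow_pos (norm_pos_iff.mpr (he.det_ne_zero _ hz)) 2
    rw [mul_left_comm, ← ENNReal.ofReal_mul h3.le, factor, mul_div_cancel₀ _ h3.ne']
  · rw [Set.indicator_of_notMem (show z ∉ {z | (b, z) ∈ e.source} from hz),
      Set.indicator_of_notMem hz]

end LevelChart

/-- The regular set is covered by countably many level charts. After making the cover disjoint, `H`
is cut into pieces each supported in one chart, and the local formulas are summed by monotone
convergence. -/
theorem coarea_family [FiniteDimensional ℂ B] [MeasurableSpace B] [BorelSpace B]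
    [SecondCountableTopology B] (hm : ℓ + k = m) {g : B × (Fin m → ℂ) → Fin ℓ → ℂ}
    (hg : ContDiff ℂ 1 g) (i : Fin (m + 1)) (ν : Measure B) [SFinite ν]
    {H : B × (Fin m → ℂ) → ℝ≥0∞} (hH : Measurable H) :
    Measurable (fun p : B × (Fin ℓ → ℂ) =>
      ∫⁻ z in {z | (p.1, z) ∈ regularSet g ∧ g (p.1, z) = p.2}, H (p.1, z) ∂(chartVol k i)) ∧
    ∫⁻ p, (∫⁻ z in {z | (p.1, z) ∈ regularSet g ∧ g (p.1, z) = p.2}, H (p.1, z) ∂(chartVol k i))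
        ∂(ν.prod volume) =
      ∫⁻ x in regularSet g, H x * ENNReal.ofReal (familyFactor hm i g x) ∂(ν.prod volume) := by
  rcases (regularSet g).eq_empty_or_nonempty with hR | hR
  · simp [hR]
  have hloc : ∀ x : regularSet g, ∃ (π : (Fin m → ℂ) →L[ℂ] (Fin k → ℂ))
      (e : OpenPartialHomeomorph (B × (Fin m → ℂ)) (B × (Fin m → ℂ))),
      (x : B × (Fin m → ℂ)) ∈ e.source ∧ LevelChart hm g π e := fun x => by
    obtain ⟨π, e, h1, h2, h3, h4⟩ := exists_local_chart hm hg x.1 x.2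
    exact ⟨π, e, h1, h2, h3, h4⟩
  choose π e hxe he using hloc
  obtain ⟨T, hTc, hT⟩ := TopologicalSpace.isOpen_iUnion_countable (fun x => (e x).source)
    fun x => (e x).open_source
  have hcover : ⋃ x ∈ T, (e x).source = regularSet g := by
    rw [hT]
    refine Set.Subset.antisymm (Set.iUnion_subset fun x => (he x).source_subset) fun x hx => ?_
    exact Set.mem_iUnion.mpr ⟨⟨x, hx⟩, hxe _⟩
  have hTne : T.Nonempty := by
    rw [Set.nonempty_iff_ne_empty]
    rintro rfl
    simp at hcover
    exact hR.ne_empty hcover.symm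
  obtain ⟨f, rfl⟩ := hTc.exists_eq_range hTne
  rw [Set.biUnion_range] at hcover
  set U : ℕ → Set (B × (Fin m → ℂ)) := fun n => (e (f n)).source with hU
  have hUm : ∀ n, MeasurableSet (U n) := fun n => (e (f n)).open_source.measurableSet
  set D : ℕ → Set (B × (Fin m → ℂ)) := disjointed U with hD
  have hDm : ∀ n, MeasurableSet (D n) := MeasurableSet.disjointed hUm
  have hDU : ∀ n, D n ⊆ U n := fun n => disjointed_subset U n
  have hDdisj : Pairwise (Function.onFun Disjoint D) := disjoint_disjointed U
  have hDcover : ⋃ n, D n = regularSet g := by rw [hD, iUnion_disjointed]; exact hcover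
  set Hn : ℕ → B × (Fin m → ℂ) → ℝ≥0∞ := fun n => (D n).indicator H with hHn
  have hHnm : ∀ n, Measurable (Hn n) := fun n => hH.indicator (hDm n)
  have hfib : ∀ p : B × (Fin ℓ → ℂ),
      ∫⁻ z in {z | (p.1, z) ∈ regularSet g ∧ g (p.1, z) = p.2}, H (p.1, z) ∂(chartVol k i) =
      ∑' n, ∫⁻ z in {z | (p.1, z) ∈ U n ∧ g (p.1, z) = p.2}, Hn n (p.1, z) ∂(chartVol k i) := by
    intro p
    have hc : Continuous fun z : Fin m → ℂ => (p.1, z) := Continuous.prodMk_right p.1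
    have hgm : MeasurableSet {z | g (p.1, z) = p.2} :=
      (isClosed_singleton.preimage (hg.continuous.comp hc)).measurableSet
    have h1 : {z | (p.1, z) ∈ regularSet g ∧ g (p.1, z) = p.2} =
        ⋃ n, {z | (p.1, z) ∈ D n ∧ g (p.1, z) = p.2} := by
      ext z
      -- Membership in the regular set is membership in one of the disjoint pieces, which splits
      -- each fibre into countably many parts.
      simp only [← hDcover, Set.mem_ofPred_eq, Set.mem_iUnion]
      tauto
    have hSm : ∀ n, MeasurableSet {z | (p.1, z) ∈ D n ∧ g (p.1, z) = p.2} := fun n =>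
      (hc.measurable (hDm n)).inter hgm
    rw [h1, lintegral_iUnion hSm]
    · refine tsum_congr fun n => ?_
      rw [← lintegral_indicator (hSm n), ← lintegral_indicator
        (show MeasurableSet {z | (p.1, z) ∈ U n ∧ g (p.1, z) = p.2} from
          (hc.measurable (hUm n)).inter hgm)]
      refine lintegral_congr fun z => ?_
      by_cases hz : (p.1, z) ∈ D n
      · by_cases hgz : g (p.1, z) = p.2
        · rw [Set.indicator_of_mem (Set.mem_ofPred_eq ▸ ⟨hz, hgz⟩),
            Set.indicator_of_mem (Set.mem_ofPred_eq ▸ ⟨hDU n hz, hgz⟩)]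
          exact (Set.indicator_of_mem hz _).symm
        · rw [Set.indicator_of_notMem (fun h => hgz h.2), Set.indicator_of_notMem (fun h => hgz h.2)]
      · rw [Set.indicator_of_notMem (fun h => hz h.1)]
        symm
        rw [Set.indicator_apply_eq_zero]
        intro _
        exact Set.indicator_of_notMem hz _
    · intro a b hab
      exact Set.disjoint_left.mpr fun z h1 h2 =>
        Set.disjoint_left.mp (hDdisj hab) h1.1 h2.1
  have hpiece := fun n => (he (f n)).coarea hg i ν (hHnm n)
  simp only [hfib]
  refine ⟨Measurable.tsum fun n => (hpiece n).1, ?_⟩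
  rw [lintegral_tsum fun n => (hpiece n).1.aemeasurable, ← hDcover, lintegral_iUnion hDm hDdisj]
  refine tsum_congr fun n => (hpiece n).2.trans ?_
  rw [← lintegral_indicator (e (f n)).open_source.measurableSet, ← lintegral_indicator (hDm n)]
  refine lintegral_congr fun x => ?_
  by_cases hx : x ∈ D n
  · rw [Set.indicator_of_mem (hDU n hx), Set.indicator_of_mem hx]
    simp only [hHn, Set.indicator_of_mem hx]
  · rw [Set.indicator_of_notMem hx, Set.indicator_apply_eq_zero]
    intro _
    simp only [hHn, Set.indicator_of_notMem hx, zero_mul]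

/-! ### Gaussian integrals -/

/-- The density of the standard complex Gaussian measure. -/
def gaussDensity (z : ℂ) : ℝ := Real.pi⁻¹ * Real.exp (-‖z‖ ^ 2)

theorem gaussDensity_nonneg (z : ℂ) : 0 ≤ gaussDensity z := by
  unfold gaussDensity
  have := Real.pi_pos
  positivity

theorem continuous_gaussDensity : Continuous gaussDensity := by
  unfold gaussDensity
  fun_prop

theorem gaussDensity_le (z : ℂ) : gaussDensity z ≤ Real.pi⁻¹ := by
  have := Real.pi_pos
  have h : Real.exp (-‖z‖ ^ 2) ≤ 1 := Real.exp_le_one_iff.mpr (by nlinarith [norm_nonneg z])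
  calc gaussDensity z ≤ Real.pi⁻¹ * 1 := by unfold gaussDensity; gcongr
    _ = Real.pi⁻¹ := mul_one _

theorem integral_gaussDensity : ∫ z, gaussDensity z = 1 := by
  have h := Complex.integral_rpow_mul_exp_neg_rpow (p := 2) (q := 0) (by norm_num) (by norm_num)
  simp only [Real.rpow_zero, one_mul, Real.rpow_ofNat] at h
  unfold gaussDensity
  rw [integral_const_mul, h]
  have := Real.pi_ne_zero
  norm_num

theorem integral_sq_gaussDensity : ∫ z, ‖z‖ ^ 2 * gaussDensity z = 1 := by
  have h := Complex.integral_rpow_mul_exp_neg_rpow (p := 2) (q := 2) (by norm_num) (by norm_num)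
  simp only [Real.rpow_ofNat] at h
  unfold gaussDensity
  simp_rw [mul_left_comm _ Real.pi⁻¹]
  rw [integral_const_mul, h]
  have := Real.pi_ne_zero
  norm_num

theorem integrable_gaussDensity : Integrable gaussDensity :=
  Integrable.of_integral_ne_zero (by rw [integral_gaussDensity]; exact one_ne_zero)

theorem integrable_sq_gaussDensity : Integrable fun z => ‖z‖ ^ 2 * gaussDensity z :=
  Integrable.of_integral_ne_zero (by rw [integral_sq_gaussDensity]; exact one_ne_zero)

theorem complexGaussian_eq :
    complexGaussian = volume.withDensity fun z => ENNReal.ofReal (gaussDensity z) := rfl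

instance instIsProbabilityMeasureComplexGaussian : IsProbabilityMeasure complexGaussian := by
  constructor
  rw [complexGaussian_eq, withDensity_apply _ MeasurableSet.univ, Measure.restrict_univ,
    ← ofReal_integral_eq_lintegral_ofReal integrable_gaussDensity
      (Filter.Eventually.of_forall gaussDensity_nonneg), integral_gaussDensity, ENNReal.ofReal_one]

theorem integrable_withDensity_ofReal {X : Type*} [MeasurableSpace X] {μ : Measure X} {f : X → ℝ}
    (hf : Measurable f) (h0 : ∀ x, 0 ≤ f x) {F : X → ℂ} :
    Integrable F (μ.withDensity fun x => ENNReal.ofReal (f x)) ↔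
      Integrable (fun x => (f x : ℂ) * F x) μ := by
  rw [integrable_withDensity_iff_integrable_smul' hf.ennreal_ofReal (by simp)]
  simp [ENNReal.toReal_ofReal, h0]

theorem integral_withDensity_ofReal {X : Type*} [MeasurableSpace X] {μ : Measure X} {f : X → ℝ}
    (hf : Measurable f) (h0 : ∀ x, 0 ≤ f x) {F : X → ℂ} :
    ∫ x, F x ∂(μ.withDensity fun x => ENNReal.ofReal (f x)) = ∫ x, (f x : ℂ) * F x ∂μ := by
  rw [integral_withDensity_eq_integral_toReal_smul hf.ennreal_ofReal (by simp)]
  simp [ENNReal.toReal_ofReal, h0]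

/-- A product of measures with integrable densities has the product density. -/
theorem pi_withDensity {ι : Type*} [Fintype ι] {X : ι → Type*} [∀ i, MeasurableSpace (X i)]
    (μ : ∀ i, Measure (X i)) [∀ i, SigmaFinite (μ i)] (f : ∀ i, X i → ℝ)
    (h0 : ∀ i x, 0 ≤ f i x) (hi : ∀ i, Integrable (f i) (μ i)) :
    Measure.pi (fun i => (μ i).withDensity fun x => ENNReal.ofReal (f i x)) =
      (Measure.pi μ).withDensity fun x => ENNReal.ofReal (∏ i, f i (x i)) := by
  have : ∀ i, IsFiniteMeasure ((μ i).withDensity fun x => ENNReal.ofReal (f i x)) := fun i =>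
    isFiniteMeasure_withDensity_ofReal (hi i).2
  refine Measure.pi_eq fun s hs => ?_
  rw [withDensity_apply _ (MeasurableSet.univ_pi hs)]
  have h1 : ∀ i, ((μ i).withDensity fun x => ENNReal.ofReal (f i x)) (s i) =
      ENNReal.ofReal (∫ x, (s i).indicator (f i) x ∂(μ i)) := by
    intro i
    rw [withDensity_apply _ (hs i), integral_indicator (hs i),
      ofReal_integral_eq_lintegral_ofReal (hi i).integrableOn
        (Filter.Eventually.of_forall (h0 i))]
  simp only [h1]
  rw [← ENNReal.ofReal_prod_of_nonneg
    fun i _ => integral_nonneg fun x => Set.indicator_nonneg (fun x _ => h0 i x) x,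
    ← integral_fintype_prod_eq_prod (fun i => (s i).indicator (f i)),
    ofReal_integral_eq_lintegral_ofReal
      (Integrable.fintype_prod_dep fun i => (hi i).indicator (hs i))
      (Filter.Eventually.of_forall fun x => Finset.prod_nonneg fun i _ =>
        Set.indicator_nonneg (fun x _ => h0 i x) _),
    ← lintegral_indicator (MeasurableSet.univ_pi hs)]
  refine lintegral_congr fun x => ?_
  by_cases hx : x ∈ Set.univ.pi s
  · rw [Set.indicator_of_mem hx]
    congr 1
    exact Finset.prod_congr rfl fun i _ => (Set.indicator_of_mem (hx i trivial) _).symm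
  · rw [Set.indicator_of_notMem hx]
    simp only [Set.mem_pi, Set.mem_univ, true_implies, not_forall] at hx
    obtain ⟨i, hi⟩ := hx
    rw [Finset.prod_eq_zero (Finset.mem_univ i) (Set.indicator_of_notMem hi _), ENNReal.ofReal_zero]

variable {ι : Type*} [Fintype ι]

theorem pi_complexGaussian : Measure.pi (fun _ : ι => complexGaussian) =
    volume.withDensity fun x => ENNReal.ofReal (∏ i, gaussDensity (x i)) := by
  rw [volume_pi, ← pi_withDensity _ _ (fun _ => gaussDensity_nonneg) (fun _ => integrable_gaussDensity)]
  rfl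

theorem prod_gaussDensity (x : ι → ℂ) : ∏ i, gaussDensity (x i) =
    (Real.pi⁻¹) ^ Fintype.card ι * Real.exp (-∑ i, ‖x i‖ ^ 2) := by
  unfold gaussDensity
  rw [Finset.prod_mul_distrib, Finset.prod_const, ← Real.exp_sum, Finset.sum_neg_distrib]
  rfl

theorem memLp_complexGaussian : MemLp (fun z : ℂ => z) 2 complexGaussian := by
  rw [memLp_two_iff_integrable_sq_norm (by fun_prop)]
  rw [complexGaussian_eq, integrable_withDensity_iff_integrable_smul'
    continuous_gaussDensity.measurable.ennreal_ofReal (by simp)]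
  refine integrable_sq_gaussDensity.congr (Filter.Eventually.of_forall fun z => ?_)
  simp [ENNReal.toReal_ofReal, gaussDensity_nonneg, mul_comm]

theorem integral_id_complexGaussian : ∫ z, z ∂complexGaussian = 0 := by
  rw [complexGaussian_eq, integral_withDensity_ofReal continuous_gaussDensity.measurable
    gaussDensity_nonneg]
  have h := integral_neg_eq_self (fun z : ℂ => (gaussDensity z : ℂ) * z) volume
  simp only [mul_neg, integral_neg, show ∀ z : ℂ, gaussDensity (-z) = gaussDensity z from
    fun z => by simp [gaussDensity]] at h
  exact self_eq_neg.mp h.symm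

theorem integral_conj_mul_complexGaussian :
    ∫ z, (starRingEnd ℂ) z * z ∂complexGaussian = 1 := by
  rw [complexGaussian_eq, integral_withDensity_ofReal continuous_gaussDensity.measurable
    gaussDensity_nonneg]
  have h := integral_sq_gaussDensity
  have h2 : ∫ z : ℂ, ((‖z‖ ^ 2 * gaussDensity z : ℝ) : ℂ) = 1 := by
    rw [integral_complex_ofReal, h]; simp
  rw [← h2]
  refine integral_congr_ae (Filter.Eventually.of_forall fun z => ?_)
  simp only [Complex.conj_mul']
  push_cast
  ring

theorem integrable_conj_mul_pi (i j : ι) :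
    Integrable (fun x : ι → ℂ => (starRingEnd ℂ) (x i) * x j)
      (Measure.pi fun _ => complexGaussian) := by
  have h : ∀ i : ι, MemLp (fun x : ι → ℂ => x i) 2 (Measure.pi fun _ => complexGaussian) :=
    fun i => memLp_complexGaussian.comp_measurePreserving
      (measurePreserving_eval (fun _ : ι => complexGaussian) i)
  have h' : MemLp (fun x : ι → ℂ => (starRingEnd ℂ) (x i)) 2
      (Measure.pi fun _ => complexGaussian) := (h i).star
  exact h'.integrable_mul (h j)

theorem integral_conj_mul_pi [DecidableEq ι] (i j : ι) :
    ∫ x : ι → ℂ, (starRingEnd ℂ) (x i) * x j ∂(Measure.pi fun _ => complexGaussian) =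
      if i = j then 1 else 0 := by
  split_ifs with hij
  · subst hij
    rw [← integral_conj_mul_complexGaussian]
    exact integral_comp_eval (μ := fun _ : ι => complexGaussian)
      (f := fun z => (starRingEnd ℂ) z * z) (by fun_prop)
  · have h := integral_fintype_prod_eq_prod (μ := fun _ : ι => complexGaussian)
      (fun l (z : ℂ) => if l = i then (starRingEnd ℂ) z else if l = j then z else 1)
    have h2 : ∀ x : ι → ℂ, (∏ l, if l = i then (starRingEnd ℂ) (x l) else
        if l = j then x l else 1) = (starRingEnd ℂ) (x i) * x j := by
      intro x
      rw [Finset.prod_eq_mul i j hij]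
      · simp [Ne.symm hij]
      · intro c _ hc
        simp [hc.1, hc.2]
      · simp
      · simp
    simp only [h2] at h
    rw [h]
    refine Finset.prod_eq_zero (Finset.mem_univ j) ?_
    simp only [Ne.symm hij, if_false, if_true]
    exact integral_id_complexGaussian

/-- Distinct coordinates are centred and independent and each has unit second moment, so only the
diagonal of the double sum survives. -/
theorem integral_conj_linear_mul_pi (p q : ι → ℂ) :
    Integrable (fun x : ι → ℂ => (starRingEnd ℂ) (∑ i, x i * p i) * ∑ i, x i * q i)
      (Measure.pi fun _ => complexGaussian) ∧
    ∫ x : ι → ℂ, (starRingEnd ℂ) (∑ i, x i * p i) * ∑ i, x i * q i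
      ∂(Measure.pi fun _ => complexGaussian) = ∑ i, (starRingEnd ℂ) (p i) * q i := by
  classical
  have h1 : ∀ x : ι → ℂ, (starRingEnd ℂ) (∑ i, x i * p i) * ∑ i, x i * q i =
      ∑ i, ∑ j, ((starRingEnd ℂ) (p i) * q j) * ((starRingEnd ℂ) (x i) * x j) := by
    intro x
    rw [map_sum, Finset.sum_mul_sum]
    refine Finset.sum_congr rfl fun i _ => Finset.sum_congr rfl fun j _ => ?_
    rw [map_mul]; ring
  simp only [h1]
  have hint : ∀ i j, Integrable (fun x : ι → ℂ => ((starRingEnd ℂ) (p i) * q j) *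
      ((starRingEnd ℂ) (x i) * x j)) (Measure.pi fun _ => complexGaussian) :=
    fun i j => (integrable_conj_mul_pi i j).const_mul _
  refine ⟨integrable_finsetSum _ fun i _ => integrable_finsetSum _ fun j _ => hint i j, ?_⟩
  rw [integral_finsetSum _ fun i _ => integrable_finsetSum _ fun j _ => hint i j]
  refine Finset.sum_congr rfl fun i _ => ?_
  rw [integral_finsetSum _ fun j _ => hint i j]
  simp only [integral_const_mul, integral_conj_mul_pi]
  simp

/-! ### Second moments of a constrained Gaussian row -/

section RankOne

variable {ι : Type*} [Fintype ι]

/-- The linear map `b ↦ b - κ (∑ b_i r_i) r̄`. -/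
def rankOneUpdate (κ : ℝ) (r : ι → ℂ) : (ι → ℂ) →L[ℂ] (ι → ℂ) :=
  LinearMap.toContinuousLinearMap
    { toFun := fun b i => b i - κ * (∑ j, b j * r j) * (starRingEnd ℂ) (r i)
      map_add' := fun b c => by
        ext i
        simp only [Pi.add_apply, add_mul, Finset.sum_add_distrib]
        ring
      map_smul' := fun c b => by
        ext i
        simp only [Pi.smul_apply, smul_eq_mul, RingHom.id_apply, mul_assoc, ← Finset.mul_sum]
        ring }

theorem rankOneUpdate_apply (κ : ℝ) (r b : ι → ℂ) (i : ι) :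
    rankOneUpdate κ r b i = b i - κ * (∑ j, b j * r j) * (starRingEnd ℂ) (r i) := rfl

/-- Moves the rank-one update from the random vector to the fixed coefficient vector, that is, to
its transpose. -/
theorem sum_rankOneUpdate_mul (κ : ℝ) (r b s : ι → ℂ) :
    ∑ i, rankOneUpdate κ r b i * s i =
      ∑ i, b i * (s i - κ * r i * ∑ j, (starRingEnd ℂ) (r j) * s j) := by
  simp only [rankOneUpdate_apply, sub_mul, mul_sub, Finset.sum_sub_distrib]
  congr 1
  have h1 : ∀ i, (κ : ℂ) * (∑ j, b j * r j) * (starRingEnd ℂ) (r i) * s i =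
      (κ * ∑ j, b j * r j) * ((starRingEnd ℂ) (r i) * s i) := fun i => by ring
  have h2 : ∀ i, b i * (κ * r i * ∑ j, (starRingEnd ℂ) (r j) * s j) =
      (b i * r i) * (κ * ∑ j, (starRingEnd ℂ) (r j) * s j) := fun i => by ring
  simp only [h1, h2, ← Finset.mul_sum, ← Finset.sum_mul]
  ring

/-- The matrix determinant lemma for a rank-one perturbation of the identity. -/
theorem det_rankOneUpdate (κ : ℝ) (r : ι → ℂ) :
    (rankOneUpdate κ r).det = 1 - κ * ((∑ i, ‖r i‖ ^ 2 : ℝ) : ℂ) := by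
  classical
  have h : LinearMap.toMatrix' (rankOneUpdate κ r).toLinearMap =
      1 + Matrix.replicateCol Unit (fun i => -(κ : ℂ) * (starRingEnd ℂ) (r i)) *
        Matrix.replicateRow Unit r := by
    ext i j
    simp only [LinearMap.toMatrix'_apply, Matrix.add_apply, Matrix.mul_apply,
      Matrix.replicateCol_apply, Matrix.replicateRow_apply, ContinuousLinearMap.coe_coe,
      rankOneUpdate_apply]
    simp [Pi.single_apply, Matrix.one_apply]
    ring
  have h2 : (rankOneUpdate κ r).det = LinearMap.det (rankOneUpdate κ r).toLinearMap := rfl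
  rw [h2, ← LinearMap.det_toMatrix', h, Matrix.det_one_add_replicateCol_mul_replicateRow]
  have h3 : ∀ i, r i * (starRingEnd ℂ) (r i) = ((‖r i‖ ^ 2 : ℝ) : ℂ) := fun i => by
    rw [Complex.mul_conj']; push_cast; rfl
  simp only [dotProduct]
  push_cast
  rw [Finset.mul_sum, sub_eq_add_neg, ← Finset.sum_neg_distrib]
  congr 1
  refine Finset.sum_congr rfl fun i _ => ?_
  have := h3 i
  push_cast at this
  rw [← this]; ring

/-- The density `π⁻¹ e^{-|∑ a_i r_i|²} ∏ π⁻¹ e^{-|a_i|²}`. -/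
def rowDensity (r a : ι → ℂ) : ℝ := gaussDensity (∑ i, a i * r i) * ∏ i, gaussDensity (a i)

theorem rowDensity_nonneg (r a : ι → ℂ) : 0 ≤ rowDensity r a :=
  mul_nonneg (gaussDensity_nonneg _) (Finset.prod_nonneg fun _ _ => gaussDensity_nonneg _)

theorem continuous_rowDensity (r : ι → ℂ) : Continuous (rowDensity r) := by
  refine (continuous_gaussDensity.comp (by fun_prop)).mul (continuous_finsetProd _ fun i _ =>
    continuous_gaussDensity.comp (continuous_apply i))

theorem integrable_rowDensity (r : ι → ℂ) : Integrable (rowDensity r) := by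
  have h : Integrable fun a : ι → ℂ => ∏ i, gaussDensity (a i) :=
    Integrable.fintype_prod_dep fun _ => integrable_gaussDensity
  refine (h.const_mul Real.pi⁻¹).mono' (continuous_rowDensity r).aestronglyMeasurable
    (Filter.Eventually.of_forall fun a => ?_)
  rw [Real.norm_of_nonneg (rowDensity_nonneg _ _)]
  exact mul_le_mul_of_nonneg_right (gaussDensity_le _)
    (Finset.prod_nonneg fun _ _ => gaussDensity_nonneg _)

/-- The exponent of `rowDensity r` is the Hermitian form `|a|² + |∑ a_i r_i|²`, with eigenvalue `p²
= 1 + |r|²` in the direction of `r̄` and `1` orthogonally to it. For this `κ` the update has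
eigenvalue `1 - κ (p² - 1) = 1/p` in that direction, so it is the inverse square root of the form
and restores the standard Gaussian. -/
theorem rowDensity_rankOneUpdate {κ p : ℝ} (hp : 0 < p) (hκ : κ = 1 / (p * (p + 1))) (r b : ι → ℂ)
    (hS : ∑ i, ‖r i‖ ^ 2 = p ^ 2 - 1) :
    rowDensity r (rankOneUpdate κ r b) = Real.pi⁻¹ * ∏ i, gaussDensity (b i) := by
  have hSc : ∑ i, (starRingEnd ℂ) (r i) * r i = ((p ^ 2 - 1 : ℝ) : ℂ) := by
    rw [← hS]; push_cast
    exact Finset.sum_congr rfl fun i _ => Complex.conj_mul' _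
  set t := ∑ i, b i * r i with ht
  have hp1 : p + 1 ≠ 0 := by positivity
  have h1 : ∑ i, rankOneUpdate κ r b i * r i = ((1 / p : ℝ) : ℂ) * t := by
    rw [sum_rankOneUpdate_mul, hSc]
    have : ∀ i, b i * (r i - κ * r i * ((p ^ 2 - 1 : ℝ) : ℂ)) =
      ((1 - κ * (p ^ 2 - 1) : ℝ) : ℂ) * (b i * r i) := fun i => by push_cast; ring
    simp only [this, ← Finset.mul_sum]
    congr 2
    rw [hκ]; field_simp; ring
  have h2 : ((∑ i, ‖rankOneUpdate κ r b i‖ ^ 2 : ℝ) : ℂ) =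
      ((∑ i, ‖b i‖ ^ 2 : ℝ) : ℂ) - (2 * κ - κ ^ 2 * (p ^ 2 - 1) : ℝ) * (‖t‖ ^ 2 : ℝ) := by
    have hterm : ∀ i, ((‖rankOneUpdate κ r b i‖ ^ 2 : ℝ) : ℂ) =
        ((‖b i‖ ^ 2 : ℝ) : ℂ) - κ * ((starRingEnd ℂ) t * (b i * r i))
          - κ * (t * (starRingEnd ℂ) (b i * r i)) +
          κ ^ 2 * ((starRingEnd ℂ) t * t) * ((starRingEnd ℂ) (r i) * r i) := by
      intro i
      push_cast
      rw [← Complex.conj_mul', ← Complex.conj_mul', rankOneUpdate_apply]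
      simp only [map_sub, map_mul, Complex.conj_conj, Complex.conj_ofReal]
      ring
    have hcast : ((∑ i, ‖rankOneUpdate κ r b i‖ ^ 2 : ℝ) : ℂ) =
      ∑ i, ((‖rankOneUpdate κ r b i‖ ^ 2 : ℝ) : ℂ) := by push_cast; rfl
    rw [hcast]
    simp only [hterm, Finset.sum_add_distrib, Finset.sum_sub_distrib, ← Finset.mul_sum]
    rw [← map_sum, ← ht, hSc]
    have htt : ((‖t‖ ^ 2 : ℝ) : ℂ) = (starRingEnd ℂ) t * t := by
      rw [Complex.conj_mul']; push_cast; rfl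
    rw [htt]
    push_cast
    ring
  have h2' : ∑ i, ‖rankOneUpdate κ r b i‖ ^ 2 =
      ∑ i, ‖b i‖ ^ 2 - (2 * κ - κ ^ 2 * (p ^ 2 - 1)) * ‖t‖ ^ 2 := by exact_mod_cast h2
  rw [rowDensity, prod_gaussDensity, prod_gaussDensity, h1, gaussDensity, h2']
  have h3 : ‖((1 / p : ℝ) : ℂ) * t‖ ^ 2 = (1 / p) ^ 2 * ‖t‖ ^ 2 := by
    rw [norm_mul, Complex.norm_real, mul_pow, Real.norm_eq_abs, sq_abs]
  rw [h3]
  have h4 : 2 * κ - κ ^ 2 * (p ^ 2 - 1) = (1 / p) ^ 2 := by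
    rw [hκ]; field_simp; ring
  rw [h4, mul_mul_mul_comm, ← Real.exp_add, mul_assoc]
  congr 3
  ring

/-- Substituting `a = T b` produces standard Gaussian moments, with Jacobian `1/(1 + |r|²)` and a
leftover constant `1/π`. The transformed coefficient vectors pair to the Schur complement, in effect
the Sherman-Morrison inverse of `1 + r rᴴ`. -/
theorem integral_rowDensity_mul (r s₀ s₁ : ι → ℂ) :
    Integrable (fun a => (rowDensity r a : ℂ) *
      ((starRingEnd ℂ) (∑ i, a i * s₀ i) * ∑ i, a i * s₁ i)) ∧
    ∫ a, (rowDensity r a : ℂ) * ((starRingEnd ℂ) (∑ i, a i * s₀ i) * ∑ i, a i * s₁ i) =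
      ((Real.pi * (1 + ∑ i, ‖r i‖ ^ 2) : ℝ) : ℂ)⁻¹ *
        (∑ i, (starRingEnd ℂ) (s₀ i) * s₁ i - ((1 + ∑ i, ‖r i‖ ^ 2 : ℝ) : ℂ)⁻¹ *
          ((∑ i, (starRingEnd ℂ) (s₀ i) * r i) * ∑ i, (starRingEnd ℂ) (r i) * s₁ i)) := by
  set S := ∑ i, ‖r i‖ ^ 2 with hS
  have hS0 : 0 ≤ S := Finset.sum_nonneg fun _ _ => by positivity
  set p := √(1 + S) with hp
  have hp0 : 0 < p := Real.sqrt_pos.mpr (by linarith)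
  have hp2 : p ^ 2 = 1 + S := Real.sq_sqrt (by linarith)
  set κ : ℝ := 1 / (p * (p + 1)) with hκ
  have hSp : ∑ i, ‖r i‖ ^ 2 = p ^ 2 - 1 := by rw [hp2]; ring
  set T := rankOneUpdate κ r with hT
  have hdet : T.det = ((1 / p : ℝ) : ℂ) := by
    rw [hT, det_rankOneUpdate, hSp]
    have : (1 / p : ℝ) = 1 - κ * (p ^ 2 - 1) := by rw [hκ]; field_simp; ring
    rw [this]; push_cast; ring
  have hdet0 : T.det ≠ 0 := by
    rw [hdet]; exact_mod_cast (by positivity : (1 / p : ℝ) ≠ 0)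
  have hunit := (LinearMap.isUnit_iff_isUnit_det T.toLinearMap).mpr (isUnit_iff_ne_zero.mpr hdet0)
  have hinj : Function.Injective T :=
    LinearMap.ker_eq_bot.mp ((LinearMap.isUnit_iff_ker_eq_bot _).mp hunit)
  have hsurj : Function.Surjective T :=
    (LinearMap.injective_iff_surjective (f := T.toLinearMap)).mp hinj
  have hjac : |(T.restrictScalars ℝ).det| = (1 + S)⁻¹ := by
    rw [abs_det_restrictScalars, hdet, Complex.norm_real, Real.norm_eq_abs, sq_abs, ← hp2]
    simp
  have hder : ∀ x ∈ (Set.univ : Set (ι → ℂ)),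
      HasFDerivWithinAt T (T.restrictScalars ℝ) Set.univ x := fun x _ =>
    (T.restrictScalars ℝ).hasFDerivAt.hasFDerivWithinAt
  have himg : T '' Set.univ = Set.univ := by rw [Set.image_univ, hsurj.range_eq]
  set s' : (ι → ℂ) → ι → ℂ := fun s i => s i - κ * r i * ∑ j, (starRingEnd ℂ) (r j) * s j with hs'
  have hG := integral_conj_linear_mul_pi (s' s₀) (s' s₁)
  have hmeas : Measurable fun x : ι → ℂ => ∏ i, gaussDensity (x i) :=
    (continuous_finsetProd _ fun i _ =>
      continuous_gaussDensity.comp (continuous_apply i)).measurable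
  have hnn : ∀ x : ι → ℂ, 0 ≤ ∏ i, gaussDensity (x i) := fun x =>
    Finset.prod_nonneg fun _ _ => gaussDensity_nonneg _
  rw [pi_complexGaussian, integrable_withDensity_ofReal hmeas hnn,
    integral_withDensity_ofReal hmeas hnn] at hG
  set F : (ι → ℂ) → ℂ := fun a => (rowDensity r a : ℂ) *
      ((starRingEnd ℂ) (∑ i, a i * s₀ i) * ∑ i, a i * s₁ i) with hF
  have hpull : ∀ b, |(T.restrictScalars ℝ).det| • F (T b) =
      (((1 + S)⁻¹ * Real.pi⁻¹ : ℝ) : ℂ) * (((∏ i, gaussDensity (b i) : ℝ) : ℂ) *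
        ((starRingEnd ℂ) (∑ i, b i * s' s₀ i) * ∑ i, b i * s' s₁ i)) := by
    intro b
    simp only [hF]
    rw [hjac, rowDensity_rankOneUpdate hp0 hκ r b hSp, sum_rankOneUpdate_mul,
      sum_rankOneUpdate_mul, Complex.real_smul]
    push_cast
    ring
  have hint : Integrable F := by
    have := (integrableOn_image_iff_integrableOn_abs_det_fderiv_smul volume MeasurableSet.univ
      hder hinj.injOn F)
    rw [himg, integrableOn_univ, integrableOn_univ] at this
    rw [this]
    simp only [hpull]
    exact hG.1.const_mul _
  refine ⟨hint, ?_⟩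
  have := (integral_image_eq_integral_abs_det_fderiv_smul volume MeasurableSet.univ
    hder hinj.injOn F)
  rw [himg, setIntegral_univ, setIntegral_univ] at this
  rw [this]
  simp only [hpull]
  rw [integral_const_mul, hG.2]
  have hcr : ∑ i, (starRingEnd ℂ) (r i) * r i = ((p ^ 2 - 1 : ℝ) : ℂ) := by
    rw [← hSp]; push_cast
    exact Finset.sum_congr rfl fun i _ => Complex.conj_mul' _
  set α := ∑ i, (starRingEnd ℂ) (s₀ i) * r i with hα
  set β := ∑ i, (starRingEnd ℂ) (r i) * s₁ i with hβ
  have hα' : (starRingEnd ℂ) (∑ j, (starRingEnd ℂ) (r j) * s₀ j) = α := by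
    rw [map_sum]
    exact Finset.sum_congr rfl fun j _ => by simp [mul_comm]
  have hsum : ∑ i, (starRingEnd ℂ) (s' s₀ i) * s' s₁ i =
      ∑ i, (starRingEnd ℂ) (s₀ i) * s₁ i - ((1 + S : ℝ) : ℂ)⁻¹ * (α * β) := by
    have hterm : ∀ i, (starRingEnd ℂ) (s' s₀ i) * s' s₁ i =
        (starRingEnd ℂ) (s₀ i) * s₁ i - (κ * β) * ((starRingEnd ℂ) (s₀ i) * r i) -
          (κ * α) * ((starRingEnd ℂ) (r i) * s₁ i) +
          (κ ^ 2 * (α * β)) * ((starRingEnd ℂ) (r i) * r i) := by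
      intro i
      simp only [hs', map_sub, map_mul, Complex.conj_ofReal]
      rw [hα']
      ring
    simp only [hterm, Finset.sum_add_distrib, Finset.sum_sub_distrib, ← Finset.mul_sum]
    rw [← hα, ← hβ, hcr, ← hp2]
    -- The squared update removes `2κ - κ² |r|²` times the component along `r`; for the chosen `κ`
    -- this is `1/p²`.
    have h5 : (((p ^ 2 : ℝ) : ℂ))⁻¹ = ((2 * κ - κ ^ 2 * (p ^ 2 - 1) : ℝ) : ℂ) := by
      rw [← Complex.ofReal_inv]
      congr 1
      rw [hκ]; field_simp; ring
    rw [h5]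
    push_cast
    ring
  rw [hsum]
  congr 1
  push_cast
  rw [mul_inv, mul_comm]

end RankOne

/-! ### Normalized monomials and their kernel -/

variable {m N : ℕ}

/-- The normalized monomial `w^J / √(J!)`. -/
def suMonomial (J : MultiIndex m N) (w : V m) : ℂ :=
  (((√(∏ i, (Nat.factorial (J.val i) : ℝ)) : ℝ) : ℂ))⁻¹ * ∏ i, w i ^ J.val i

theorem eval_suPolynomial (a : MultiIndex m N → ℂ) (w : V m) :
    MvPolynomial.eval (fun j => w j) (suPolynomial a) = ∑ J, a J * suMonomial J w := by
  simp only [suPolynomial, map_sum, map_mul, map_prod, map_pow, MvPolynomial.eval_C,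
    MvPolynomial.eval_X, suMonomial, div_eq_mul_inv, mul_assoc]

theorem contDiff_suMonomial (J : MultiIndex m N) {n : WithTop ℕ∞} :
    ContDiff ℂ n (suMonomial J) := by
  unfold suMonomial
  refine contDiff_const.mul (contDiff_prod fun i _ => ContDiff.pow ?_ _)
  exact (EuclideanSpace.proj (𝕜 := ℂ) i).contDiff

theorem suMonomial_smul (J : MultiIndex m N) (c : ℂ) (w : V m) :
    suMonomial J (c • w) = c ^ N * suMonomial J w := by
  have h : ∑ i, J.val i = N := Finset.Nat.mem_antidiagonalTuple.mp J.2
  simp only [suMonomial, PiLp.smul_apply, smul_eq_mul, mul_pow, Finset.prod_mul_distrib,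
    Finset.prod_pow_eq_pow_sum, h]
  ring

/-- The multinomial theorem: dividing by `J!` is what makes the coefficients of `⟨y, w⟩^N` match, up
to `N!`. -/
theorem sum_suMonomial (y w : V m) :
    ∑ J : MultiIndex m N, (starRingEnd ℂ) (suMonomial J y) * suMonomial J w =
      (N.factorial : ℂ)⁻¹ * (inner ℂ y w) ^ N := by
  have h1 : inner ℂ y w = ∑ i, (starRingEnd ℂ) (y i) * w i := by
    rw [PiLp.inner_apply]
    exact Finset.sum_congr rfl fun i _ => by simp [mul_comm]
  rw [h1, Finset.sum_pow_eq_sum_piAntidiag, Finset.piAntidiag_univ_fin_eq_antidiagonalTuple,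
    Finset.mul_sum, ← Finset.sum_coe_sort (Finset.Nat.antidiagonalTuple (m + 1) N)]
  refine Finset.sum_congr rfl fun J _ => ?_
  have hJ : ∑ i, J.val i = N := Finset.Nat.mem_antidiagonalTuple.mp J.2
  have h2 := Nat.multinomial_spec Finset.univ J.val
  rw [hJ] at h2
  set Q := ∏ i, (Nat.factorial (J.val i) : ℝ) with hQ
  have hQpos : 0 < Q := Finset.prod_pos fun i _ => by positivity
  have hQc : (Q : ℂ) * (Nat.multinomial Finset.univ J.val : ℂ) = (N.factorial : ℂ) := by
    rw [← h2, hQ]; push_cast; ring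
  have hQ0 : (Q : ℂ) ≠ 0 := by exact_mod_cast hQpos.ne'
  have hN0 : (N.factorial : ℂ) ≠ 0 := by exact_mod_cast N.factorial_ne_zero
  have hsq : (((√Q : ℝ) : ℂ))⁻¹ * (((√Q : ℝ) : ℂ))⁻¹ = (Q : ℂ)⁻¹ := by
    rw [← mul_inv, ← Complex.ofReal_mul, Real.mul_self_sqrt hQpos.le]
  have hmul : (N.factorial : ℂ)⁻¹ * (Nat.multinomial Finset.univ J.val : ℂ) = (Q : ℂ)⁻¹ := by
    field_simp
    rw [← hQc]; ring
  simp only [suMonomial, map_mul, map_prod, map_pow, mul_pow, Finset.prod_mul_distrib,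
    map_inv₀, Complex.conj_ofReal]
  rw [← mul_assoc (N.factorial : ℂ)⁻¹, hmul, ← hsq]
  ring

theorem hasFDerivAt_suMonomial (J : MultiIndex m N) (w : V m) :
    HasFDerivAt (suMonomial J) (fderiv ℂ (suMonomial J) w) w :=
  ((contDiff_suMonomial J (n := 1)).differentiable (by simp)).differentiableAt.hasFDerivAt

theorem hasFDerivAt_inner_pow (y w : V m) (n : ℕ) :
    HasFDerivAt (fun w : V m => (inner ℂ y w) ^ n)
      ((n * (inner ℂ y w) ^ (n - 1) : ℂ) • (innerSL ℂ y : V m →L[ℂ] ℂ)) w := by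
  have h : HasFDerivAt (fun w : V m => inner ℂ y w) (innerSL ℂ y : V m →L[ℂ] ℂ) w :=
    (innerSL ℂ y : V m →L[ℂ] ℂ).hasFDerivAt
  have := h.pow n
  simpa using this

/-- Obtained by differentiating the kernel identity in its holomorphic variable. -/
theorem sum_suMonomial_fderiv (y w v : V m) :
    ∑ J : MultiIndex m N, (starRingEnd ℂ) (suMonomial J y) * fderiv ℂ (suMonomial J) w v =
      (N.factorial : ℂ)⁻¹ * (N * (inner ℂ y w) ^ (N - 1) * inner ℂ y v) := by
  have h1 : HasFDerivAt (fun w => ∑ J : MultiIndex m N,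
      (starRingEnd ℂ) (suMonomial J y) * suMonomial J w)
      (∑ J : MultiIndex m N, (starRingEnd ℂ) (suMonomial J y) • fderiv ℂ (suMonomial J) w) w :=
    HasFDerivAt.fun_sum fun J _ => (hasFDerivAt_suMonomial J w).const_mul _
  simp only [sum_suMonomial] at h1
  have h2 := (hasFDerivAt_inner_pow y w N).const_mul ((N.factorial : ℂ)⁻¹)
  have h3 := congrArg (fun L : V m →L[ℂ] ℂ => L v) (h1.unique h2)
  simpa using h3

/-- The conjugate of the previous identity is again holomorphic in `y`, so differentiating it there
at `y = w` gives the mixed second derivative of the kernel on the diagonal. -/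
theorem sum_fderiv_suMonomial (w v₀ v₁ : V m) :
    ∑ J : MultiIndex m N, (starRingEnd ℂ) (fderiv ℂ (suMonomial J) w v₀) *
        fderiv ℂ (suMonomial J) w v₁ =
      (N.factorial : ℂ)⁻¹ * (N * (inner ℂ w w) ^ (N - 1) * inner ℂ v₀ v₁ +
        N * ((N - 1 : ℕ) * (inner ℂ w w) ^ (N - 1 - 1)) * inner ℂ w v₁ * inner ℂ v₀ w) := by
  have hconj : ∀ y, ∑ J : MultiIndex m N, (starRingEnd ℂ) (fderiv ℂ (suMonomial J) w v₀) *
      suMonomial J y = (N.factorial : ℂ)⁻¹ * (N * ((inner ℂ w y) ^ (N - 1) * inner ℂ v₀ y)) := by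
    intro y
    have := congrArg (starRingEnd ℂ) (sum_suMonomial_fderiv (N := N) y w v₀)
    simp only [map_sum, map_mul, Complex.conj_conj, map_inv₀, map_natCast, map_pow,
      inner_conj_symm] at this
    simp only [mul_comm ((starRingEnd ℂ) (fderiv ℂ (suMonomial _) w v₀))]
    rw [this]; ring
  have h1 : HasFDerivAt (fun y => ∑ J : MultiIndex m N,
      (starRingEnd ℂ) (fderiv ℂ (suMonomial J) w v₀) * suMonomial J y)
      (∑ J : MultiIndex m N, (starRingEnd ℂ) (fderiv ℂ (suMonomial J) w v₀) •
        fderiv ℂ (suMonomial J) w) w :=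
    HasFDerivAt.fun_sum fun J _ => (hasFDerivAt_suMonomial J w).const_mul _
  simp only [hconj] at h1
  have h : HasFDerivAt (fun y : V m => inner ℂ v₀ y) (innerSL ℂ v₀ : V m →L[ℂ] ℂ) w :=
    (innerSL ℂ v₀ : V m →L[ℂ] ℂ).hasFDerivAt
  have h2 := (((hasFDerivAt_inner_pow w w (N - 1)).fun_mul h).const_mul (N : ℂ)).const_mul
    ((N.factorial : ℂ)⁻¹)
  have h3 := congrArg (fun L : V m →L[ℂ] ℂ => L v₁) (h1.unique h2)
  simp only [sum_apply, _root_.smul_apply, _root_.add_apply, innerSL_apply_apply, smul_eq_mul] at h3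
  rw [h3]
  ring

/-! ### The random polynomials in an affine chart -/

variable {m N ℓ : ℕ}

/-- The multi-index of `w_i^N`. -/
def baseIndex (m N : ℕ) (i : Fin (m + 1)) : MultiIndex m N :=
  ⟨Pi.single i N, by simp [Finset.Nat.mem_antidiagonalTuple, Finset.sum_pi_single']⟩

/-- The multi-indices other than that of `w_i^N`. -/
abbrev RestIndex (m N : ℕ) (i : Fin (m + 1)) : Type := {J : MultiIndex m N // J ≠ baseIndex m N i}

theorem suMonomial_baseIndex (i : Fin (m + 1)) (w : V m) :
    suMonomial (baseIndex m N i) w = (((√(N.factorial : ℝ) : ℝ) : ℂ))⁻¹ * w i ^ N := by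
  have h1 : ∏ j, (Nat.factorial ((Pi.single i N : Fin (m + 1) → ℕ) j) : ℝ) = N.factorial := by
    rw [Finset.prod_eq_single i]
    · simp
    · intro j _ hj
      simp [hj]
    · simp
  have h2 : ∏ j, w j ^ (Pi.single i N : Fin (m + 1) → ℕ) j = w i ^ N := by
    rw [Finset.prod_eq_single i]
    · simp
    · intro j _ hj
      simp [hj]
    · simp
  simp only [suMonomial, baseIndex]
  rw [h1, h2]

/-- The coefficients in the chart of the equation `a_{J₀} = ∑_{J ≠ J₀} a_J r_J`. -/
def rowCoeff (i : Fin (m + 1)) (z : Fin m → ℂ) (J : RestIndex m N i) : ℂ :=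
  -((√(N.factorial : ℝ) : ℝ) : ℂ) * suMonomial J.val (chartVec i z)

/-- The derivatives of the coefficients `rowCoeff`. -/
def rowCoeffDeriv (i : Fin (m + 1)) (z : Fin m → ℂ) (J : RestIndex m N i) : (Fin m → ℂ) →L[ℂ] ℂ :=
  -((√(N.factorial : ℝ) : ℝ) : ℂ) •
    (fderiv ℂ (suMonomial J.val) (chartVec i z)).comp (chartLin i)

theorem hasFDerivAt_chartVec (i : Fin (m + 1)) (z : Fin m → ℂ) :
    HasFDerivAt (chartVec i) (chartLin i) z :=
  (chartLin i).hasFDerivAt.const_add _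

theorem contDiff_chartVec (i : Fin (m + 1)) {n : WithTop ℕ∞} : ContDiff ℂ n (chartVec (m := m) i) :=
  contDiff_const.add (chartLin i).contDiff

theorem hasFDerivAt_rowCoeff (i : Fin (m + 1)) (z : Fin m → ℂ) (J : RestIndex m N i) :
    HasFDerivAt (fun z => rowCoeff i z J) (rowCoeffDeriv i z J) z :=
  ((hasFDerivAt_suMonomial J.val _).comp z (hasFDerivAt_chartVec i z)).const_mul _

theorem contDiff_rowCoeff (i : Fin (m + 1)) (J : RestIndex m N i) {n : WithTop ℕ∞} :
    ContDiff ℂ n fun z => rowCoeff i z J :=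
  contDiff_const.mul ((contDiff_suMonomial J.val).comp (contDiff_chartVec i))

theorem sqrt_factorial_ne_zero : ((√(N.factorial : ℝ) : ℝ) : ℂ) ≠ 0 := by
  have : (0 : ℝ) < N.factorial := by exact_mod_cast N.factorial_pos
  exact_mod_cast (Real.sqrt_pos.mpr this).ne'

theorem sqrt_factorial_mul_self :
    ((√(N.factorial : ℝ) : ℝ) : ℂ) * ((√(N.factorial : ℝ) : ℝ) : ℂ) = N.factorial := by
  rw [← Complex.ofReal_mul, Real.mul_self_sqrt (by positivity)]
  simp

/-- With `w_i = 1` the monomial `w_i^N` is constant, so its coefficient enters additively. Vanishing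
at a point becomes one linear condition solved for that coefficient. -/
theorem eval_suPolynomial_chartVec (i : Fin (m + 1)) (a : MultiIndex m N → ℂ) (z : Fin m → ℂ) :
    MvPolynomial.eval (fun j => chartVec i z j) (suPolynomial a) =
      (((√(N.factorial : ℝ) : ℝ) : ℂ))⁻¹ *
        (a (baseIndex m N i) - ∑ J : RestIndex m N i, a J.val * rowCoeff i z J) := by
  have h0 := sqrt_factorial_ne_zero (N := N)
  rw [eval_suPolynomial, Fintype.sum_eq_add_sum_subtype_ne _ (baseIndex m N i),
    suMonomial_baseIndex, chartVec_same, mul_sub, Finset.mul_sum, sub_eq_add_neg,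
    ← Finset.sum_neg_distrib]
  congr 1
  · simp [mul_comm]
  · refine Finset.sum_congr rfl fun J _ => ?_
    simp only [rowCoeff]
    field_simp

/-- The family of maps whose level sets are the zero sets of the random polynomials. -/
def chartFamily (ℓ : ℕ) (i : Fin (m + 1)) :
    (Fin ℓ → RestIndex m N i → ℂ) × (Fin m → ℂ) → Fin ℓ → ℂ :=
  fun x l => ∑ J, x.1 l J * rowCoeff i x.2 J

theorem contDiff_chartFamily (i : Fin (m + 1)) {n : WithTop ℕ∞} :
    ContDiff ℂ n (chartFamily (N := N) ℓ i) := by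
  refine contDiff_pi.mpr fun l => ContDiff.sum fun J _ => ?_
  have h1 : ContDiff ℂ n fun x : (Fin ℓ → RestIndex m N i → ℂ) × (Fin m → ℂ) => x.1 l J :=
    contDiff_pi.mp (contDiff_pi.mp contDiff_fst l) J
  exact h1.mul ((contDiff_rowCoeff i J).comp contDiff_snd)

/-- The derivative in `z` of `∑ a_J r_J(z)`. -/
def rowDeriv (i : Fin (m + 1)) (z : Fin m → ℂ) (a : RestIndex m N i → ℂ) : (Fin m → ℂ) →L[ℂ] ℂ :=
  ∑ J, a J • rowCoeffDeriv i z J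

theorem rowDeriv_apply (i : Fin (m + 1)) (z : Fin m → ℂ) (a : RestIndex m N i → ℂ)
    (v : Fin m → ℂ) : rowDeriv i z a v = ∑ J, a J * rowCoeffDeriv i z J v := by
  simp [rowDeriv]

theorem vertDeriv_chartFamily (i : Fin (m + 1))
    (x : (Fin ℓ → RestIndex m N i → ℂ) × (Fin m → ℂ)) (v : Fin m → ℂ) (l : Fin ℓ) :
    vertDeriv (chartFamily ℓ i) x v l = rowDeriv i x.2 (x.1 l) v := by
  have h1 : HasFDerivAt (fun z : Fin m → ℂ => chartFamily (N := N) ℓ i (x.1, z))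
      (vertDeriv (chartFamily ℓ i) x) x.2 := by
    have h2 : HasFDerivAt (fun z : Fin m → ℂ => (x.1, z))
        (ContinuousLinearMap.inr ℂ (Fin ℓ → RestIndex m N i → ℂ) (Fin m → ℂ)) x.2 :=
      (hasFDerivAt_const x.1 x.2).prodMk (hasFDerivAt_id x.2)
    exact ((contDiff_chartFamily (n := 1) i).differentiable
      (by simp)).differentiableAt.hasFDerivAt.comp x.2 h2
  have h3 := hasFDerivAt_pi'.mp h1 l
  have h4 : HasFDerivAt (fun z : Fin m → ℂ => chartFamily (N := N) ℓ i (x.1, z) l)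
      (rowDeriv i x.2 (x.1 l)) x.2 :=
    HasFDerivAt.fun_sum fun J _ => (hasFDerivAt_rowCoeff i x.2 J).const_mul _
  exact congrArg (fun L : (Fin m → ℂ) →L[ℂ] ℂ => L v) (h3.unique h4)

theorem levelForm_chartFamily (i : Fin (m + 1))
    (x : (Fin ℓ → RestIndex m N i → ℂ) × (Fin m → ℂ)) :
    levelForm (vertDeriv (chartFamily ℓ i) x) =
      wedgeProd ℓ fun l => hform (rowDeriv i x.2 (x.1 l)).toLinearMap := by
  rw [levelForm]
  congr 1
  funext l
  congr 1
  exact LinearMap.ext fun v => vertDeriv_chartFamily i x v l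

/-! ### Kernel sums in a chart -/

section Sums

variable (i : Fin (m + 1)) (z : Fin m → ℂ)

/-- Being constant in the chart, the monomial `w_i^N` drops out of all sums over derivatives; those
over the remaining indices are then full kernel sums. -/
theorem fderiv_baseIndex_chartLin (v : Fin m → ℂ) :
    fderiv ℂ (suMonomial (baseIndex m N i)) (chartVec i z) (chartLin i v) = 0 := by
  have h1 := (hasFDerivAt_suMonomial (baseIndex m N i) _).comp z (hasFDerivAt_chartVec i z)
  have h2 : (suMonomial (baseIndex m N i) ∘ chartVec i) =
      fun _ => (((√(N.factorial : ℝ) : ℝ) : ℂ))⁻¹ := by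
    funext z'
    simp [suMonomial_baseIndex]
  rw [h2] at h1
  exact congrArg (fun L : (Fin m → ℂ) →L[ℂ] ℂ => L v) (h1.unique (hasFDerivAt_const _ z))

theorem norm_chartVec_pos : 0 < ‖chartVec i z‖ := norm_pos_iff.mpr (chartVec_ne_zero i z)

theorem inner_chartVec_self :
    inner ℂ (chartVec i z) (chartVec i z) = ((‖chartVec i z‖ ^ 2 : ℝ) : ℂ) := by
  rw [inner_self_eq_norm_sq_to_K]; norm_cast

theorem conj_sqrt_factorial_mul (x y : ℂ) :
    (starRingEnd ℂ) (-((√(N.factorial : ℝ) : ℝ) : ℂ) * x) *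
      (-((√(N.factorial : ℝ) : ℝ) : ℂ) * y) = N.factorial * ((starRingEnd ℂ) x * y) := by
  rw [← sqrt_factorial_mul_self (N := N)]
  simp only [map_mul, map_neg, Complex.conj_ofReal]
  ring

/-- This is `N!` times the kernel on the diagonal, with the omitted monomial `w_i^N` supplying the
`1`. -/
theorem one_add_sum_rowCoeff :
    1 + ∑ J : RestIndex m N i, ‖rowCoeff i z J‖ ^ 2 = (‖chartVec i z‖ ^ 2) ^ N := by
  have h := sum_suMonomial (N := N) (chartVec i z) (chartVec i z)
  rw [Fintype.sum_eq_add_sum_subtype_ne _ (baseIndex m N i), suMonomial_baseIndex, chartVec_same,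
    inner_chartVec_self] at h
  have hN : (N.factorial : ℂ) ≠ 0 := by exact_mod_cast N.factorial_ne_zero
  have h2 := congrArg (fun x : ℂ => (N.factorial : ℂ) * x) h
  simp only [mul_add, Finset.mul_sum, ← conj_sqrt_factorial_mul] at h2
  rw [mul_inv_cancel_left₀ hN] at h2
  have h3 : ((1 + ∑ J : RestIndex m N i, ‖rowCoeff i z J‖ ^ 2 : ℝ) : ℂ) =
      (((‖chartVec i z‖ ^ 2) ^ N : ℝ) : ℂ) := by
    push_cast
    push_cast at h2
    rw [← h2]
    congr 1
    · have := sqrt_factorial_ne_zero (N := N)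
      simp only [one_pow, mul_one, neg_mul, map_neg]
      rw [mul_inv_cancel₀ this]
      simp
    · refine Finset.sum_congr rfl fun J _ => ?_
      rw [← Complex.conj_mul']
      rfl
  exact_mod_cast h3

theorem sum_rowCoeff_deriv (v : Fin m → ℂ) :
    ∑ J : RestIndex m N i, (starRingEnd ℂ) (rowCoeff i z J) * rowCoeffDeriv i z J v =
      N * ((‖chartVec i z‖ ^ 2 : ℝ) : ℂ) ^ (N - 1) * inner ℂ (chartVec i z) (chartLin i v) := by
  have h := sum_suMonomial_fderiv (N := N) (chartVec i z) (chartVec i z) (chartLin i v)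
  rw [Fintype.sum_eq_add_sum_subtype_ne _ (baseIndex m N i), fderiv_baseIndex_chartLin, mul_zero,
    zero_add, inner_chartVec_self] at h
  have hN : (N.factorial : ℂ) ≠ 0 := by exact_mod_cast N.factorial_ne_zero
  have h2 := congrArg (fun x : ℂ => (N.factorial : ℂ) * x) h
  simp only [Finset.mul_sum, ← conj_sqrt_factorial_mul] at h2
  rw [mul_inv_cancel_left₀ hN] at h2
  exact h2

theorem sum_rowCoeffDeriv (v₀ v₁ : Fin m → ℂ) :
    ∑ J : RestIndex m N i, (starRingEnd ℂ) (rowCoeffDeriv i z J v₀) * rowCoeffDeriv i z J v₁ =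
      N * ((‖chartVec i z‖ ^ 2 : ℝ) : ℂ) ^ (N - 1) * inner ℂ (chartLin i v₀) (chartLin i v₁) +
        N * ((N - 1 : ℕ) * ((‖chartVec i z‖ ^ 2 : ℝ) : ℂ) ^ (N - 1 - 1)) *
          inner ℂ (chartVec i z) (chartLin i v₁) * inner ℂ (chartLin i v₀) (chartVec i z) := by
  have h := sum_fderiv_suMonomial (N := N) (chartVec i z) (chartLin i v₀) (chartLin i v₁)
  rw [Fintype.sum_eq_add_sum_subtype_ne _ (baseIndex m N i), fderiv_baseIndex_chartLin, map_zero,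
    zero_mul, zero_add, inner_chartVec_self] at h
  have hN : (N.factorial : ℂ) ≠ 0 := by exact_mod_cast N.factorial_ne_zero
  have h2 := congrArg (fun x : ℂ => (N.factorial : ℂ) * x) h
  simp only [Finset.mul_sum, ← conj_sqrt_factorial_mul] at h2
  rw [mul_inv_cancel_left₀ hN] at h2
  exact h2

/-- The Schur complement of the kernel `K = |w|^{2N}` is `K` times the mixed second derivative of
`log K`, hence `N` times that of `log |w|²`. Concretely, the terms in `⟨v₀, w⟩⟨w, v₁⟩` have
coefficients `N (N - 1)` and `-N²`, leaving the `-N` of the projection orthogonal to `w`. -/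
theorem integral_rowDensity_rowDeriv (v₀ v₁ : Fin m → ℂ) :
    Integrable (fun a : RestIndex m N i → ℂ => (rowDensity (rowCoeff i z) a : ℂ) *
      ((starRingEnd ℂ) (rowDeriv i z a v₀) * rowDeriv i z a v₁)) ∧
    ∫ a : RestIndex m N i → ℂ, (rowDensity (rowCoeff i z) a : ℂ) *
      ((starRingEnd ℂ) (rowDeriv i z a v₀) * rowDeriv i z a v₁) =
      N * inner ℂ (chartFS i z v₀) (chartFS i z v₁) := by
  simp only [rowDeriv_apply]
  have h := integral_rowDensity_mul (rowCoeff (N := N) i z) (fun J => rowCoeffDeriv i z J v₀)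
    (fun J => rowCoeffDeriv i z J v₁)
  refine ⟨h.1, h.2.trans ?_⟩
  have hc : ∑ J : RestIndex m N i, (starRingEnd ℂ) (rowCoeffDeriv i z J v₀) * rowCoeff i z J =
      N * ((‖chartVec i z‖ ^ 2 : ℝ) : ℂ) ^ (N - 1) * inner ℂ (chartLin i v₀) (chartVec i z) := by
    have := congrArg (starRingEnd ℂ) (sum_rowCoeff_deriv (N := N) i z v₀)
    simp only [map_sum, map_mul, Complex.conj_conj, map_natCast, map_pow, Complex.conj_ofReal,
      inner_conj_symm] at this
    rw [← this]
    exact Finset.sum_congr rfl fun J _ => mul_comm _ _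
  rw [hc, sum_rowCoeff_deriv, sum_rowCoeffDeriv, one_add_sum_rowCoeff, chartFS,
    ContinuousLinearMap.comp_apply, ContinuousLinearMap.comp_apply,
    inner_fsMap (chartVec_ne_zero i z)]
  set ρ : ℝ := ‖chartVec i z‖ ^ 2 with hρ
  have hρ0 : (ρ : ℂ) ≠ 0 := by
    have := norm_chartVec_pos i z
    exact_mod_cast (by positivity : ρ ≠ 0)
  have hπ : (Real.pi : ℂ) ≠ 0 := by exact_mod_cast Real.pi_ne_zero
  push_cast
  -- The exponents `N - 1` and `N - 2` are truncated, so degrees zero and one are treated apart.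
  rcases N with _ | _ | n
  · simp
  · simp
  · simp only [Nat.add_sub_cancel]
    push_cast
    field_simp
    ring

theorem integral_rowDensity_hform (v : Fin 2 → Fin m → ℂ) :
    Integrable (fun a : RestIndex m N i → ℂ => (rowDensity (rowCoeff i z) a : ℂ) *
      hform (rowDeriv i z a).toLinearMap v) ∧
    ∫ a : RestIndex m N i → ℂ, (rowDensity (rowCoeff i z) a : ℂ) *
      hform (rowDeriv i z a).toLinearMap v = ((N : ℝ) • hform (chartFS i z).toLinearMap) v := by
  have h := integral_rowDensity_rowDeriv (N := N) i z (v 0) (v 1)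
  have hF : ∀ a : RestIndex m N i → ℂ, (rowDensity (rowCoeff i z) a : ℂ) *
      hform (rowDeriv i z a).toLinearMap v = (((rowDensity (rowCoeff i z) a : ℂ) *
      ((starRingEnd ℂ) (rowDeriv i z a (v 0)) * rowDeriv i z a (v 1))).im : ℂ) := by
    intro a
    rw [hform_apply, Complex.im_ofReal_mul]
    push_cast
    congr 3
    simp [mul_comm]
  simp only [hF]
  refine ⟨h.1.im.ofReal, ?_⟩
  rw [integral_complex_ofReal]
  have := integral_im h.1
  simp only [RCLike.im_to_complex] at this
  rw [this, h.2]
  simp only [hform_apply, AlternatingMap.smul_apply, Complex.real_smul]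
  push_cast
  rw [← Complex.ofReal_natCast, Complex.im_ofReal_mul]
  push_cast
  rfl

end Sums

/-! ### Tangent spaces of level sets -/

/-- The derivative maps the tangent cone into that of the point `0`, which is trivial. Conversely
the implicit function parametrizes the level set by the kernel, with derivative the inclusion, so
every kernel vector is tangent. -/
theorem span_tangentConeAt_level {E F : Type*} [NormedAddCommGroup E] [NormedSpace ℂ E]
    [NormedAddCommGroup F] [NormedSpace ℂ F] [CompleteSpace E] [CompleteSpace F]
    [FiniteDimensional ℂ F]
    {f : E → F} {f' : E →L[ℂ] F} {w : E} (hf : HasStrictFDerivAt f f' w)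
    (hs : Function.Surjective f') (h0 : f w = 0) {U : Set E} (hU : U ∈ nhds w) :
    Submodule.span ℂ (tangentConeAt ℂ {x | x ∈ U ∧ f x = 0} w) = f'.toLinearMap.ker := by
  refine le_antisymm (Submodule.span_le.mpr fun y hy => ?_) fun v hv => ?_
  · have h1 := (hf.hasFDerivAt.hasFDerivWithinAt (s := {x | x ∈ U ∧ f x = 0})).mapsTo_tangent_cone hy
    have h2 : f '' {x | x ∈ U ∧ f x = 0} ⊆ {0} := by
      rintro _ ⟨x, hx, rfl⟩
      exact hx.2
    have h3 := tangentConeAt_subset_zero (𝕜 := ℂ) (x := f w) (s := {(0 : F)}) (by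
      rw [accPt_iff_nhds]
      push Not
      exact ⟨Set.univ, Filter.univ_mem, fun y hy => by rw [h0]; exact hy.2⟩)
    exact h3 (tangentConeAt_mono h2 h1)
  · apply Submodule.subset_span
    have hr : f'.range = ⊤ := LinearMap.range_eq_top.mpr hs
    set φ := hf.implicitFunction f f' hr (f w) with hφ
    have hφ' : HasStrictFDerivAt φ f'.ker.subtypeL 0 := hf.to_implicitFunction hr
    have hφ0 : φ 0 = w := by
      have := (hf.implicitFunction_apply_image hr)
      exact this
    have hev : ∀ᶠ y : f'.ker in nhds 0, φ y ∈ {x | x ∈ U ∧ f x = 0} := by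
      have h1 : ∀ᶠ y : f'.ker in nhds 0, f (φ y) = f w := by
        have h2 := hf.map_implicitFunction_eq hr
        have h3 : Filter.Tendsto (fun y : f'.ker => (f w, y)) (nhds 0) (nhds (f w, 0)) :=
          (Continuous.prodMk_right (f w)).tendsto 0
        exact h3.eventually h2
      have h4 : ∀ᶠ y : f'.ker in nhds 0, φ y ∈ U :=
        hφ'.continuousAt.eventually (by rw [hφ0]; exact hU)
      filter_upwards [h1, h4] with y hy hy'
      exact ⟨hy', by rw [hy, h0]⟩
    have h5 : f'.ker.subtypeL ⟨v, hv⟩ ∈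
        tangentConeAt ℂ (φ '' {y | φ y ∈ {x | x ∈ U ∧ f x = 0}}) (φ 0) :=
      (hφ'.hasFDerivAt.hasFDerivWithinAt
        (s := {y | φ y ∈ {x | x ∈ U ∧ f x = 0}})).mapsTo_tangent_cone
        (by rw [tangentConeAt_of_mem_nhds hev]; trivial)
    rw [hφ0] at h5
    refine tangentConeAt_mono ?_ h5
    rintro _ ⟨y, hy, rfl⟩
    exact hy

/-! ### Basic forms and their densities -/

variable {m k : ℕ}

/-- A form on `ℂ^{m+1} ∖ {0}` that comes from a form on projective space. -/
structure IsBasic {n : ℕ} (ψ : Form m n) : Prop where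
  kills : ∀ w : V m, w ≠ 0 → ∀ c : ℂ, Kills (ψ w) (c • w)
  invariant : ∀ w : V m, w ≠ 0 → ∀ c : ℂ, c ≠ 0 → ∀ v : Fin n → V m,
    ψ (c • w) (fun i => c • v i) = ψ w v

theorem TestForm.isBasic (φ : TestForm m k) : IsBasic φ.form where
  kills := fun w hw c v i hv => φ.horizontal w hw v i c hv
  invariant := fun w hw c hc v => φ.invariant w hw c hc v

/-- In the multilinear expansion every term except the one containing no multiple of `w` vanishes by
horizontality. -/
theorem IsBasic.map_add {n : ℕ} {ψ : Form m n} (hψ : IsBasic ψ) {w : V m} (hw : w ≠ 0)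
    (u : Fin n → V m) (c : Fin n → ℂ) : ψ w (fun j => u j + c j • w) = ψ w u := by
  classical
  have h := (ψ w).toMultilinearMap.map_add_univ u (fun j => c j • w)
  have h2 : ψ w (fun j => u j + c j • w) =
      ∑ s : Finset (Fin n), ψ w (s.piecewise u fun j => c j • w) := h
  rw [h2, Finset.sum_eq_single Finset.univ]
  · simp
  · intro s _ hs
    obtain ⟨j, hj⟩ : ∃ j, j ∉ s := by
      by_contra! hcon
      exact hs (Finset.eq_univ_iff_forall.mpr hcon)
    exact hψ.kills w hw (c j) _ j (by simp [hj])
  · simp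

theorem IsBasic.wedge {p q n : ℕ} (h : p + q = n) {α : Form m p} {β : Form m q} (hα : IsBasic α)
    (hβ : IsBasic β) : IsBasic (wedge h α β) where
  kills := fun w hw c => Kills.wedgeAt h (hα.kills w hw c) (hβ.kills w hw c)
  invariant := fun w hw c hc v => by
    let T : V m →ₗ[ℝ] V m := (c • LinearMap.id : V m →ₗ[ℂ] V m).restrictScalars ℝ
    have h1 : ∀ {r : ℕ} {γ : Form m r}, IsBasic γ → (γ (c • w)).compLinearMap T = γ w :=
      fun hγ => AlternatingMap.ext fun v => hγ.invariant w hw c hc v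
    have h2 : ((wedgeAt h (α (c • w)) (β (c • w))).compLinearMap T) v =
        wedgeAt h (α w) (β w) v := by
      rw [wedgeAt_compLinearMap, h1 hα, h1 hβ]
    exact h2

theorem fsMap_smul {w : V m} (hw : w ≠ 0) {c : ℂ} (hc : c ≠ 0) (v : V m) :
    ((‖c‖ : ℝ) : ℂ) • fsMap (c • w) v = fsMap w v := by
  have h1 : ((‖c‖ : ℝ) : ℂ) ≠ 0 := by exact_mod_cast norm_ne_zero_iff.mpr hc
  have h2 : ((‖w‖ : ℝ) : ℂ) ≠ 0 := by exact_mod_cast norm_ne_zero_iff.mpr hw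
  have h3 : (starRingEnd ℂ) c * c = ((‖c‖ : ℝ) : ℂ) ^ 2 := Complex.conj_mul' c
  rw [fsMap_apply, fsMap_apply, smul_smul, inner_smul_left, smul_smul]
  congr 1
  · rw [norm_smul]; push_cast; field_simp
  · congr 2
    rw [norm_smul, mul_pow]
    push_cast
    rw [mul_inv]
    have : ((((‖c‖ : ℝ) : ℂ) ^ 2)⁻¹ * (((‖w‖ : ℝ) : ℂ) ^ 2)⁻¹ * ((starRingEnd ℂ) c * inner ℂ w v)) * c
      = (((‖c‖ : ℝ) : ℂ) ^ 2)⁻¹ * ((starRingEnd ℂ) c * c) * ((((‖w‖ : ℝ) : ℂ) ^ 2)⁻¹ * inner ℂ w v) := by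
      ring
    rw [this, h3, inv_mul_cancel₀ (pow_ne_zero 2 h1), one_mul]

theorem isBasic_fubiniStudy (m : ℕ) : IsBasic (fubiniStudy m) where
  kills := fun w hw c => by
    rw [fubiniStudy_eq_hform hw]
    refine hform_kills ?_
    rw [map_smul, ContinuousLinearMap.coe_coe, fsMap_self hw, smul_zero]
  invariant := fun w hw c hc v => by
    have h1 : (‖c‖ : ℂ) ≠ 0 := by exact_mod_cast norm_ne_zero_iff.mpr hc
    have h3 : (starRingEnd ℂ) c * c = ((‖c‖ : ℝ) : ℂ) ^ 2 := Complex.conj_mul' c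
    rw [fubiniStudy_eq_hform hw, fubiniStudy_eq_hform (smul_ne_zero hc hw), hform_apply, hform_apply]
    simp only [ContinuousLinearMap.coe_coe, map_smul, ← fsMap_smul hw hc (v _)]
    congr 2
    rw [inner_smul_left, inner_smul_right, inner_smul_left, inner_smul_right, ← mul_assoc,
      ← mul_assoc, h3, Complex.conj_ofReal, sq]

theorem isBasic_wedgePow {α : Form m 2} (hα : IsBasic α) : ∀ ℓ, IsBasic (wedgePow α ℓ)
  | 0 => ⟨fun _ _ _ _ i => i.elim0, fun _ _ _ _ _ => rfl⟩
  | ℓ + 1 => IsBasic.wedge (by ring) hα (isBasic_wedgePow hα ℓ)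

/-- Three choices in `density` are undone: the representative `c w` is replaced by `w` through
invariance, the chosen unitary basis is exchanged for the frame `A ε_j` at the cost of the Gram
determinant, and the projection inside `fsMap` is dropped because a basic form ignores multiples of
`w`. -/
theorem density_mul_gramDet {Z : Set (CP m)} {i : Fin (m + 1)} {z : Fin m → ℂ}
    {D : (Fin k → ℂ) →L[ℂ] (Fin m → ℂ)} (hD : Function.Injective D)
    (hT : tangentAt Z (chart i z) = ((chartFS i z).comp D).toLinearMap.range)
    {ψ : Form m (2 * k)} (hψ : IsBasic ψ) :
    density Z ψ (chart i z) * (gramDet ((chartFS i z).comp D) : ℂ) =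
      ψ (chartVec i z) (cframe fun j => chartLin i (D (Pi.single j 1))) := by
  set A := (chartFS i z).comp D with hA
  have hAinj : Function.Injective A := (fsMap_chartLin_injective i z).comp hD
  set w := chartVec i z with hw
  have hw0 : w ≠ 0 := chartVec_ne_zero i z
  obtain ⟨c, hc, hrep⟩ := CP.exists_rep_mk w hw0
  have hex : ∃ e : Fin k → V m, Orthonormal ℂ e ∧
      Submodule.span ℂ (Set.range e) = tangentAt Z (chart i z) := by
    have hfin : Module.finrank ℂ (tangentAt Z (chart i z)) = k := by
      rw [hT, LinearMap.finrank_range_of_inj hAinj]; simp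
    let o : OrthonormalBasis (Fin k) ℂ (tangentAt Z (chart i z)) :=
      (stdOrthonormalBasis ℂ _).reindex (finCongr hfin)
    refine ⟨fun j => (o j : V m),
      o.orthonormal.comp_linearIsometry (tangentAt Z (chart i z)).subtypeₗᵢ, ?_⟩
    have h1 := o.toBasis.span_eq
    rw [o.coe_toBasis] at h1
    have h2 := congrArg (Submodule.map (tangentAt Z (chart i z)).subtype) h1
    rw [Submodule.map_span, Submodule.map_top, Submodule.range_subtype, ← Set.range_comp] at h2
    exact h2
  rw [density, dif_pos hex]
  obtain ⟨ho, hspan⟩ := hex.choose_spec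
  set e := hex.choose with he
  have hcn : ((‖c‖ : ℝ) : ℂ) ≠ 0 := by exact_mod_cast norm_ne_zero_iff.mpr hc
  -- The scale in `density` contains `|c w|`, while invariance divides the frame by `c`. The
  -- quotient is a phase, which keeps the basis unitary.
  set u : ℂ := ((‖c‖ : ℝ) : ℂ) * c⁻¹ with hu
  have hu1 : ‖u‖ = 1 := by
    rw [hu, norm_mul, Complex.norm_real, norm_norm, norm_inv,
      mul_inv_cancel₀ (norm_ne_zero_iff.mpr hc)]
  have hu0 : u ≠ 0 := by intro h; rw [h] at hu1; simp at hu1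
  have hrep' : (chart i z).rep = c • w := hrep
  have hval : ψ (chart i z).rep
      (realFrame fun j => ((√Real.pi * ‖(chart i z).rep‖ : ℝ) : ℂ) • e j) =
      ψ w (cframe fun j => ((√Real.pi * ‖w‖ : ℝ) : ℂ) • u • e j) := by
    rw [hrep', ← hψ.invariant w hw0 c hc]
    congr 1
    funext j
    have hsc : ((√Real.pi * ‖c • w‖ : ℝ) : ℂ) = c * (((√Real.pi * ‖w‖ : ℝ) : ℂ) * u) := by
      rw [hu, norm_smul]
      push_cast
      field_simp
    simp only [realFrame, cframe, hsc, smul_smul]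
    congr 1
    ring
  rw [hval]
  set s : ℂ := ((√Real.pi * ‖w‖ : ℝ) : ℂ) with hs
  have hs0 : s ≠ 0 := by
    have h1 : 0 < ‖w‖ := norm_pos_iff.mpr hw0
    have h2 : 0 < √Real.pi := Real.sqrt_pos.mpr Real.pi_pos
    rw [hs]
    exact_mod_cast (mul_pos h2 h1).ne'
  let τ : (V m) [⋀^Fin (2 * k)]→ₗ[ℝ] ℂ :=
    (ψ w).compLinearMap ((s • LinearMap.id : V m →ₗ[ℂ] V m).restrictScalars ℝ)
  have hτ : ∀ f : Fin k → V m, τ (cframe f) = ψ w (cframe fun j => s • f j) := by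
    intro f
    simp only [τ, AlternatingMap.compLinearMap_apply]
    congr 1
    funext j
    exact cframe_comp (s • LinearMap.id : V m →ₗ[ℂ] V m) f j
  have hou : Orthonormal ℂ fun j => u • e j := by
    rw [orthonormal_iff_ite] at ho ⊢
    intro a b
    rw [inner_smul_left, inner_smul_right, ho a b, ← mul_assoc, Complex.conj_mul', hu1]
    simp
  have hspan' : Submodule.span ℂ (Set.range fun j => u • e j) = tangentAt Z (chart i z) := by
    rw [← hspan]
    apply le_antisymm
    · rw [Submodule.span_le]
      rintro _ ⟨j, rfl⟩
      exact Submodule.smul_mem _ _ (Submodule.subset_span ⟨j, rfl⟩)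
    · rw [Submodule.span_le]
      rintro _ ⟨j, rfl⟩
      have : e j = u⁻¹ • (u • e j) := by rw [smul_smul, inv_mul_cancel₀ hu0, one_smul]
      rw [this]
      exact Submodule.smul_mem _ _ (Submodule.subset_span ⟨j, rfl⟩)
  obtain ⟨hg, r, -, hr⟩ := map_cframe_gram τ (fun j => u • e j)
    (fun j => A (Pi.single j 1)) hou (fun j => by
      rw [hspan', hT]; exact ⟨_, rfl⟩)
  have hgd : (gramDet A : ℂ) = (Matrix.gram ℂ fun j => A (Pi.single j 1)).det := by
    rw [gramDet, hr, Complex.ofReal_re]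
  rw [← hτ, hgd, mul_comm, ← hg, hτ]
  have hfs : ∀ v : V m, s • fsMap w v = v + (-((((‖w‖ ^ 2)⁻¹ : ℝ) : ℂ) * inner ℂ w v)) • w := by
    intro v
    rw [fsMap_apply, smul_smul]
    have : s * (((√Real.pi * ‖w‖)⁻¹ : ℝ) : ℂ) = 1 := by
      rw [Complex.ofReal_inv, ← hs, mul_inv_cancel₀ hs0]
    rw [this, one_smul, neg_smul, sub_eq_add_neg]
  have hfr : (cframe fun j => s • A (Pi.single j 1)) = fun l =>
      cframe (fun j => chartLin i (D (Pi.single j 1))) l +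
        (-((((‖w‖ ^ 2)⁻¹ : ℝ) : ℂ) *
          inner ℂ w (cframe (fun j => chartLin i (D (Pi.single j 1))) l))) • w := by
    funext l
    rw [← hfs]
    exact (cframe_comp ((s • (fsMap w)).toLinearMap)
      (fun j => chartLin i (D (Pi.single j 1))) l).symm
  rw [hfr, hψ.map_add hw0]

/-! ### The tangent spaces of the zero sets -/

variable {m N ℓ k : ℕ}

theorem exists_chartLin_add (i : Fin (m + 1)) (z : Fin m → ℂ) (v : V m) :
    ∃ z' : Fin m → ℂ, v = chartLin i z' + v i • chartVec i z := by
  refine ⟨fun j => v (i.succAbove j) - v i * z j, ?_⟩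
  ext j
  refine Fin.succAboveCases i ?_ (fun j => ?_) j
  · simp
  · simp

theorem range_chartFS (i : Fin (m + 1)) (z : Fin m → ℂ) :
    (chartFS i z).toLinearMap.range = (Submodule.span ℂ {chartVec i z})ᗮ := by
  have hw := chartVec_ne_zero i z
  apply le_antisymm
  · rintro _ ⟨v, rfl⟩
    rw [Submodule.mem_orthogonal_singleton_iff_inner_right]
    exact fsMap_inner_eq_zero hw _
  · intro v hv
    rw [Submodule.mem_orthogonal_singleton_iff_inner_right] at hv
    obtain ⟨z', hz'⟩ := exists_chartLin_add i z v
    have h1 : fsMap (chartVec i z) v = chartFS i z z' := by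
      rw [hz', map_add, map_smul, fsMap_self hw, smul_zero, add_zero]; rfl
    have hs : ((√Real.pi * ‖chartVec i z‖ : ℝ) : ℂ) ≠ 0 := by
      exact_mod_cast (mul_pos (Real.sqrt_pos.mpr Real.pi_pos) (norm_chartVec_pos i z)).ne'
    refine ⟨((√Real.pi * ‖chartVec i z‖ : ℝ) : ℂ) • z', ?_⟩
    rw [map_smul, ContinuousLinearMap.coe_coe, ← h1, fsMap_apply, hv, mul_zero, zero_smul, sub_zero,
      smul_smul, Complex.ofReal_inv, mul_inv_cancel₀ hs, one_smul]

/-- The cone over all of projective space is open, so the tangent cone is everything and only the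
orthogonal complement of `w` remains. -/
theorem tangentAt_univ (i : Fin (m + 1)) (z : Fin m → ℂ) :
    tangentAt Set.univ (chart i z) = ((chartFS i z).comp
      (ContinuousLinearMap.id ℂ (Fin m → ℂ))).toLinearMap.range := by
  obtain ⟨c, hc, hrep⟩ := CP.exists_rep_mk (chartVec i z) (chartVec_ne_zero i z)
  have hrep' : (chart i z).rep = c • chartVec i z := hrep
  have hcone : coneOver (Set.univ : Set (CP m)) ∈ nhds (chart i z).rep := by
    have : coneOver (Set.univ : Set (CP m)) = {0}ᶜ := by
      ext w; simp [coneOver]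
    rw [this]
    exact isOpen_compl_singleton.mem_nhds (chart i z).rep_ne_zero
  rw [tangentAt, tangentConeAt_of_mem_nhds hcone, Submodule.span_univ, top_inf_eq, hrep',
    Submodule.span_singleton_smul_eq (isUnit_iff_ne_zero.mpr hc), ← range_chartFS]
  rfl

/-- The map defined by a tuple of homogeneous polynomials. -/
def polyMap (a : Fin ℓ → MultiIndex m N → ℂ) (w : V m) : Fin ℓ → ℂ :=
  fun l => ∑ J, a l J * suMonomial J w

theorem contDiff_polyMap (a : Fin ℓ → MultiIndex m N → ℂ) {n : WithTop ℕ∞} :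
    ContDiff ℂ n (polyMap a) :=
  contDiff_pi.mpr fun _ => ContDiff.sum fun J _ => contDiff_const.mul (contDiff_suMonomial J)

theorem hasStrictFDerivAt_polyMap (a : Fin ℓ → MultiIndex m N → ℂ) (w : V m) :
    HasStrictFDerivAt (polyMap a) (fderiv ℂ (polyMap a) w) w :=
  (contDiff_polyMap a (n := 1)).contDiffAt.hasStrictFDerivAt (by simp)

theorem polyMap_smul (a : Fin ℓ → MultiIndex m N → ℂ) (c : ℂ) (w : V m) :
    polyMap a (c • w) = c ^ N • polyMap a w := by
  ext l
  simp only [polyMap, suMonomial_smul, Pi.smul_apply, smul_eq_mul, Finset.mul_sum]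
  exact Finset.sum_congr rfl fun J _ => by ring

theorem fderiv_polyMap_smul (a : Fin ℓ → MultiIndex m N → ℂ) (c : ℂ) (w v : V m) :
    fderiv ℂ (polyMap a) (c • w) (c • v) = c ^ N • fderiv ℂ (polyMap a) w v := by
  have h1 : HasFDerivAt (fun x : V m => polyMap a (c • x))
      ((fderiv ℂ (polyMap a) (c • w)).comp (c • ContinuousLinearMap.id ℂ (V m))) w :=
    (hasStrictFDerivAt_polyMap a (c • w)).hasFDerivAt.comp w
      ((hasFDerivAt_id w).const_smul c)
  simp only [polyMap_smul] at h1
  have h2 := (hasStrictFDerivAt_polyMap a w).hasFDerivAt.const_smul (c ^ N)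
  exact congrArg (fun L : V m →L[ℂ] (Fin ℓ → ℂ) => L v) (h1.unique h2)

/-- Euler's relation at a zero: by homogeneity the map vanishes on the whole line through `w`. -/
theorem fderiv_polyMap_self (a : Fin ℓ → MultiIndex m N → ℂ) (w : V m) (h0 : polyMap a w = 0) :
    fderiv ℂ (polyMap a) w w = 0 := by
  have h1 : HasDerivAt (fun t : ℂ => polyMap a (t • w)) (fderiv ℂ (polyMap a) w w) 1 := by
    have h2 : HasDerivAt (fun t : ℂ => t • w) w 1 := by
      simpa using (hasDerivAt_id (1 : ℂ)).smul_const w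
    have h3 : HasFDerivAt (polyMap a) (fderiv ℂ (polyMap a) w) ((1 : ℂ) • w) := by
      rw [one_smul]; exact (hasStrictFDerivAt_polyMap a w).hasFDerivAt
    exact h3.comp_hasDerivAt 1 h2
  simp only [polyMap_smul, h0, smul_zero] at h1
  exact h1.unique (hasDerivAt_const 1 _)

/-- The coefficients other than those of `w_i^N`. -/
def restCoeff (i : Fin (m + 1)) (a : Fin ℓ → MultiIndex m N → ℂ) : Fin ℓ → RestIndex m N i → ℂ :=
  fun l J => a l J.val

theorem polyMap_chartVec (i : Fin (m + 1)) (a : Fin ℓ → MultiIndex m N → ℂ) (z : Fin m → ℂ) :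
    polyMap a (chartVec i z) = (((√(N.factorial : ℝ) : ℝ) : ℂ))⁻¹ •
      ((fun l => a l (baseIndex m N i)) - chartFamily ℓ i (restCoeff i a, z)) := by
  ext l
  have := eval_suPolynomial_chartVec i (a l) z
  rw [eval_suPolynomial] at this
  simp only [polyMap, this]
  rfl

theorem polyMap_chartVec_eq_zero_iff (i : Fin (m + 1)) (a : Fin ℓ → MultiIndex m N → ℂ)
    (z : Fin m → ℂ) : polyMap a (chartVec i z) = 0 ↔
      chartFamily ℓ i (restCoeff i a, z) = fun l => a l (baseIndex m N i) := by
  rw [polyMap_chartVec, smul_eq_zero_iff_right (inv_ne_zero sqrt_factorial_ne_zero), sub_eq_zero,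
    eq_comm]

theorem fderiv_polyMap_chartLin (i : Fin (m + 1)) (a : Fin ℓ → MultiIndex m N → ℂ)
    (z v : Fin m → ℂ) : fderiv ℂ (polyMap a) (chartVec i z) (chartLin i v) =
      -(((√(N.factorial : ℝ) : ℝ) : ℂ))⁻¹ •
        vertDeriv (chartFamily ℓ i) (restCoeff i a, z) v := by
  have h1 := (hasStrictFDerivAt_polyMap a (chartVec i z)).hasFDerivAt.comp z
    (hasFDerivAt_chartVec i z)
  have h2 : polyMap a ∘ chartVec i = fun z => (((√(N.factorial : ℝ) : ℝ) : ℂ))⁻¹ •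
      ((fun l => a l (baseIndex m N i)) - chartFamily ℓ i (restCoeff i a, z)) :=
    funext fun z => polyMap_chartVec i a z
  rw [h2] at h1
  have h3 : HasFDerivAt (fun z : Fin m → ℂ => chartFamily (N := N) ℓ i (restCoeff i a, z))
      (vertDeriv (chartFamily ℓ i) (restCoeff i a, z)) z := by
    have h4 : HasFDerivAt (fun z : Fin m → ℂ => (restCoeff i a, z))
        (ContinuousLinearMap.inr ℂ (Fin ℓ → RestIndex m N i → ℂ) (Fin m → ℂ)) z :=
      (hasFDerivAt_const _ z).prodMk (hasFDerivAt_id z)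
    exact ((contDiff_chartFamily (n := 1) i).differentiable
      (by simp)).differentiableAt.hasFDerivAt.comp z h4
  have h5 := (h3.const_sub (fun l => a l (baseIndex m N i))).const_smul
    (((√(N.factorial : ℝ) : ℝ) : ℂ))⁻¹
  have h6 := congrArg (fun L : (Fin m → ℂ) →L[ℂ] (Fin ℓ → ℂ) => L v) (h1.unique h5)
  simp only [ContinuousLinearMap.comp_apply, _root_.smul_apply, _root_.neg_apply, smul_neg] at h6
  rw [h6, neg_smul]

/-- The common zeros of the polynomials with coefficients `a`. -/
def coeffZeroSet (a : Fin ℓ → MultiIndex m N → ℂ) : Set (CP m) :=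
  zeroSet fun l => suPolynomial (a l)

theorem mem_coeffZeroSet (a : Fin ℓ → MultiIndex m N → ℂ) (p : CP m) :
    p ∈ coeffZeroSet a ↔ polyMap a p.rep = 0 := by
  simp only [coeffZeroSet, zeroSet, Set.mem_ofPred_eq, eval_suPolynomial, funext_iff, polyMap,
    Pi.zero_apply]

theorem mk_mem_coeffZeroSet (a : Fin ℓ → MultiIndex m N → ℂ) (w : V m) (hw : w ≠ 0) :
    CP.mk w hw ∈ coeffZeroSet a ↔ polyMap a w = 0 := by
  obtain ⟨c, hc, hrep⟩ := CP.exists_rep_mk w hw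
  rw [mem_coeffZeroSet, hrep, polyMap_smul, smul_eq_zero_iff_right (pow_ne_zero _ hc)]

theorem chart_mem_coeffZeroSet (a : Fin ℓ → MultiIndex m N → ℂ) (i : Fin (m + 1)) (z : Fin m → ℂ) :
    chart i z ∈ coeffZeroSet a ↔
      chartFamily ℓ i (restCoeff i a, z) = fun l => a l (baseIndex m N i) := by
  rw [chart, mk_mem_coeffZeroSet, polyMap_chartVec_eq_zero_iff]

/-- The cone is a level set of the homogeneous map away from the origin, and regularity in the chart
makes its differential surjective there. The tangent space is its kernel within `w^⊥`; as `fsMap`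
alters a vector only by a scale and a multiple of `w`, Euler's relation identifies this with the
image of the kernel of `Y`. -/
theorem tangentAt_coeffZeroSet {a : Fin ℓ → MultiIndex m N → ℂ} {i : Fin (m + 1)}
    {z : Fin m → ℂ} (hz : chart i z ∈ coeffZeroSet a)
    (hreg : (restCoeff i a, z) ∈ regularSet (chartFamily (N := N) ℓ i))
    {D : (Fin k → ℂ) →L[ℂ] (Fin m → ℂ)}
    (hD : ∀ v, vertDeriv (chartFamily ℓ i) (restCoeff i a, z) v = 0 ↔ ∃ t, D t = v) :
    tangentAt (coeffZeroSet a) (chart i z) = ((chartFS i z).comp D).toLinearMap.range := by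
  set w := chartVec i z with hw
  have hw0 : w ≠ 0 := chartVec_ne_zero i z
  obtain ⟨c, hc, hrep⟩ := CP.exists_rep_mk w hw0
  have hrep' : (chart i z).rep = c • w := hrep
  set Y := vertDeriv (chartFamily (N := N) ℓ i) (restCoeff i a, z) with hY
  have hPw : polyMap a w = 0 := by
    rwa [polyMap_chartVec_eq_zero_iff, ← chart_mem_coeffZeroSet]
  have hPc : polyMap a (c • w) = 0 := by rw [polyMap_smul, hPw, smul_zero]
  have hq : -(((√(N.factorial : ℝ) : ℝ) : ℂ))⁻¹ ≠ 0 :=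
    neg_ne_zero.mpr (inv_ne_zero sqrt_factorial_ne_zero)
  have hdc : ∀ v, fderiv ℂ (polyMap a) (c • w) v = (c ^ N * c⁻¹) • fderiv ℂ (polyMap a) w v := by
    intro v
    have h1 := fderiv_polyMap_smul a c w (c⁻¹ • v)
    rw [smul_smul, mul_inv_cancel₀ hc, one_smul, map_smul, smul_smul] at h1
    exact h1
  have hcc : c ^ N * c⁻¹ ≠ 0 := mul_ne_zero (pow_ne_zero _ hc) (inv_ne_zero hc)
  have hsurj : Function.Surjective (fderiv ℂ (polyMap a) (c • w)) := by
    intro y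
    obtain ⟨v, hv⟩ := hreg ((c ^ N * c⁻¹)⁻¹ • (-(((√(N.factorial : ℝ) : ℝ) : ℂ))⁻¹)⁻¹ • y)
    refine ⟨chartLin i v, ?_⟩
    rw [hdc, fderiv_polyMap_chartLin, ← hY, show Y v = _ from hv, smul_smul, smul_smul, smul_smul]
    have : c ^ N * c⁻¹ * (-(((√(N.factorial : ℝ) : ℝ) : ℂ))⁻¹ * ((c ^ N * c⁻¹)⁻¹ *
        (-(((√(N.factorial : ℝ) : ℝ) : ℂ))⁻¹)⁻¹)) = 1 := by
      rw [mul_left_comm (-(((√(N.factorial : ℝ) : ℝ) : ℂ))⁻¹), mul_inv_cancel₀ hq, mul_one,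
        mul_inv_cancel₀ hcc]
    rw [← mul_assoc, ← mul_assoc] at this
    rw [this, one_smul]
  have hcone : coneOver (coeffZeroSet a) = {x | x ∈ ({0} : Set (V m))ᶜ ∧ polyMap a x = 0} := by
    ext x
    simp only [coneOver, Set.mem_ofPred_eq, mk_mem_coeffZeroSet, exists_prop, Set.mem_compl_iff,
      Set.mem_singleton_iff, ne_eq]
  have hfs : ∀ v, fderiv ℂ (polyMap a) w (chartFS i z v) = 0 ↔ Y v = 0 := by
    intro v
    have hs : (((√Real.pi * ‖w‖)⁻¹ : ℝ) : ℂ) ≠ 0 := by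
      exact_mod_cast (inv_pos.mpr
        (mul_pos (Real.sqrt_pos.mpr Real.pi_pos) (norm_chartVec_pos i z))).ne'
    have h1 : chartFS i z v = fsMap w (chartLin i v) := rfl
    rw [h1, fsMap_apply, map_smul, map_sub, map_smul, fderiv_polyMap_self a w hPw, smul_zero,
      sub_zero, fderiv_polyMap_chartLin, smul_eq_zero_iff_right hs, smul_eq_zero_iff_right hq]
  rw [tangentAt, hrep', hcone, span_tangentConeAt_level (hasStrictFDerivAt_polyMap a (c • w)) hsurj
    hPc (isOpen_compl_singleton.mem_nhds (smul_ne_zero hc hw0)),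
    Submodule.span_singleton_smul_eq (isUnit_iff_ne_zero.mpr hc), ← range_chartFS]
  ext v
  constructor
  · rintro ⟨h1, z', rfl⟩
    have h2 : fderiv ℂ (polyMap a) (c • w) (chartFS i z z') = 0 := h1
    rw [hdc, smul_eq_zero_iff_right hcc, hfs, hD] at h2
    obtain ⟨t, ht⟩ := h2
    exact ⟨t, by rw [← ht]; rfl⟩
  · rintro ⟨t, rfl⟩
    refine ⟨?_, D t, rfl⟩
    change fderiv ℂ (polyMap a) (c • w) (chartFS i z (D t)) = 0
    rw [hdc, smul_eq_zero_iff_right hcc, hfs, hD]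
    exact ⟨t, rfl⟩

/-- The pullback of a form to the `i`-th chart. -/
def chartPull {n : ℕ} (i : Fin (m + 1)) (ψ : Form m n) (z : Fin m → ℂ) :
    (Fin m → ℂ) [⋀^Fin n]→ₗ[ℝ] ℂ :=
  (ψ (chartVec i z)).compLinearMap ((chartLin i).toLinearMap.restrictScalars ℝ)

theorem chartPull_cframe (i : Fin (m + 1)) (ψ : Form m (2 * k)) (z : Fin m → ℂ)
    (f : Fin k → Fin m → ℂ) :
    chartPull i ψ z (cframe f) = ψ (chartVec i z) (cframe fun j => chartLin i (f j)) := by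
  rw [chartPull, AlternatingMap.compLinearMap_apply]
  congr 1
  exact funext fun j => cframe_comp (chartLin i).toLinearMap f j

/-- Both sides are evaluated in the same kernel frame `D`. The coarea factor contributes `|det (Y,
π)|²` and a Gram determinant; the latter converts the density into the form evaluated on `D`. -/
theorem density_coeffZeroSet (hm : ℓ + k = m) {a : Fin ℓ → MultiIndex m N → ℂ} {i : Fin (m + 1)}
    {z : Fin m → ℂ} (hz : chart i z ∈ coeffZeroSet a)
    (hreg : (restCoeff i a, z) ∈ regularSet (chartFamily (N := N) ℓ i))
    {ψ : Form m (2 * k)} (hψ : IsBasic ψ) :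
    density (coeffZeroSet a) ψ (chart i z) *
        (familyFactor hm i (chartFamily ℓ i) (restCoeff i a, z) : ℂ) =
      wedgeAt (two_mul_add hm) (levelForm (vertDeriv (chartFamily ℓ i) (restCoeff i a, z)))
        (chartPull i ψ z) (stdFrame m) := by
  set Y := vertDeriv (chartFamily (N := N) ℓ i) (restCoeff i a, z) with hY
  obtain ⟨π, hd⟩ := exists_complementary_map hm Y hreg
  obtain ⟨D, hDinj, hDs, hφ⟩ := exists_kernel_frame hm Y π hd
  have hD : ∀ v, Y v = 0 ↔ ∃ t, D t = v := by
    intro v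
    constructor
    · intro hv
      refine ⟨π v, splitEndo_injective hd ?_⟩
      rw [hDs, splitEndo_apply, hv]
    · rintro ⟨t, rfl⟩
      have := hDs t
      rw [splitEndo_apply] at this
      exact congrArg Prod.fst ((splitEquiv hm).injective this)
  have h1 := density_mul_gramDet hDinj (tangentAt_coeffZeroSet hz hreg hD) hψ
  have h2 := (coareaFactor_eq hm Y π hd (chartFS i z) (fsMap_chartLin_injective i z) D hDs).1
  rw [hφ, chartPull_cframe, ← h1, familyFactor, h2]
  push_cast
  ring

theorem density_univ_mul (i : Fin (m + 1)) (z : Fin m → ℂ) {ψ : Form m (2 * m)} (hψ : IsBasic ψ) :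
    density Set.univ ψ (chart i z) * (gramDet (chartFS i z) : ℂ) =
      chartPull i ψ z (stdFrame m) := by
  rw [stdFrame, chartPull_cframe]
  exact density_mul_gramDet (D := ContinuousLinearMap.id ℂ (Fin m → ℂ)) Function.injective_id
    (tangentAt_univ i z) hψ

/-! ### Almost all systems are regular -/

variable {m N ℓ : ℕ}

/-- All common zeros of the polynomials with coefficients `a` are nondegenerate. -/
def IsRegular (a : Fin ℓ → MultiIndex m N → ℂ) : Prop :=
  ∀ (i : Fin (m + 1)) (z : Fin m → ℂ), chart i z ∈ coeffZeroSet a →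
    (restCoeff i a, z) ∈ regularSet (chartFamily (N := N) ℓ i)

instance instIsAddHaarMeasureCoeff {ι κ : Type*} [Fintype ι] [Fintype κ] :
    (volume : Measure (ι → κ → ℂ)).IsAddHaarMeasure := by
  have h : (volume : Measure (κ → ℂ)).IsAddHaarMeasure := inferInstance
  have : ∀ i : ι, (volume : Measure ((fun _ : ι => κ → ℂ) i)).IsAddHaarMeasure := fun _ => h
  exact Measure.pi.isAddHaarMeasure (α := fun _ : ι => κ → ℂ) (fun _ => volume)

theorem volume_coeff_eq_zero (l : Fin ℓ) (J : MultiIndex m N) :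
    volume {a : Fin ℓ → MultiIndex m N → ℂ | a l J = 0} = 0 := by
  let L : (Fin ℓ → MultiIndex m N → ℂ) →ₗ[ℝ] ℂ :=
    { toFun := fun a => a l J
      map_add' := fun _ _ => rfl
      map_smul' := fun _ _ => rfl }
  have h : {a : Fin ℓ → MultiIndex m N → ℂ | a l J = 0} = (L.ker : Set _) := by
    ext a; rfl
  rw [h]
  refine Measure.addHaar_submodule _ _ fun htop => ?_
  have h1 : (fun _ _ => 1 : Fin ℓ → MultiIndex m N → ℂ) ∈ L.ker := by rw [htop]; trivial
  have h2 : (1 : ℂ) = 0 := h1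
  exact one_ne_zero h2

/-- The multi-index of `w_i^{N} w_j` with `j = i.succAbove n`. -/
def linIndex (i : Fin (m + 1)) (n : Fin m) : MultiIndex m (N + 1) :=
  ⟨Pi.single i N + Pi.single (i.succAbove n) 1, by
    simp [Finset.Nat.mem_antidiagonalTuple, Finset.sum_add_distrib]⟩

theorem linIndex_succAbove (i : Fin (m + 1)) (n n' : Fin m) :
    (linIndex (N := N) i n).val (i.succAbove n') = if n' = n then 1 else 0 := by
  simp [linIndex, Pi.single_apply, Fin.succAbove_ne]

theorem linIndex_ne (i : Fin (m + 1)) (n : Fin m) :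
    linIndex (N := N) i n ≠ baseIndex m (N + 1) i := by
  intro h
  have h1 := congrArg (fun J : MultiIndex m (N + 1) => J.val (i.succAbove n)) h
  simp only [linIndex_succAbove] at h1
  simp [baseIndex, Fin.succAbove_ne] at h1

theorem linIndex_injective (i : Fin (m + 1)) : Function.Injective (linIndex (N := N) (m := m) i) := by
  intro n n' h
  have h1 := congrArg (fun J : MultiIndex m (N + 1) => J.val (i.succAbove n)) h
  simp only [linIndex_succAbove] at h1
  by_contra hne
  simp [hne] at h1

/-- `linIndex` as an index different from the base index. -/
def linRest (i : Fin (m + 1)) (n : Fin m) : RestIndex m (N + 1) i := ⟨linIndex i n, linIndex_ne i n⟩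

/-- In the chart the monomial `w_i^N w_j` becomes the coordinate `z_n` up to a constant. These
coefficients move the differential of a row freely, which is how degeneracy is detected. -/
theorem exists_rowCoeff_linRest (i : Fin (m + 1)) (n : Fin m) : ∃ κ : ℂ, κ ≠ 0 ∧
    ∀ z : Fin m → ℂ, rowCoeff i z (linRest (N := N) i n) = κ * z n := by
  have h : ∀ z : Fin m → ℂ, ∏ j, chartVec i z j ^ (linIndex (N := N) i n).val j = z n := by
    intro z
    rw [Fin.prod_univ_succAbove _ i]
    simp only [chartVec_same, one_pow, one_mul, chartVec_succAbove, linIndex_succAbove]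
    rw [Finset.prod_eq_single n]
    · simp
    · intro b _ hb
      simp [hb]
    · simp
  refine ⟨-((√((N + 1).factorial : ℝ) : ℝ) : ℂ) *
    (((√(∏ j, (Nat.factorial ((linIndex (N := N) i n).val j) : ℝ)) : ℝ) : ℂ))⁻¹, ?_, ?_⟩
  · refine mul_ne_zero (neg_ne_zero.mpr sqrt_factorial_ne_zero) (inv_ne_zero ?_)
    have : 0 < ∏ j, (Nat.factorial ((linIndex (N := N) i n).val j) : ℝ) :=
      Finset.prod_pos fun j _ => by exact_mod_cast Nat.factorial_pos _
    exact_mod_cast (Real.sqrt_pos.mpr this).ne'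
  · intro z
    simp only [rowCoeff, suMonomial, linRest, h]
    ring

theorem exists_rowCoeffDeriv_linRest (i : Fin (m + 1)) (n : Fin m) : ∃ κ : ℂ, κ ≠ 0 ∧
    ∀ z v : Fin m → ℂ, rowCoeffDeriv i z (linRest (N := N) i n) v = κ * v n := by
  obtain ⟨κ, hκ, h⟩ := exists_rowCoeff_linRest (N := N) i n
  refine ⟨κ, hκ, fun z v => ?_⟩
  have h1 := hasFDerivAt_rowCoeff i z (linRest (N := N) i n)
  simp only [h] at h1
  have h2 : HasFDerivAt (fun z : Fin m → ℂ => κ * z n)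
      (κ • (ContinuousLinearMap.proj n : (Fin m → ℂ) →L[ℂ] ℂ)) z :=
    (ContinuousLinearMap.proj n : (Fin m → ℂ) →L[ℂ] ℂ).hasFDerivAt.const_mul κ
  exact congrArg (fun L : (Fin m → ℂ) →L[ℂ] ℂ => L v) (h1.unique h2)

theorem contDiff_rowCoeffDeriv (i : Fin (m + 1)) (J : RestIndex m N i) (v : Fin m → ℂ) :
    ContDiff ℂ 1 fun z => rowCoeffDeriv i z J v := by
  have h1 : ContDiff ℂ 1 (fderiv ℂ (suMonomial J.val)) :=
    (contDiff_suMonomial J.val (n := 2)).fderiv_right (by norm_num)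
  have h2 := (h1.comp (contDiff_chartVec i (n := 1))).clm_apply
    (contDiff_const (c := chartLin i v))
  exact contDiff_const.mul h2

/-! ### A parametrization of degenerate systems -/

section Parametrization

variable (i : Fin (m + 1)) (j : Fin ℓ) (κ : Fin m → ℂ)

/-- The multipliers stored in the constant terms. -/
def parMult (b : Fin ℓ → MultiIndex m (N + 1) → ℂ) (l : Fin ℓ) : ℂ :=
  if l = j then 1 else b l (baseIndex m (N + 1) i)

/-- The point stored in the linear terms of row `j`. -/
def parPoint (b : Fin ℓ → MultiIndex m (N + 1) → ℂ) : Fin m → ℂ := fun n => b j (linIndex i n)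

/-- The defect of the linear relation between the differentials. -/
def parDefect (b : Fin ℓ → MultiIndex m (N + 1) → ℂ) (n : Fin m) : ℂ :=
  ∑ l, parMult i j b l * rowDeriv i (parPoint i j b) (restCoeff i b l) (Pi.single n 1)

/-- The correction of the linear terms in row `j`. -/
def parRest (b : Fin ℓ → MultiIndex m (N + 1) → ℂ) : Fin ℓ → RestIndex m (N + 1) i → ℂ :=
  fun l J => b l J.val -
    if l = j then ∑ n, if J = linRest i n then (κ n)⁻¹ * parDefect i j b n else 0 else 0

open Classical in
/-- A map whose restriction to the hyperplane `b_{j, J₀} = 0` has all degenerate systems in its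
range. -/
def parMap (b : Fin ℓ → MultiIndex m (N + 1) → ℂ) : Fin ℓ → MultiIndex m (N + 1) → ℂ :=
  fun l J => if h : J = baseIndex m (N + 1) i then
    chartFamily ℓ i (parRest i j κ b, parPoint i j b) l else parRest i j κ b l ⟨J, h⟩

theorem contDiff_parMap : ContDiff ℂ 1 (parMap (N := N) i j κ) := by
  have hc : ∀ l (J : MultiIndex m (N + 1)), ContDiff ℂ 1
      fun b : Fin ℓ → MultiIndex m (N + 1) → ℂ => b l J := fun l J =>
    contDiff_pi.mp (contDiff_pi.mp contDiff_id l) J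
  have hpt : ContDiff ℂ 1 (parPoint (N := N) i j) := contDiff_pi.mpr fun n => hc j _
  have hmult : ∀ l, ContDiff ℂ 1 fun b => parMult (N := N) i j b l := by
    intro l
    unfold parMult
    split_ifs
    · exact contDiff_const
    · exact hc _ _
  have hdef : ∀ n, ContDiff ℂ 1 fun b => parDefect (N := N) i j b n := by
    intro n
    refine ContDiff.sum fun l _ => (hmult l).mul ?_
    simp only [rowDeriv_apply]
    exact ContDiff.sum fun J _ => (hc l J.val).mul ((contDiff_rowCoeffDeriv i J _).comp hpt)
  have hrest : ContDiff ℂ 1 (parRest (N := N) i j κ) := by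
    refine contDiff_pi.mpr fun l => contDiff_pi.mpr fun J => (hc l J.val).sub ?_
    split_ifs
    · refine ContDiff.sum fun n _ => ?_
      split_ifs
      · exact contDiff_const.mul (hdef n)
      · exact contDiff_const
    · exact contDiff_const
  refine contDiff_pi.mpr fun l => contDiff_pi.mpr fun J => ?_
  unfold parMap
  split_ifs with h
  · exact contDiff_pi.mp ((contDiff_chartFamily i).comp (hrest.prodMk hpt)) l
  · exact contDiff_pi.mp (contDiff_pi.mp hrest l) ⟨J, h⟩

/-- At a degenerate zero the constant terms are forced by vanishing at `z`, and the linear terms of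
row `j` by the relation `c` between the differentials. These slots are reused in `b`: the linear
terms of row `j` store `z`, the constant terms of the other rows store `c`. The constant term of row
`j` is left unused, so a hyperplane suffices. -/
theorem mem_image_parMap (hκ0 : ∀ n, κ n ≠ 0) (hκ : ∀ n (z v : Fin m → ℂ),
      rowCoeffDeriv i z (linRest (N := N) i n) v = κ n * v n)
    {a : Fin ℓ → MultiIndex m (N + 1) → ℂ} {z : Fin m → ℂ} (hz : chart i z ∈ coeffZeroSet a)
    {c : Fin ℓ → ℂ} (hcj : c j = 1)
    (hc : ∀ v, ∑ l, c l * rowDeriv i z (restCoeff i a l) v = 0) :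
    a ∈ parMap i j κ '' {b | b j (baseIndex m (N + 1) i) = 0} := by
  classical
  let b : Fin ℓ → MultiIndex m (N + 1) → ℂ := fun l J =>
    if J = baseIndex m (N + 1) i then (if l = j then 0 else c l) else
      a l J + if l = j then ∑ n, if J = linIndex i n then z n - a j (linIndex i n) else 0 else 0
  have hsumlin : ∀ (n : Fin m) (f : Fin m → ℂ),
      (∑ n', if linIndex (N := N) i n = linIndex i n' then f n' else 0) = f n := by
    intro n f
    rw [Finset.sum_eq_single n]
    · simp
    · intro n' _ hn
      rw [if_neg fun h => hn (linIndex_injective i h).symm]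
    · simp
  have hbpt : parPoint i j b = z := by
    funext n
    simp only [parPoint, b, if_neg (linIndex_ne i n), if_true, hsumlin]
    ring
  have hbm : ∀ l, parMult i j b l = c l := by
    intro l
    simp only [parMult, b]
    by_cases h : l = j
    · simp [h, hcj]
    · simp [h]
  have hbrest : ∀ l (J : RestIndex m (N + 1) i), b l J.val = a l J.val +
      if l = j then ∑ n, if J = linRest i n then z n - a j (linIndex i n) else 0 else 0 := by
    intro l J
    simp only [b, if_neg J.2]
    congr 2
    refine Finset.sum_congr rfl fun n _ => ?_
    have : (J.val = linIndex i n) ↔ (J = linRest i n) := by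
      exact ⟨fun h => Subtype.ext h, fun h => congrArg Subtype.val h⟩
    simp only [this]
  -- The relation holds for `a`. Replacing the linear coefficient `a_{j,n}` by `z_n` spoils it by
  -- `κ_n (z_n - a_{j,n})`, so dividing by `κ_n` recovers the correction that `parRest` subtracts.
  have hdefect : ∀ n, parDefect i j b n = κ n * (z n - a j (linIndex i n)) := by
    intro n
    simp only [parDefect, hbm, hbpt]
    have h1 : ∀ l, rowDeriv i z (restCoeff i b l) (Pi.single n 1) =
        rowDeriv i z (restCoeff i a l) (Pi.single n 1) +
          if l = j then κ n * (z n - a j (linIndex i n)) else 0 := by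
      intro l
      simp only [rowDeriv_apply, restCoeff, hbrest, add_mul, Finset.sum_add_distrib]
      congr 1
      split_ifs with hl
      · simp only [Finset.sum_mul, ite_mul, zero_mul]
        rw [Finset.sum_comm]
        simp only [Finset.sum_ite_eq', Finset.mem_univ, if_true, hκ]
        rw [Finset.sum_eq_single n]
        · simp [mul_comm]
        · intro n' _ hn'
          simp [hn']
        · simp
      · simp
    simp only [h1, mul_add, Finset.sum_add_distrib, hc, zero_add]
    simp [hcj]
  have hrest : parRest i j κ b = restCoeff i a := by
    funext l J
    simp only [parRest, hbrest, hdefect]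
    have : ∀ n, (κ n)⁻¹ * (κ n * (z n - a j (linIndex (N := N) i n))) =
        z n - a j (linIndex i n) := fun n => inv_mul_cancel_left₀ (hκ0 n) _
    simp only [this, restCoeff]
    ring
  refine ⟨b, by simp [b], ?_⟩
  funext l J
  simp only [parMap, hrest, hbpt]
  split_ifs with h
  · rw [(chart_mem_coeffZeroSet a i z).mp hz, h]
  · rfl

end Parametrization

/-- A proper range lies in the kernel of a nonzero functional, normalized here at one of its nonzero
coefficients. -/
theorem exists_relation_of_not_surjective {X : Type*} [AddCommGroup X] [Module ℂ X]
    (Y : X →ₗ[ℂ] (Fin ℓ → ℂ)) (hY : ¬ Function.Surjective Y) :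
    ∃ (j : Fin ℓ) (c : Fin ℓ → ℂ), c j = 1 ∧ ∀ v, ∑ l, c l * Y v l = 0 := by
  have h1 : Y.range < ⊤ := lt_top_iff_ne_top.mpr fun h => hY (LinearMap.range_eq_top.mp h)
  obtain ⟨f, hf0, hf⟩ := Submodule.exists_le_ker_of_lt_top _ h1
  have hfe : ∀ y : Fin ℓ → ℂ, f y = ∑ l, f (Pi.single l 1) * y l := by
    intro y
    conv_lhs => rw [LinearMap.pi_apply_eq_sum_univ f y]
    exact Finset.sum_congr rfl fun l _ => by rw [smul_eq_mul, mul_comm]; congr 2; ext; simp [Pi.single_apply, eq_comm]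
  obtain ⟨j, hj⟩ : ∃ j, f (Pi.single j 1) ≠ 0 := by
    by_contra! hcon
    exact hf0 (LinearMap.ext fun y => by rw [hfe]; simp [hcon])
  refine ⟨j, fun l => (f (Pi.single j 1))⁻¹ * f (Pi.single l 1), inv_mul_cancel₀ hj, fun v => ?_⟩
  have h2 : f (Y v) = 0 := hf ⟨v, rfl⟩
  rw [hfe] at h2
  simp only [mul_assoc, ← Finset.mul_sum, h2, mul_zero]

/-- In degree zero a nonzero constant among the equations excludes zeros altogether. In positive
degree a degenerate system lies in one of finitely many `C^1` images of a hyperplane in a space of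
the same dimension, and differentiable maps preserve null sets. -/
theorem ae_isRegular (hℓ : 1 ≤ ℓ) :
    ∀ᵐ a : Fin ℓ → MultiIndex m N → ℂ, IsRegular a := by
  rcases N with _ | N
  · let l₀ : Fin ℓ := ⟨0, hℓ⟩
    have h := volume_coeff_eq_zero (m := m) (N := 0) l₀ (baseIndex m 0 0)
    have h2 : ∀ᵐ a : Fin ℓ → MultiIndex m 0 → ℂ, a l₀ (baseIndex m 0 0) ≠ 0 := by
      rw [ae_iff]
      simpa using h
    filter_upwards [h2] with a ha i z hz
    exfalso
    apply ha
    rw [chart_mem_coeffZeroSet] at hz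
    have hb : baseIndex m 0 i = baseIndex m 0 0 := by
      apply Subtype.ext
      simp [baseIndex]
    have hemp : IsEmpty (RestIndex m 0 i) := ⟨fun J => J.2 (by
      apply Subtype.ext
      funext n
      have h3 : ∑ n, J.val.val n = 0 := Finset.Nat.mem_antidiagonalTuple.mp J.val.2
      have h4 := (Finset.sum_eq_zero_iff.mp h3) n (Finset.mem_univ n)
      rw [h4]
      simp [baseIndex])⟩
    have h5 := congrFun hz l₀
    simp only [chartFamily, Finset.univ_eq_empty, Finset.sum_empty, hb] at h5
    exact h5.symm
  · have hκ : ∀ i : Fin (m + 1), ∃ κ : Fin m → ℂ, (∀ n, κ n ≠ 0) ∧ ∀ n (z v : Fin m → ℂ),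
        rowCoeffDeriv i z (linRest (N := N) i n) v = κ n * v n := by
      intro i
      choose κ h0 h1 using fun n => exists_rowCoeffDeriv_linRest (N := N) i n
      exact ⟨κ, h0, h1⟩
    choose κ hκ0 hκ using hκ
    have hnull : ∀ (i : Fin (m + 1)) (j : Fin ℓ),
        volume (parMap (N := N) i j (κ i) '' {b | b j (baseIndex m (N + 1) i) = 0}) = 0 := by
      intro i j
      refine addHaar_image_eq_zero_of_differentiableOn_of_addHaar_eq_zero volume ?_
        (volume_coeff_eq_zero j _)
      exact (((contDiff_parMap i j (κ i)).differentiable (by simp)).restrictScalars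
        ℝ).differentiableOn
    have hae : ∀ᵐ a : Fin ℓ → MultiIndex m (N + 1) → ℂ, ∀ (i : Fin (m + 1)) (j : Fin ℓ),
        a ∉ parMap (N := N) i j (κ i) '' {b | b j (baseIndex m (N + 1) i) = 0} :=
      ae_all_iff.mpr fun i => ae_all_iff.mpr fun j => measure_eq_zero_iff_ae_notMem.mp (hnull i j)
    filter_upwards [hae] with a ha i z hz
    by_contra hns
    obtain ⟨j, c, hcj, hc⟩ := exists_relation_of_not_surjective
      (vertDeriv (chartFamily (N := N + 1) ℓ i) (restCoeff i a, z)).toLinearMap hns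
    refine ha i j (mem_image_parMap i j (κ i) (hκ0 i) (hκ i) hz hcj fun v => ?_)
    rw [← hc v]
    exact Finset.sum_congr rfl fun l _ => by
      rw [ContinuousLinearMap.coe_coe, vertDeriv_chartFamily]

/-! ### Integration against a family of measures -/

section Disintegration

variable {P X : Type*} [MeasurableSpace P] [MeasurableSpace X] {μ : Measure P} {κ : P → Measure X}
  {M : Measure X}

/-- The nonnegative case applied to `‖f‖` gives integrability for almost every `p`, and applied to
the positive and negative parts gives the identity. Measurability of `κ` enters only through `h`. -/
theorem integral_disintegration_real
    (h : ∀ H : X → ℝ≥0∞, Measurable H → AEMeasurable (fun p => ∫⁻ x, H x ∂(κ p)) μ ∧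
      ∫⁻ p, ∫⁻ x, H x ∂(κ p) ∂μ = ∫⁻ x, H x ∂M)
    {f : X → ℝ} (hf : Measurable f) (hi : Integrable f M) :
    (∀ᵐ p ∂μ, Integrable f (κ p)) ∧ Integrable (fun p => ∫ x, f x ∂(κ p)) μ ∧
      ∫ p, ∫ x, f x ∂(κ p) ∂μ = ∫ x, f x ∂M := by
  have hae : ∀ᵐ p ∂μ, Integrable f (κ p) := by
    obtain ⟨h1, h2⟩ := h (fun x => ‖f x‖ₑ) hf.enorm
    have h3 : ∫⁻ p, ∫⁻ x, ‖f x‖ₑ ∂(κ p) ∂μ ≠ ⊤ := by rw [h2]; exact hi.2.ne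
    filter_upwards [ae_lt_top' h1 h3] with p hp
    exact ⟨hf.aestronglyMeasurable, hp⟩
  have hpart : ∀ g : X → ℝ, Measurable g → Integrable g M →
      Integrable (fun p => (∫⁻ x, ENNReal.ofReal (g x) ∂(κ p)).toReal) μ ∧
      ∫ p, (∫⁻ x, ENNReal.ofReal (g x) ∂(κ p)).toReal ∂μ =
        (∫⁻ x, ENNReal.ofReal (g x) ∂M).toReal := by
    intro g hg hgi
    obtain ⟨h1, h2⟩ := h (fun x => ENNReal.ofReal (g x)) hg.ennreal_ofReal
    have h3 : ∫⁻ p, ∫⁻ x, ENNReal.ofReal (g x) ∂(κ p) ∂μ ≠ ⊤ := by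
      rw [h2]; exact hgi.lintegral_lt_top.ne
    exact ⟨integrable_toReal_of_lintegral_ne_top h1 h3, by
      rw [integral_toReal h1 (ae_lt_top' h1 h3), h2]⟩
  obtain ⟨p1, p2⟩ := hpart f hf hi
  obtain ⟨n1, n2⟩ := hpart (fun x => -f x) hf.neg hi.neg
  have heq : (fun p => ∫ x, f x ∂(κ p)) =ᵐ[μ] fun p =>
      (∫⁻ x, ENNReal.ofReal (f x) ∂(κ p)).toReal - (∫⁻ x, ENNReal.ofReal (-f x) ∂(κ p)).toReal := by
    filter_upwards [hae] with p hp
    exact integral_eq_lintegral_pos_part_sub_lintegral_neg_part hp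
  refine ⟨hae, (p1.sub n1).congr heq.symm, ?_⟩
  rw [integral_congr_ae heq, integral_sub p1 n1, p2, n2,
    integral_eq_lintegral_pos_part_sub_lintegral_neg_part hi]

/-- If `∫⁻ H dM = ∫⁻ ∫⁻ H dκ_p dμ(p)` for nonnegative functions `H`, then the same holds for
integrable functions. -/
theorem integral_disintegration
    (h : ∀ H : X → ℝ≥0∞, Measurable H → AEMeasurable (fun p => ∫⁻ x, H x ∂(κ p)) μ ∧
      ∫⁻ p, ∫⁻ x, H x ∂(κ p) ∂μ = ∫⁻ x, H x ∂M)
    {f : X → ℂ} (hf : Measurable f) (hi : Integrable f M) :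
    (∀ᵐ p ∂μ, Integrable f (κ p)) ∧ Integrable (fun p => ∫ x, f x ∂(κ p)) μ ∧
      ∫ p, ∫ x, f x ∂(κ p) ∂μ = ∫ x, f x ∂M := by
  obtain ⟨r1, r2, r3⟩ := integral_disintegration_real h (Complex.measurable_re.comp hf) hi.re
  obtain ⟨i1, i2, i3⟩ := integral_disintegration_real h (Complex.measurable_im.comp hf) hi.im
  have hae : ∀ᵐ p ∂μ, Integrable f (κ p) := by
    filter_upwards [r1, i1] with p h1 h2
    have := h1.ofReal.add (h2.ofReal.mul_const Complex.I)
    refine (this : Integrable _ (κ p)).congr (Filter.Eventually.of_forall fun x => ?_)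
    exact Complex.re_add_im (f x)
  have heq : (fun p => ∫ x, f x ∂(κ p)) =ᵐ[μ] fun p =>
      ((∫ x, (f x).re ∂(κ p) : ℝ) : ℂ) + ((∫ x, (f x).im ∂(κ p) : ℝ) : ℂ) * Complex.I := by
    filter_upwards [hae] with p hp
    exact (integral_re_add_im hp).symm
  have r2' : Integrable (fun p => ((∫ x, (f x).re ∂(κ p) : ℝ) : ℂ)) μ := r2.ofReal
  have i2' : Integrable (fun p => ((∫ x, (f x).im ∂(κ p) : ℝ) : ℂ)) μ := i2.ofReal
  refine ⟨hae, (r2'.add (i2'.mul_const Complex.I)).congr heq.symm, ?_⟩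
  rw [integral_congr_ae heq, integral_add r2' (i2'.mul_const _), integral_mul_const,
    integral_complex_ofReal, integral_complex_ofReal]
  exact (congrArg₂ (fun s t : ℝ => (s : ℂ) + (t : ℂ) * Complex.I) r3 i3).trans
    (integral_re_add_im hi)

end Disintegration

/-! ### The distribution of the coefficients -/

variable {m N ℓ : ℕ}

/-- The distribution of the coefficients of `ℓ` independent random polynomials. -/
def coeffLaw (m N ℓ : ℕ) : Measure (Fin ℓ → MultiIndex m N → ℂ) :=
  Measure.pi fun _ => Measure.pi fun _ => complexGaussian

/-- The density of `coeffLaw`. -/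
def coeffDensity (a : Fin ℓ → MultiIndex m N → ℂ) : ℝ := ∏ l, ∏ J, gaussDensity (a l J)

theorem continuous_coeffDensity : Continuous (coeffDensity (m := m) (N := N) (ℓ := ℓ)) :=
  continuous_finsetProd _ fun l _ => continuous_finsetProd _ fun J _ =>
    continuous_gaussDensity.comp ((continuous_apply J).comp (continuous_apply l))

theorem coeffLaw_eq : coeffLaw m N ℓ =
    volume.withDensity fun a => ENNReal.ofReal (coeffDensity a) := by
  rw [coeffLaw, pi_complexGaussian, pi_withDensity]
  · rfl
  · exact fun _ _ => Finset.prod_nonneg fun _ _ => gaussDensity_nonneg _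
  · exact fun _ => Integrable.fintype_prod_dep fun _ => integrable_gaussDensity

theorem map_curry_pi {ι κ X : Type*} [Fintype ι] [Fintype κ] [MeasurableSpace X] (ν : Measure X)
    [SigmaFinite ν] : (Measure.pi fun _ : ι × κ => ν).map (fun x i j => x (i, j)) =
      Measure.pi fun _ : ι => Measure.pi fun _ : κ => ν := by
  have h1 : Measurable fun (x : ι × κ → X) i j => x (i, j) :=
    measurable_pi_lambda _ fun i => measurable_pi_lambda _ fun j => measurable_pi_apply _
  have h2 : Measurable fun (x : ι → κ → X) (p : ι × κ) => x p.1 p.2 :=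
    measurable_pi_lambda _ fun p => (measurable_pi_apply p.2).comp (measurable_pi_apply p.1)
  have h3 : (Measure.pi fun _ : ι × κ => ν) =
      (Measure.pi fun _ : ι => Measure.pi fun _ : κ => ν).map fun x p => x p.1 p.2 := by
    refine Measure.pi_eq fun s hs => ?_
    rw [Measure.map_apply h2 (MeasurableSet.univ_pi hs)]
    have : (fun (x : ι → κ → X) (p : ι × κ) => x p.1 p.2) ⁻¹' (Set.univ.pi s) =
        Set.univ.pi fun i => Set.univ.pi fun j => s (i, j) := by
      ext x
      simp [Set.mem_pi]
    rw [this, Measure.pi_pi]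
    simp only [Measure.pi_pi, Fintype.prod_prod_type]
  rw [h3, Measure.map_map h1 h2]
  exact Measure.map_id

theorem map_coeff {Ω : Type*} [MeasurableSpace Ω] {μ : Measure Ω} [IsProbabilityMeasure μ]
    {a : Fin ℓ → MultiIndex m N → Ω → ℂ}
    (ha_indep : iIndepFun (fun p : Fin ℓ × MultiIndex m N => a p.1 p.2) μ)
    (ha_law : ∀ i J, HasLaw (a i J) complexGaussian μ) :
    μ.map (fun x l J => a l J x) = coeffLaw m N ℓ := by
  have h1 := (iIndepFun_iff_map_fun_eq_pi_map
    fun p : Fin ℓ × MultiIndex m N => (ha_law p.1 p.2).aemeasurable).mp ha_indep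
  simp only [(ha_law _ _).map_eq] at h1
  rw [coeffLaw, ← map_curry_pi, ← h1, AEMeasurable.map_map_of_aemeasurable]
  · rfl
  · exact (measurable_pi_lambda _ fun i => measurable_pi_lambda _ fun j =>
      measurable_pi_apply _).aemeasurable
  · exact aemeasurable_pi_lambda _ fun p => (ha_law p.1 p.2).aemeasurable

/-- Separate the coefficients of `w_i^N` from the others. -/
def splitCoeff (i : Fin (m + 1)) (a : Fin ℓ → MultiIndex m N → ℂ) :
    (Fin ℓ → RestIndex m N i → ℂ) × (Fin ℓ → ℂ) :=
  (restCoeff i a, fun l => a l (baseIndex m N i))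

theorem measurePreserving_splitCoeff (i : Fin (m + 1)) :
    MeasurePreserving (splitCoeff (N := N) (ℓ := ℓ) i) volume (volume.prod volume) := by
  let _ : Unique {J : MultiIndex m N // ¬ J ≠ baseIndex m N i} :=
    { default := ⟨baseIndex m N i, by simp⟩
      uniq := fun J => Subtype.ext (not_not.mp J.2) }
  have h1 := volume_preserving_piEquivPiSubtypeProd (fun _ : MultiIndex m N => ℂ)
    (fun J => J ≠ baseIndex m N i)
  have h2 : MeasurePreserving (fun f : {J : MultiIndex m N // ¬ J ≠ baseIndex m N i} → ℂ =>
      f default) volume volume := by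
    convert volume_preserving_funUnique {J : MultiIndex m N // ¬ J ≠ baseIndex m N i} ℂ
    rfl
  have h3 : MeasurePreserving (fun a : MultiIndex m N → ℂ =>
      ((fun J => a J.val : RestIndex m N i → ℂ), a (baseIndex m N i))) volume
      (volume.prod volume) := by
    have h := ((MeasurePreserving.id (volume : Measure (RestIndex m N i → ℂ))).prod h2).comp h1
    exact h
  have h4 := measurePreserving_pi (fun _ : Fin ℓ => volume) (fun _ : Fin ℓ => volume.prod volume)
    fun _ => h3
  exact (measurePreserving_arrowProdEquivProdArrow (RestIndex m N i → ℂ) ℂ (Fin ℓ)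
    (fun _ => volume) (fun _ => volume)).comp h4

/-- The density of the law of the coefficients, restricted to the polynomials that vanish at
`chart i z`. -/
def fibreDensity (i : Fin (m + 1)) (x : (Fin ℓ → RestIndex m N i → ℂ) × (Fin m → ℂ)) : ℝ :=
  ∏ l, rowDensity (rowCoeff i x.2) (x.1 l)

theorem fibreDensity_nonneg (i : Fin (m + 1)) (x : (Fin ℓ → RestIndex m N i → ℂ) × (Fin m → ℂ)) :
    0 ≤ fibreDensity i x := Finset.prod_nonneg fun _ _ => rowDensity_nonneg _ _

theorem continuous_fibreDensity (i : Fin (m + 1)) :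
    Continuous (fibreDensity (N := N) (ℓ := ℓ) i) := by
  refine continuous_finsetProd _ fun l _ => ?_
  have h1 : ∀ J, Continuous fun x : (Fin ℓ → RestIndex m N i → ℂ) × (Fin m → ℂ) => x.1 l J :=
    fun J => by fun_prop
  exact (continuous_gaussDensity.comp (continuous_finsetSum _ fun J _ => (h1 J).mul
    ((contDiff_rowCoeff (n := 1) i J).continuous.comp continuous_snd))).mul
    (continuous_finsetProd _ fun J _ => continuous_gaussDensity.comp (h1 J))

/-- On a zero the coefficient of `w_i^N` equals `∑ a_J r_J`, so its Gaussian factor is the first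
factor of `rowDensity`. -/
theorem coeffDensity_eq_fibreDensity {i : Fin (m + 1)} {a : Fin ℓ → MultiIndex m N → ℂ}
    {z : Fin m → ℂ}
    (h : chartFamily ℓ i (restCoeff i a, z) = fun l => a l (baseIndex m N i)) :
    coeffDensity a = fibreDensity i (restCoeff i a, z) := by
  refine Finset.prod_congr rfl fun l _ => ?_
  have h1 : ∑ J, restCoeff i a l J * rowCoeff i z J = a l (baseIndex m N i) := congrFun h l
  rw [rowDensity, h1, Fintype.prod_eq_mul_prod_compl (baseIndex m N i)]
  congr 1
  refine Finset.prod_subtype _ (fun J => ?_) _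
  simp

/-! ### The expected zero measure in a chart -/

variable {m N ℓ k : ℕ}

/-! ### Positivity of the coarea factor on the regular set -/

section FamilyFactor

variable {B : Type*} [NormedAddCommGroup B] [NormedSpace ℂ B]

theorem levelForm_eq_zero {g : B × (Fin m → ℂ) → Fin ℓ → ℂ} {x : B × (Fin m → ℂ)}
    (hx : x ∉ regularSet g) : levelForm (vertDeriv g x) = 0 :=
  wedgeProd_eq_zero_of_not_surjective _ hx

theorem wedgeAt_zero_left {E : Type*} [AddCommGroup E] [Module ℝ E] {p q n : ℕ} (h : p + q = n)
    (β : E [⋀^Fin q]→ₗ[ℝ] ℂ) : wedgeAt h (0 : E [⋀^Fin p]→ₗ[ℝ] ℂ) β = 0 := by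
  ext v
  simp [wedgeAt_apply]

theorem familyFactor_eq_zero (hm : ℓ + k = m) (i : Fin (m + 1))
    {g : B × (Fin m → ℂ) → Fin ℓ → ℂ} {x : B × (Fin m → ℂ)} (hx : x ∉ regularSet g) :
    familyFactor hm i g x = 0 := by
  rw [familyFactor, coareaFactor, levelForm_eq_zero hx, wedgeAt_zero_left]
  simp

theorem familyFactor_pos (hm : ℓ + k = m) (i : Fin (m + 1))
    {g : B × (Fin m → ℂ) → Fin ℓ → ℂ} {x : B × (Fin m → ℂ)} (hx : x ∈ regularSet g) :
    0 < familyFactor hm i g x := by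
  obtain ⟨π, hd⟩ := exists_complementary_map hm (vertDeriv g x) hx
  obtain ⟨D, -, hDs, -⟩ := exists_kernel_frame hm (vertDeriv g x) π hd
  have h := coareaFactor_eq hm (vertDeriv g x) π hd (chartFS i x.2)
    (fsMap_chartLin_injective i x.2) D hDs
  rw [familyFactor, h.1]
  exact mul_pos (pow_pos (norm_pos_iff.mpr hd) 2) h.2

theorem familyFactor_nonneg (hm : ℓ + k = m) (i : Fin (m + 1))
    (g : B × (Fin m → ℂ) → Fin ℓ → ℂ) (x : B × (Fin m → ℂ)) : 0 ≤ familyFactor hm i g x := by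
  by_cases hx : x ∈ regularSet g
  · exact (familyFactor_pos hm i hx).le
  · exact (familyFactor_eq_zero hm i hx).ge

theorem isOpen_regularSet (hm : ℓ + k = m) {g : B × (Fin m → ℂ) → Fin ℓ → ℂ}
    (hg : ContDiff ℂ 1 g) : IsOpen (regularSet g) := by
  have h : regularSet g = familyFactor hm 0 g ⁻¹' {0}ᶜ := by
    ext x
    by_cases hx : x ∈ regularSet g
    · simp [hx, (familyFactor_pos hm 0 hx).ne']
    · simp [hx, familyFactor_eq_zero hm 0 hx]
  rw [h]
  exact isOpen_compl_singleton.preimage (continuous_familyFactor hm 0 hg)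

theorem wedge_levelForm_vertDeriv (hm : ℓ + k = m) (i : Fin (m + 1))
    (g : B × (Fin m → ℂ) → Fin ℓ → ℂ) (x : B × (Fin m → ℂ)) :
    wedgeAt (two_mul_add hm) (levelForm (vertDeriv g x))
      (wedgeProd k fun _ => hform (chartFS i x.2).toLinearMap) (stdFrame m) =
        (k.factorial : ℂ) * (familyFactor hm i g x : ℂ) := by
  by_cases hx : x ∈ regularSet g
  · exact wedge_levelForm_hform hm _ hx _ (fsMap_chartLin_injective i x.2)
  · rw [familyFactor_eq_zero hm i hx, levelForm_eq_zero hx, wedgeAt_zero_left]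
    simp

end FamilyFactor

theorem chartFS_injective (i : Fin (m + 1)) (z : Fin m → ℂ) : Function.Injective (chartFS i z) :=
  fsMap_chartLin_injective i z

theorem continuous_chartFS (i : Fin (m + 1)) : Continuous (chartFS (m := m) i) :=
  continuous_fsMap_chart i

theorem hasMetricDerivAt_chart (i : Fin (m + 1)) (z : Fin m → ℂ) :
    HasMetricDerivAt (chart i) (chartFS i z) z := by
  have h := hasMetricDerivAt_chart_comp i (ζ := id) (hasStrictFDerivAt_id z)
  rw [ContinuousLinearMap.comp_id] at h
  exact h

theorem chartVol_eq (i : Fin (m + 1)) :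
    chartVol m i = volume.withDensity fun z => ENNReal.ofReal (gramDet (chartFS i z)) := by
  ext S hS
  rw [chartVol, (measurableEmbedding_chart i).comap_apply, withDensity_apply _ hS]
  exact area_formula (N := chartFS i) isOpen_univ (fun z _ => chartFS_injective i z)
    (fun z _ => hasMetricDerivAt_chart i z) (chart_injective i).injOn
    (continuous_gramDet.comp (continuous_chartFS i)).continuousOn hS (Set.subset_univ S)

theorem continuous_gramDet_chartFS (i : Fin (m + 1)) :
    Continuous fun z : Fin m → ℂ => gramDet (chartFS i z) :=
  continuous_gramDet.comp (continuous_chartFS i)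

theorem gramDet_chartFS_pos (i : Fin (m + 1)) (z : Fin m → ℂ) : 0 < gramDet (chartFS i z) := by
  let _ : MeasurableSpace (V m) := borel (V m)
  have : BorelSpace (V m) := ⟨rfl⟩
  exact (hausdorff_image_linear (chartFS i z) (fsMap_chartLin_injective i z)).1

/-- For fixed `z` the weight is a product over the rows, and each row contributes one two-form to
`levelForm`. The average is therefore the wedge of the `ℓ` row averages, each equal to `N` times the
Fubini-Study form in the chart. -/
theorem integral_fibreDensity_wedge (hm : ℓ + k = m) (i : Fin (m + 1)) (z : Fin m → ℂ)
    (φ : (Fin m → ℂ) [⋀^Fin (2 * k)]→ₗ[ℝ] ℂ) :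
    Integrable (fun b : Fin ℓ → RestIndex m N i → ℂ => (fibreDensity i (b, z) : ℂ) *
      wedgeAt (two_mul_add hm) (levelForm (vertDeriv (chartFamily ℓ i) (b, z))) φ (stdFrame m)) ∧
    ∫ b : Fin ℓ → RestIndex m N i → ℂ, (fibreDensity i (b, z) : ℂ) *
      wedgeAt (two_mul_add hm) (levelForm (vertDeriv (chartFamily ℓ i) (b, z))) φ (stdFrame m) =
      (N : ℂ) ^ ℓ * wedgeAt (two_mul_add hm)
        (wedgeProd ℓ fun _ => hform (chartFS i z).toLinearMap) φ (stdFrame m) := by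
  set r : RestIndex m N i → ℂ := rowCoeff i z with hr
  have hmr := (continuous_rowDensity r).measurable
  have : IsFiniteMeasure (volume.withDensity fun a => ENNReal.ofReal (rowDensity r a)) :=
    isFiniteMeasure_withDensity_ofReal (integrable_rowDensity r).2
  have hW : (Measure.pi fun _ : Fin ℓ => volume.withDensity fun a => ENNReal.ofReal (rowDensity r a))
      = volume.withDensity fun b => ENNReal.ofReal (fibreDensity i (b, z)) :=
    pi_withDensity _ _ (fun _ => rowDensity_nonneg r) fun _ => integrable_rowDensity r
  have hmW : Measurable fun b : Fin ℓ → RestIndex m N i → ℂ => fibreDensity i (b, z) :=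
    ((continuous_fibreDensity i).comp (continuous_id.prodMk continuous_const)).measurable
  have h := integral_wedgeAt_wedgeProd
    (volume.withDensity fun a => ENNReal.ofReal (rowDensity r a))
    (fun a => hform (rowDeriv i z a).toLinearMap) ((N : ℝ) • hform (chartFS i z).toLinearMap)
    (fun v => (integrable_withDensity_ofReal hmr (rowDensity_nonneg r)).mpr
      (integral_rowDensity_hform i z v).1)
    (fun v => (integral_withDensity_ofReal hmr (rowDensity_nonneg r)).trans
      (integral_rowDensity_hform i z v).2) (two_mul_add hm) φ (stdFrame m)
  rw [hW, integrable_withDensity_ofReal hmW (fun b => fibreDensity_nonneg i _),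
    integral_withDensity_ofReal hmW (fun b => fibreDensity_nonneg i _)] at h
  simp only [levelForm_chartFamily]
  refine ⟨h.1, h.2.trans ?_⟩
  have h2 := wedgeAt_smul (two_mul_add hm) (wedgeProd ℓ fun _ => hform (chartFS i z).toLinearMap) φ
    ((N : ℝ) ^ ℓ) 1
  rw [one_smul, mul_one] at h2
  rw [wedgeProd_smul, h2, AlternatingMap.smul_apply, Complex.real_smul]
  push_cast
  rfl

/-- Take the `k`-th power of the Fubini-Study form as `φ`. The random side is `k!` times the coarea
factor, while the averaged side is `m!` times the Gram determinant by Wirtinger. -/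
theorem lintegral_fibreDensity (hm : ℓ + k = m) (i : Fin (m + 1)) (z : Fin m → ℂ) :
    ∫⁻ b : Fin ℓ → RestIndex m N i → ℂ, ENNReal.ofReal (fibreDensity i (b, z)) *
      ENNReal.ofReal (familyFactor hm i (chartFamily ℓ i) (b, z)) =
      (m.factorial : ℝ≥0∞) / (k.factorial : ℝ≥0∞) * (N : ℝ≥0∞) ^ ℓ *
        ENNReal.ofReal (gramDet (chartFS i z)) := by
  obtain ⟨h1, h2⟩ := integral_fibreDensity_wedge (N := N) hm i z
    (wedgeProd k fun _ => hform (chartFS i z).toLinearMap)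
  have hk : (0 : ℝ) < k.factorial := by exact_mod_cast k.factorial_pos
  have h3 : ∀ b : Fin ℓ → RestIndex m N i → ℂ, (fibreDensity i (b, z) : ℂ) *
      wedgeAt (two_mul_add hm) (levelForm (vertDeriv (chartFamily ℓ i) (b, z)))
        (wedgeProd k fun _ => hform (chartFS i z).toLinearMap) (stdFrame m) =
      ((k.factorial * (fibreDensity i (b, z) * familyFactor hm i (chartFamily ℓ i) (b, z)) : ℝ)
        : ℂ) := fun b => by
    rw [wedge_levelForm_vertDeriv hm i (chartFamily ℓ i) (b, z)]
    push_cast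
    ring
  simp only [h3] at h1 h2
  rw [stdFrame, wedge_hform_eq_gramDet hm (two_mul_add hm) _ (chartFS_injective i z),
    integral_complex_ofReal, integral_const_mul] at h2
  have h4 : (k.factorial : ℝ) * ∫ b : Fin ℓ → RestIndex m N i → ℂ,
      fibreDensity i (b, z) * familyFactor hm i (chartFamily ℓ i) (b, z) =
      (N : ℝ) ^ ℓ * (m.factorial * gramDet (chartFS i z)) := by
    exact_mod_cast h2
  have h5 : Integrable fun b : Fin ℓ → RestIndex m N i → ℂ =>
      fibreDensity i (b, z) * familyFactor hm i (chartFamily ℓ i) (b, z) := by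
    have := (h1.re.const_mul (k.factorial : ℝ)⁻¹)
    refine this.congr (Filter.Eventually.of_forall fun b => ?_)
    simp [hk.ne']
  have h6 : ∀ b : Fin ℓ → RestIndex m N i → ℂ, 0 ≤
      fibreDensity i (b, z) * familyFactor hm i (chartFamily ℓ i) (b, z) := fun b =>
    mul_nonneg (fibreDensity_nonneg i _) (familyFactor_nonneg hm i _ _)
  simp only [← ENNReal.ofReal_mul (fibreDensity_nonneg i _)]
  rw [← ofReal_integral_eq_lintegral_ofReal h5 (Filter.Eventually.of_forall h6)]
  have h7 : ∫ b : Fin ℓ → RestIndex m N i → ℂ,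
      fibreDensity i (b, z) * familyFactor hm i (chartFamily ℓ i) (b, z) =
      (m.factorial : ℝ) / k.factorial * (N : ℝ) ^ ℓ * gramDet (chartFS i z) := by
    field_simp
    linarith
  rw [h7, ENNReal.ofReal_mul (by positivity), ENNReal.ofReal_mul (by positivity),
    ENNReal.ofReal_div_of_pos hk, ENNReal.ofReal_pow (by positivity)]
  simp only [ENNReal.ofReal_natCast]

theorem IsRegular.setOf_chart_mem {a : Fin ℓ → MultiIndex m N → ℂ} (ha : IsRegular a)
    (i : Fin (m + 1)) : {z | chart i z ∈ coeffZeroSet a} =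
      {z | ((splitCoeff i a).1, z) ∈ regularSet (chartFamily (N := N) ℓ i) ∧
        chartFamily ℓ i ((splitCoeff i a).1, z) = (splitCoeff i a).2} := by
  ext z
  exact ⟨fun hz => ⟨ha i z hz, (chart_mem_coeffZeroSet a i z).mp hz⟩,
    fun hz => (chart_mem_coeffZeroSet a i z).mpr hz.2⟩

theorem ae_isRegular_coeffLaw (hℓ : 1 ≤ ℓ) : ∀ᵐ a ∂(coeffLaw m N ℓ), IsRegular a := by
  rw [coeffLaw_eq]
  exact (withDensity_absolutelyContinuous _ _).ae_le (ae_isRegular hℓ)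

/-- The expectation of integrals over the random zero set, in the `i`-th chart. -/
theorem lintegral_coeffLaw (hℓ : 1 ≤ ℓ) (hm : ℓ + k = m) (i : Fin (m + 1))
    {H : (Fin ℓ → RestIndex m N i → ℂ) × (Fin m → ℂ) → ℝ≥0∞} (hH : Measurable H) :
    AEMeasurable (fun a => ∫⁻ z in {z | chart i z ∈ coeffZeroSet a}, H (restCoeff i a, z)
      ∂(chartVol k i)) (coeffLaw m N ℓ) ∧
    ∫⁻ a, (∫⁻ z in {z | chart i z ∈ coeffZeroSet a}, H (restCoeff i a, z) ∂(chartVol k i))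
        ∂(coeffLaw m N ℓ) =
      ∫⁻ x, H x * (ENNReal.ofReal (fibreDensity i x) *
        ENNReal.ofReal (familyFactor hm i (chartFamily ℓ i) x)) ∂(volume.prod volume) := by
  have hg := contDiff_chartFamily (N := N) (ℓ := ℓ) (n := 1) i
  have hR := isOpen_regularSet hm hg
  have hS := measurePreserving_splitCoeff (N := N) (ℓ := ℓ) i
  have hmγ : Measurable fun a : Fin ℓ → MultiIndex m N → ℂ => ENNReal.ofReal (coeffDensity a) :=
    continuous_coeffDensity.measurable.ennreal_ofReal
  have hmW : Measurable fun x : (Fin ℓ → RestIndex m N i → ℂ) × (Fin m → ℂ) =>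
      ENNReal.ofReal (fibreDensity i x) := (continuous_fibreDensity i).measurable.ennreal_ofReal
  let T (G : (Fin ℓ → RestIndex m N i → ℂ) × (Fin m → ℂ) → ℝ≥0∞)
      (p : (Fin ℓ → RestIndex m N i → ℂ) × (Fin ℓ → ℂ)) : ℝ≥0∞ :=
    ∫⁻ z in {z | (p.1, z) ∈ regularSet (chartFamily (N := N) ℓ i) ∧
      chartFamily ℓ i (p.1, z) = p.2}, G (p.1, z) ∂(chartVol k i)
  obtain ⟨hT, -⟩ := coarea_family hm hg i volume hH
  obtain ⟨hT', hint⟩ := coarea_family hm hg i volume (hH.mul hmW)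
  have hT'' : Measurable (T fun x => H x * ENNReal.ofReal (fibreDensity i x)) := hT'
  have hTS : Measurable fun a => T H (splitCoeff i a) := hT.comp hS.measurable
  have hae : (fun a => ∫⁻ z in {z | chart i z ∈ coeffZeroSet a}, H (restCoeff i a, z)
      ∂(chartVol k i)) =ᵐ[coeffLaw m N ℓ] fun a => T H (splitCoeff i a) := by
    filter_upwards [ae_isRegular_coeffLaw hℓ] with a ha
    rw [ha.setOf_chart_mem i]
    rfl
  refine ⟨⟨_, hTS, hae⟩, ?_⟩
  -- For given `a` the Gaussian density is constant in `z`, and along the zero set it equals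
  -- `fibreDensity`. It may therefore be moved inside the fibre integral before the coarea formula
  -- is applied.
  have hmul : ∀ a : Fin ℓ → MultiIndex m N → ℂ, ENNReal.ofReal (coeffDensity a) *
      T H (splitCoeff i a) = T (fun x => H x * ENNReal.ofReal (fibreDensity i x))
        (splitCoeff i a) := by
    intro a
    have hms : MeasurableSet {z | ((splitCoeff i a).1, z) ∈ regularSet (chartFamily (N := N) ℓ i) ∧
        chartFamily ℓ i ((splitCoeff i a).1, z) = (splitCoeff i a).2} := by
      have hc : Continuous fun z : Fin m → ℂ => ((splitCoeff (N := N) (ℓ := ℓ) i a).1, z) :=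
        continuous_const.prodMk continuous_id
      exact (hR.preimage hc).measurableSet.inter
        (isClosed_singleton.preimage (hg.continuous.comp hc)).measurableSet
    rw [← lintegral_const_mul' _ _ ENNReal.ofReal_ne_top]
    refine setLIntegral_congr_fun hms fun z hz => ?_
    rw [coeffDensity_eq_fibreDensity (z := z) (i := i) hz.2, mul_comm]
    rfl
  rw [lintegral_congr_ae hae, coeffLaw_eq, lintegral_withDensity_eq_lintegral_mul _ hmγ hTS]
  simp only [Pi.mul_apply, hmul]
  rw [hS.lintegral_comp hT'']
  refine hint.trans ?_
  rw [← lintegral_indicator hR.measurableSet]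
  refine lintegral_congr fun x => ?_
  by_cases hx : x ∈ regularSet (chartFamily (N := N) ℓ i)
  · rw [Set.indicator_of_mem hx, Pi.mul_apply, mul_assoc]
  · rw [Set.indicator_of_notMem hx, familyFactor_eq_zero hm i hx]
    simp

/-! ### Integration over projective space in charts -/

variable {m N ℓ k : ℕ}

theorem inter_chart_image (S : Set (CP m)) (i : Fin (m + 1)) :
    S ∩ chart i '' chartPiece i = chart i '' (chart i ⁻¹' S ∩ chartPiece i) := by
  rw [Set.inter_comm (chart i ⁻¹' S), Set.image_inter_preimage, Set.inter_comm]

theorem iUnion_chart_image_preimage (S : Set (CP m)) :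
    ⋃ i, chart i '' (chart i ⁻¹' S ∩ chartPiece i) = S := by
  simp only [← inter_chart_image, ← Set.inter_iUnion, iUnion_chart_image, Set.inter_univ]

theorem disjoint_chart_image_preimage (S : Set (CP m)) : Pairwise (Function.onFun Disjoint
    fun i : Fin (m + 1) => chart i '' (chart i ⁻¹' S ∩ chartPiece i)) := fun _ _ hij =>
  (disjoint_chart_image hij).mono (Set.image_mono Set.inter_subset_right)
    (Set.image_mono Set.inter_subset_right)

theorem measurableSet_chart_preimage {S : Set (CP m)} (hS : MeasurableSet S) (i : Fin (m + 1)) :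
    MeasurableSet (chart i ⁻¹' S ∩ chartPiece i) :=
  ((continuous_chart i).measurable hS).inter (measurableSet_chartPiece i)

theorem vol_eq_sum {S : Set (CP m)} (hS : MeasurableSet S) :
    vol m (2 * k) S = ∑ i, chartVol k i (chart i ⁻¹' S ∩ chartPiece i) := by
  conv_lhs => rw [← iUnion_chart_image_preimage S]
  rw [measure_iUnion (disjoint_chart_image_preimage S) fun i =>
    (measurableEmbedding_chart i).measurableSet_image.mpr (measurableSet_chart_preimage hS i),
    tsum_fintype]
  exact Finset.sum_congr rfl fun i _ => ((measurableEmbedding_chart i).comap_apply _ _).symm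

theorem restrict_chart_image (i : Fin (m + 1)) (T : Set (Fin m → ℂ)) :
    (vol m (2 * k)).restrict (chart i '' T) =
      ((chartVol k i).map (chart i)).restrict (chart i '' T) := by
  rw [chartVol, (measurableEmbedding_chart i).map_comap,
    Measure.restrict_restrict_of_subset (Set.image_subset_range _ _)]

theorem integral_vol_eq_sum {S : Set (CP m)} (hS : MeasurableSet S) {F : CP m → ℂ}
    (hF : ∀ i, IntegrableOn (fun z => F (chart i z)) (chart i ⁻¹' S ∩ chartPiece i)
      (chartVol k i)) :
    ∫ p in S, F p ∂(vol m (2 * k)) =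
      ∑ i, ∫ z in chart i ⁻¹' S ∩ chartPiece i, F (chart i z) ∂(chartVol k i) := by
  conv_lhs => rw [← iUnion_chart_image_preimage S]
  rw [integral_iUnion_fintype (fun i => (measurableEmbedding_chart i).measurableSet_image.mpr
    (measurableSet_chart_preimage hS i)) (disjoint_chart_image_preimage S) fun i => ?_]
  · refine Finset.sum_congr rfl fun i _ => ?_
    rw [restrict_chart_image, (measurableEmbedding_chart i).setIntegral_map,
      Set.preimage_image_eq _ (chart_injective i)]
  · rw [IntegrableOn, restrict_chart_image, ← IntegrableOn,
      (measurableEmbedding_chart i).integrableOn_map_iff,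
      Set.preimage_image_eq _ (chart_injective i)]
    exact hF i

theorem measurableSet_chart_mem (a : Fin ℓ → MultiIndex m N → ℂ) (i : Fin (m + 1)) :
    MeasurableSet {z | chart i z ∈ coeffZeroSet a} := by
  simp only [chart_mem_coeffZeroSet]
  exact (isClosed_singleton.preimage ((contDiff_chartFamily (n := 1) i).continuous.comp
    (continuous_const.prodMk continuous_id))).measurableSet

theorem measurableSet_coeffZeroSet (a : Fin ℓ → MultiIndex m N → ℂ) :
    MeasurableSet (coeffZeroSet a) := by
  rw [← iUnion_chart_image_preimage (coeffZeroSet a)]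
  exact MeasurableSet.iUnion fun i => (measurableEmbedding_chart i).measurableSet_image.mpr
    ((measurableSet_chart_mem a i).inter (measurableSet_chartPiece i))

/-- The expected volume of the random zero set. -/
theorem lintegral_vol_coeffZeroSet (hℓ : 1 ≤ ℓ) (hm : ℓ + k = m) {U : Set (CP m)}
    (hU : MeasurableSet U) :
    AEMeasurable (fun a => vol m (2 * k) (U ∩ coeffZeroSet a)) (coeffLaw m N ℓ) ∧
    ∫⁻ a, vol m (2 * k) (U ∩ coeffZeroSet a) ∂(coeffLaw m N ℓ) =
      (m.factorial : ℝ≥0∞) / (k.factorial : ℝ≥0∞) * (N : ℝ≥0∞) ^ ℓ * vol m (2 * m) U := by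
  let H (i : Fin (m + 1)) (x : (Fin ℓ → RestIndex m N i → ℂ) × (Fin m → ℂ)) : ℝ≥0∞ :=
    (chart i ⁻¹' U ∩ chartPiece i).indicator 1 x.2
  have hH : ∀ i, Measurable (H i) := fun i =>
    (measurable_one.indicator (measurableSet_chart_preimage hU i)).comp measurable_snd
  have hsum : ∀ a : Fin ℓ → MultiIndex m N → ℂ, vol m (2 * k) (U ∩ coeffZeroSet a) =
      ∑ i, ∫⁻ z in {z | chart i z ∈ coeffZeroSet a}, H i (restCoeff i a, z) ∂(chartVol k i) := by
    intro a
    rw [vol_eq_sum (hU.inter (measurableSet_coeffZeroSet a))]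
    refine Finset.sum_congr rfl fun i _ => ?_
    change _ = ∫⁻ z in {z | chart i z ∈ coeffZeroSet a},
      (chart i ⁻¹' U ∩ chartPiece i).indicator 1 z ∂(chartVol k i)
    rw [lintegral_indicator_one (measurableSet_chart_preimage hU i),
      Measure.restrict_apply (measurableSet_chart_preimage hU i)]
    congr 1
    ext z
    simp only [Set.mem_inter_iff, Set.mem_preimage, Set.mem_ofPred_eq]
    tauto
  simp only [hsum]
  have hK := fun i => lintegral_coeffLaw hℓ hm i (hH i)
  refine ⟨Finset.aemeasurable_fun_sum _ fun i _ => (hK i).1, ?_⟩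
  rw [lintegral_finsetSum' _ fun i _ => (hK i).1, vol_eq_sum hU, Finset.mul_sum]
  refine Finset.sum_congr rfl fun i _ => (hK i).2.trans ?_
  have hmW : Measurable fun x : (Fin ℓ → RestIndex m N i → ℂ) × (Fin m → ℂ) =>
      ENNReal.ofReal (fibreDensity i x) *
        ENNReal.ofReal (familyFactor hm i (chartFamily ℓ i) x) :=
    (continuous_fibreDensity i).measurable.ennreal_ofReal.mul
      (continuous_familyFactor hm i (contDiff_chartFamily i)).measurable.ennreal_ofReal
  -- Tonelli with the coefficients integrated first: at fixed `z` their integral is known, and the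
  -- indicator of `U` depends on `z` only.
  refine (lintegral_prod_symm _ ((hH i).mul hmW).aemeasurable).trans ?_
  simp only [Pi.mul_apply]
  have hz : ∀ z : Fin m → ℂ, ∫⁻ b : Fin ℓ → RestIndex m N i → ℂ, H i (b, z) *
      (ENNReal.ofReal (fibreDensity i (b, z)) *
        ENNReal.ofReal (familyFactor hm i (chartFamily ℓ i) (b, z))) =
      (m.factorial : ℝ≥0∞) / (k.factorial : ℝ≥0∞) * (N : ℝ≥0∞) ^ ℓ *
        (chart i ⁻¹' U ∩ chartPiece i).indicator
          (fun z => ENNReal.ofReal (gramDet (chartFS i z))) z := by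
    intro z
    by_cases hz : z ∈ chart i ⁻¹' U ∩ chartPiece i
    · simp only [H, Set.indicator_of_mem hz, Pi.one_apply, one_mul]
      exact lintegral_fibreDensity hm i z
    · simp only [H, Set.indicator_of_notMem hz, zero_mul, lintegral_zero, mul_zero]
  simp only [hz]
  rw [lintegral_const_mul _ ((continuous_gramDet_chartFS i).measurable.ennreal_ofReal.indicator
    (measurableSet_chart_preimage hU i)), lintegral_indicator (measurableSet_chart_preimage hU i),
    chartVol_eq, withDensity_apply _ (measurableSet_chart_preimage hU i)]

/-! ### The expected current of integration -/

variable {m N ℓ k : ℕ}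

theorem norm_realFrame (e : Fin k → V m) {C : ℝ} (he : ∀ j, ‖e j‖ = C) (j : Fin (2 * k)) :
    ‖realFrame e j‖ = C := by
  rw [realFrame, norm_smul, norm_pow, Complex.norm_I, one_pow, one_mul, he]

/-- The coefficient of a test form on a tangent space is bounded. -/
theorem exists_norm_density_le (φ : TestForm m k) :
    ∃ C : ℝ, 0 ≤ C ∧ ∀ (Z : Set (CP m)) (p : CP m), ‖density Z φ.form p‖ ≤ C := by
  have hcont : ContinuousOn φ.toFun (Metric.sphere (0 : V m) 1) :=
    φ.smooth.continuousOn.mono fun w hw => by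
      rintro rfl
      simp at hw
  obtain ⟨K, hK⟩ := (isCompact_sphere (0 : V m) 1).exists_bound_of_continuousOn hcont
  refine ⟨|K| * √Real.pi ^ (2 * k), by positivity, fun Z p => ?_⟩
  rw [density]
  split_ifs with h
  · have hw : 0 < ‖p.rep‖ := norm_pos_iff.mpr p.rep_ne_zero
    -- By invariance the representative may be normalized to the unit sphere, where compactness
    -- bounds the form; the frame vectors then have length `√π`.
    set c : ℂ := ((‖p.rep‖⁻¹ : ℝ) : ℂ) with hc
    have hc0 : c ≠ 0 := by
      rw [hc]; exact_mod_cast (inv_pos.mpr hw).ne'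
    have hcn : ‖c‖ = ‖p.rep‖⁻¹ := by rw [hc, Complex.norm_real, norm_inv, norm_norm]
    have hs : c • p.rep ∈ Metric.sphere (0 : V m) 1 := by
      rw [mem_sphere_zero_iff_norm, norm_smul, hcn, inv_mul_cancel₀ hw.ne']
    set v := realFrame fun j => ((√Real.pi * ‖p.rep‖ : ℝ) : ℂ) • h.choose j with hv
    have hvn : ∀ j, ‖v j‖ = √Real.pi * ‖p.rep‖ := norm_realFrame _ fun j => by
      rw [norm_smul, h.choose_spec.1.1 j, mul_one, Complex.norm_real, Real.norm_of_nonneg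
        (by positivity)]
    have hinv : φ.form p.rep v = φ.toFun (c • p.rep) fun j => c • v j :=
      (φ.invariant p.rep p.rep_ne_zero c hc0 v).symm
    rw [hinv]
    refine (ContinuousAlternatingMap.le_opNorm _ _).trans ?_
    have hprod : ∏ j, ‖c • v j‖ = √Real.pi ^ (2 * k) := by
      have : ∀ j, ‖c • v j‖ = √Real.pi := fun j => by
        rw [norm_smul, hcn, hvn]
        field_simp
      simp [this]
    rw [hprod]
    exact mul_le_mul_of_nonneg_right ((hK _ hs).trans (le_abs_self K)) (by positivity)
  · simp only [norm_zero]
    positivity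

/-- The integrand of the current of integration over the zero set, multiplied by the coarea
factor. -/
def wedgeDensity (hm : ℓ + k = m) (i : Fin (m + 1)) (φ : TestForm m k)
    (x : (Fin ℓ → RestIndex m N i → ℂ) × (Fin m → ℂ)) : ℂ :=
  wedgeAt (two_mul_add hm) (levelForm (vertDeriv (chartFamily ℓ i) x)) (chartPull i φ.form x.2)
    (stdFrame m)

theorem continuous_chartPull (i : Fin (m + 1)) (φ : TestForm m k) (v : Fin (2 * k) → Fin m → ℂ) :
    Continuous fun z => chartPull i φ.form z v := by
  have h : Continuous fun z : Fin m → ℂ => φ.toFun (chartVec i z) :=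
    φ.smooth.continuousOn.comp_continuous (continuous_chartVec i) fun z => chartVec_ne_zero i z
  exact (continuous_eval_const fun j => chartLin i (v j)).comp h

theorem continuous_wedgeDensity (hm : ℓ + k = m) (i : Fin (m + 1)) (φ : TestForm m k) :
    Continuous (wedgeDensity (N := N) (ℓ := ℓ) hm i φ) :=
  continuous_wedgeAt _ (continuous_levelForm (continuous_vertDeriv (contDiff_chartFamily i)))
    (fun v => (continuous_chartPull i φ v).comp continuous_snd) _

theorem wedgeDensity_eq_zero (hm : ℓ + k = m) (i : Fin (m + 1)) (φ : TestForm m k)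
    {x : (Fin ℓ → RestIndex m N i → ℂ) × (Fin m → ℂ)}
    (hx : x ∉ regularSet (chartFamily (N := N) ℓ i)) : wedgeDensity hm i φ x = 0 := by
  rw [wedgeDensity, levelForm_eq_zero hx, wedgeAt_zero_left]
  rfl

/-- Every point of the incidence variety comes from an actual system, so bounds for `density`
transfer to `fibreIntegrand`. -/
theorem exists_coeff (i : Fin (m + 1)) (b : Fin ℓ → RestIndex m N i → ℂ) (y : Fin ℓ → ℂ) :
    ∃ a : Fin ℓ → MultiIndex m N → ℂ, restCoeff i a = b ∧ (fun l => a l (baseIndex m N i)) = y := by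
  classical
  refine ⟨fun l J => if h : J = baseIndex m N i then y l else b l ⟨J, h⟩, ?_, ?_⟩
  · ext l J
    simp [restCoeff, J.2]
  · ext l
    simp

/-- The function on the incidence variety whose integrals over the fibres are the integrals of
`φ` over the zero sets. -/
def fibreIntegrand (hm : ℓ + k = m) (i : Fin (m + 1)) (φ : TestForm m k)
    (x : (Fin ℓ → RestIndex m N i → ℂ) × (Fin m → ℂ)) : ℂ :=
  (chartPiece i).indicator 1 x.2 *
    (wedgeDensity hm i φ x / (familyFactor hm i (chartFamily ℓ i) x : ℂ))

theorem measurable_fibreIntegrand (hm : ℓ + k = m) (i : Fin (m + 1)) (φ : TestForm m k) :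
    Measurable (fibreIntegrand (N := N) (ℓ := ℓ) hm i φ) :=
  ((measurable_one.indicator (measurableSet_chartPiece i)).comp measurable_snd).mul
    ((continuous_wedgeDensity hm i φ).measurable.div (Complex.continuous_ofReal.comp
      (continuous_familyFactor hm i (contDiff_chartFamily i))).measurable)

theorem density_eq_div (hm : ℓ + k = m) {a : Fin ℓ → MultiIndex m N → ℂ} {i : Fin (m + 1)}
    {z : Fin m → ℂ} (hz : chart i z ∈ coeffZeroSet a)
    (hreg : (restCoeff i a, z) ∈ regularSet (chartFamily (N := N) ℓ i)) (φ : TestForm m k) :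
    density (coeffZeroSet a) φ.form (chart i z) = wedgeDensity hm i φ (restCoeff i a, z) /
      (familyFactor hm i (chartFamily ℓ i) (restCoeff i a, z) : ℂ) := by
  rw [eq_div_iff (by exact_mod_cast (familyFactor_pos hm i hreg).ne')]
  exact density_coeffZeroSet hm hz hreg φ.isBasic

/-- At regular points the quotient is a value of `density`, hence bounded uniformly over all
systems. At other points numerator and denominator both vanish, and the quotient is zero by
convention. -/
theorem exists_norm_fibreIntegrand_le (hm : ℓ + k = m) (i : Fin (m + 1)) (φ : TestForm m k) :
    ∃ C : ℝ, 0 ≤ C ∧ ∀ x : (Fin ℓ → RestIndex m N i → ℂ) × (Fin m → ℂ),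
      ‖fibreIntegrand hm i φ x‖ ≤ (chartPiece i).indicator (fun _ => C) x.2 := by
  obtain ⟨C, hC0, hC⟩ := exists_norm_density_le φ
  refine ⟨C, hC0, fun x => ?_⟩
  by_cases hp : x.2 ∈ chartPiece i
  · rw [fibreIntegrand, Set.indicator_of_mem hp, Set.indicator_of_mem hp, Pi.one_apply, one_mul]
    by_cases hx : x ∈ regularSet (chartFamily (N := N) ℓ i)
    · obtain ⟨a, ha1, ha2⟩ := exists_coeff i x.1 (chartFamily ℓ i x)
      have hz : chart i x.2 ∈ coeffZeroSet a := by
        rw [chart_mem_coeffZeroSet, ha1, ha2]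
      have h := density_eq_div hm hz (by rwa [ha1]) φ
      rw [ha1] at h
      exact h ▸ hC _ _
    · rw [wedgeDensity_eq_zero hm i φ hx]
      simpa using hC0
  · rw [fibreIntegrand, Set.indicator_of_notMem hp, Set.indicator_of_notMem hp]
    simp

theorem fibreWeight_mul_fibreIntegrand (hm : ℓ + k = m) (i : Fin (m + 1)) (φ : TestForm m k)
    (x : (Fin ℓ → RestIndex m N i → ℂ) × (Fin m → ℂ)) :
    ((fibreDensity i x * familyFactor hm i (chartFamily ℓ i) x : ℝ) : ℂ) *
      fibreIntegrand hm i φ x = (chartPiece i).indicator 1 x.2 *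
        ((fibreDensity i x : ℂ) * wedgeDensity hm i φ x) := by
  rw [fibreIntegrand]
  by_cases hx : x ∈ regularSet (chartFamily (N := N) ℓ i)
  · have : (familyFactor hm i (chartFamily ℓ i) x : ℂ) ≠ 0 := by
      exact_mod_cast (familyFactor_pos hm i hx).ne'
    push_cast
    field_simp
  · rw [wedgeDensity_eq_zero hm i φ hx]
    simp

theorem continuous_fibreWeight (hm : ℓ + k = m) (i : Fin (m + 1)) :
    Continuous fun x : (Fin ℓ → RestIndex m N i → ℂ) × (Fin m → ℂ) =>
      fibreDensity i x * familyFactor hm i (chartFamily ℓ i) x :=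
  (continuous_fibreDensity i).mul (continuous_familyFactor hm i (contDiff_chartFamily i))

theorem fibreWeight_nonneg (hm : ℓ + k = m) (i : Fin (m + 1))
    (x : (Fin ℓ → RestIndex m N i → ℂ) × (Fin m → ℂ)) :
    0 ≤ fibreDensity i x * familyFactor hm i (chartFamily ℓ i) x :=
  mul_nonneg (fibreDensity_nonneg i x) (familyFactor_nonneg hm i _ x)

theorem integrableOn_chartPiece {f : (Fin m → ℂ) → ℂ} (hf : Continuous f) (i : Fin (m + 1)) :
    IntegrableOn f (chartPiece i) :=
  (hf.continuousOn.integrableOn_compact (isCompact_closedBall 0 1)).mono_set (chartPiece_subset i)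

/-- The bounded factor is replaced by its bound. The weight then integrates over `b` to a constant
times the Gram determinant, which is continuous on the bounded piece of the chart. -/
theorem integrable_fibreWeight_mul (hm : ℓ + k = m) (i : Fin (m + 1)) (φ : TestForm m k) :
    Integrable (fun x : (Fin ℓ → RestIndex m N i → ℂ) × (Fin m → ℂ) =>
      ((fibreDensity i x * familyFactor hm i (chartFamily ℓ i) x : ℝ) : ℂ) *
        fibreIntegrand hm i φ x) (volume.prod volume) := by
  obtain ⟨C, hC0, hC⟩ := exists_norm_fibreIntegrand_le (N := N) hm i φ
  have hmw := (continuous_fibreWeight (N := N) hm i).measurable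
  refine ⟨((Complex.measurable_ofReal.comp hmw).mul
    (measurable_fibreIntegrand hm i φ)).aestronglyMeasurable, ?_⟩
  let G (x : (Fin ℓ → RestIndex m N i → ℂ) × (Fin m → ℂ)) : ℝ≥0∞ :=
    (chartPiece i).indicator (fun _ => ENNReal.ofReal C) x.2 *
      (ENNReal.ofReal (fibreDensity i x) *
        ENNReal.ofReal (familyFactor hm i (chartFamily ℓ i) x))
  have hG : Measurable G :=
    ((measurable_const.indicator (measurableSet_chartPiece i)).comp measurable_snd).mul
      ((continuous_fibreDensity i).measurable.ennreal_ofReal.mul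
        (continuous_familyFactor hm i (contDiff_chartFamily i)).measurable.ennreal_ofReal)
  have hle : ∀ x : (Fin ℓ → RestIndex m N i → ℂ) × (Fin m → ℂ),
      ‖((fibreDensity i x * familyFactor hm i (chartFamily ℓ i) x : ℝ) : ℂ) *
        fibreIntegrand hm i φ x‖ₑ ≤ G x := by
    intro x
    have h1 : ‖fibreIntegrand hm i φ x‖ₑ ≤
        (chartPiece i).indicator (fun _ => ENNReal.ofReal C) x.2 := by
      rw [← ofReal_norm]
      refine (ENNReal.ofReal_le_ofReal (hC x)).trans (le_of_eq ?_)
      by_cases hp : x.2 ∈ chartPiece i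
      · simp [hp]
      · simp [hp]
    rw [enorm_mul, mul_comm, ← ofReal_norm (((_ : ℝ) : ℂ)), Complex.norm_real,
      Real.norm_of_nonneg (fibreWeight_nonneg hm i x), ENNReal.ofReal_mul (fibreDensity_nonneg i x)]
    exact mul_le_mul_left h1 _
  refine (lintegral_mono hle).trans_lt ?_
  rw [lintegral_prod_symm _ hG.aemeasurable]
  have hz : ∀ z : Fin m → ℂ, ∫⁻ b : Fin ℓ → RestIndex m N i → ℂ, G (b, z) =
      (chartPiece i).indicator (fun z => ENNReal.ofReal C *
        ((m.factorial : ℝ≥0∞) / (k.factorial : ℝ≥0∞) * (N : ℝ≥0∞) ^ ℓ *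
          ENNReal.ofReal (gramDet (chartFS i z)))) z := by
    intro z
    by_cases hp : z ∈ chartPiece i
    · simp only [G, Set.indicator_of_mem hp]
      rw [lintegral_const_mul' _ _ ENNReal.ofReal_ne_top, lintegral_fibreDensity hm i z]
    · simp only [G, Set.indicator_of_notMem hp, zero_mul, lintegral_zero]
  simp only [hz]
  rw [lintegral_indicator (measurableSet_chartPiece i),
    lintegral_const_mul' _ _ ENNReal.ofReal_ne_top, lintegral_const_mul']
  · refine ENNReal.mul_lt_top ENNReal.ofReal_lt_top (ENNReal.mul_lt_top ?_ ?_)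
    · refine ENNReal.mul_lt_top (ENNReal.div_lt_top (ENNReal.natCast_ne_top _) ?_)
        (ENNReal.pow_lt_top (ENNReal.natCast_lt_top _))
      exact_mod_cast k.factorial_ne_zero
    · have h := (integrableOn_chartPiece (Complex.continuous_ofReal.comp
        (continuous_gramDet_chartFS i)) i).re
      exact Integrable.lintegral_lt_top h
  · refine ENNReal.mul_ne_top (ENNReal.div_lt_top (ENNReal.natCast_ne_top _) ?_).ne
      (ENNReal.pow_lt_top (ENNReal.natCast_lt_top _)).ne
    exact_mod_cast k.factorial_ne_zero

theorem chartPull_wedge_fubiniStudy (hm : ℓ + k = m) (h : 2 * ℓ + 2 * k = 2 * m) (i : Fin (m + 1))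
    (φ : TestForm m k) (z : Fin m → ℂ) :
    chartPull i (wedge h (wedgePow (fubiniStudy m) ℓ) φ.form) z =
      wedgeAt (two_mul_add hm) (wedgeProd ℓ fun _ => hform (chartFS i z).toLinearMap)
        (chartPull i φ.form z) := by
  rw [chartPull, wedge, wedgeAt_compLinearMap, wedgePow_eq_wedgeProd, wedgeProd_compLinearMap,
    fubiniStudy_eq_hform (chartVec_ne_zero i z)]
  rfl

/-- The expected integral of a test form over the part of the zero set in the `i`-th piece. -/
theorem integral_fibreIntegrand (hℓ : 1 ≤ ℓ) (hm : ℓ + k = m) (i : Fin (m + 1))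
    (φ : TestForm m k) :
    (∀ᵐ a ∂(coeffLaw m N ℓ), IntegrableOn (fun z => fibreIntegrand hm i φ (restCoeff i a, z))
      {z | chart i z ∈ coeffZeroSet a} (chartVol k i)) ∧
    Integrable (fun a => ∫ z in {z | chart i z ∈ coeffZeroSet a},
      fibreIntegrand hm i φ (restCoeff i a, z) ∂(chartVol k i)) (coeffLaw m N ℓ) ∧
    ∫ a, (∫ z in {z | chart i z ∈ coeffZeroSet a},
      fibreIntegrand hm i φ (restCoeff i a, z) ∂(chartVol k i)) ∂(coeffLaw m N ℓ) =
      (N : ℂ) ^ ℓ * ∫ z in chartPiece i, wedgeAt (two_mul_add hm)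
        (wedgeProd ℓ fun _ => hform (chartFS i z).toLinearMap) (chartPull i φ.form z)
          (stdFrame m) := by
  -- The volume of the zero set of `a`, placed on its slice of the incidence variety. Disintegration
  -- compares these measures with the weighted measure `M`.
  let κ (a : Fin ℓ → MultiIndex m N → ℂ) : Measure ((Fin ℓ → RestIndex m N i → ℂ) × (Fin m → ℂ)) :=
    ((chartVol k i).restrict {z | chart i z ∈ coeffZeroSet a}).map fun z => (restCoeff i a, z)
  let M : Measure ((Fin ℓ → RestIndex m N i → ℂ) × (Fin m → ℂ)) :=
    (volume.prod volume).withDensity fun x =>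
      ENNReal.ofReal (fibreDensity i x * familyFactor hm i (chartFamily ℓ i) x)
  have hmw := (continuous_fibreWeight (N := N) (ℓ := ℓ) hm i).measurable
  have hf := measurable_fibreIntegrand (N := N) (ℓ := ℓ) hm i φ
  have hpair : ∀ b : Fin ℓ → RestIndex m N i → ℂ, Measurable fun z : Fin m → ℂ => (b, z) :=
    fun b => measurable_const.prodMk measurable_id
  have hdis : ∀ H : (Fin ℓ → RestIndex m N i → ℂ) × (Fin m → ℂ) → ℝ≥0∞, Measurable H →
      AEMeasurable (fun a => ∫⁻ x, H x ∂(κ a)) (coeffLaw m N ℓ) ∧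
      ∫⁻ a, ∫⁻ x, H x ∂(κ a) ∂(coeffLaw m N ℓ) = ∫⁻ x, H x ∂M := by
    intro H hH
    simp only [κ, M, lintegral_map hH (hpair _)]
    obtain ⟨h1, h2⟩ := lintegral_coeffLaw hℓ hm i hH
    refine ⟨h1, h2.trans ?_⟩
    rw [lintegral_withDensity_eq_lintegral_mul _ hmw.ennreal_ofReal hH]
    refine lintegral_congr fun x => ?_
    rw [Pi.mul_apply, ENNReal.ofReal_mul (fibreDensity_nonneg i x), mul_comm]
  have hint := integrable_fibreWeight_mul (N := N) hm i φ
  have hiM : Integrable (fibreIntegrand (N := N) hm i φ) M :=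
    (integrable_withDensity_ofReal hmw (fibreWeight_nonneg hm i)).mpr hint
  obtain ⟨d1, d2, d3⟩ := integral_disintegration hdis hf hiM
  have hκ : ∀ a, ∫ x, fibreIntegrand hm i φ x ∂(κ a) = ∫ z in {z | chart i z ∈ coeffZeroSet a},
      fibreIntegrand hm i φ (restCoeff i a, z) ∂(chartVol k i) := fun a =>
    integral_map (hpair _).aemeasurable hf.aestronglyMeasurable
  simp only [hκ] at d2 d3
  refine ⟨?_, d2, d3.trans ?_⟩
  · filter_upwards [d1] with a ha
    exact (integrable_map_measure hf.aestronglyMeasurable (hpair _).aemeasurable).mp ha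
  · rw [integral_withDensity_ofReal hmw (fibreWeight_nonneg hm i), integral_prod_symm _ hint,
      ← integral_const_mul, ← integral_indicator (measurableSet_chartPiece i)]
    refine integral_congr_ae (Filter.Eventually.of_forall fun z => ?_)
    simp only [fibreWeight_mul_fibreIntegrand]
    rw [integral_const_mul]
    by_cases hp : z ∈ chartPiece i
    · rw [Set.indicator_of_mem hp, Set.indicator_of_mem hp, Pi.one_apply, one_mul]
      exact (integral_fibreDensity_wedge hm i z (chartPull i φ.form z)).2
    · rw [Set.indicator_of_notMem hp, Set.indicator_of_notMem hp, zero_mul]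

/-- The volume density in the chart is the Gram determinant, which turns `density` into the
pulled-back form on the standard frame. -/
theorem integrate_univ_wedge (hm : ℓ + k = m) (h : 2 * ℓ + 2 * k = 2 * m) (φ : TestForm m k) :
    integrate (k := m) Set.univ (wedge h (wedgePow (fubiniStudy m) ℓ) φ.form) =
      ∑ i, ∫ z in chartPiece i, wedgeAt (two_mul_add hm)
        (wedgeProd ℓ fun _ => hform (chartFS i z).toLinearMap) (chartPull i φ.form z)
          (stdFrame m) := by
  set ψ := wedge h (wedgePow (fubiniStudy m) ℓ) φ.form with hψ
  have hb : IsBasic ψ :=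
    IsBasic.wedge h (isBasic_wedgePow (isBasic_fubiniStudy m) ℓ) φ.isBasic
  have hd : ∀ (i : Fin (m + 1)) (z : Fin m → ℂ), (gramDet (chartFS i z) : ℂ) *
      density Set.univ ψ (chart i z) = wedgeAt (two_mul_add hm)
        (wedgeProd ℓ fun _ => hform (chartFS i z).toLinearMap) (chartPull i φ.form z)
          (stdFrame m) := fun i z => by
    rw [mul_comm, density_univ_mul i z hb, hψ, chartPull_wedge_fubiniStudy hm]
  have hcont : ∀ i : Fin (m + 1), Continuous fun z => wedgeAt (two_mul_add hm)
      (wedgeProd ℓ fun _ => hform (chartFS i z).toLinearMap) (chartPull i φ.form z)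
        (stdFrame m) := fun i =>
    continuous_wedgeAt _ (fun v => continuous_wedgeProd ℓ _
      (fun _ v => continuous_hform (continuous_chartFS i) v) v) (continuous_chartPull i φ) _
  have hg := fun i : Fin (m + 1) => (continuous_gramDet_chartFS (m := m) i).measurable
  have hres : ∀ i : Fin (m + 1), (chartVol m i).restrict (chartPiece i) =
      (volume.restrict (chartPiece i)).withDensity
        fun z => ENNReal.ofReal (gramDet (chartFS i z)) := fun i => by
    rw [chartVol_eq, restrict_withDensity (measurableSet_chartPiece i)]
  rw [integrate, integral_vol_eq_sum MeasurableSet.univ]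
  · simp only [Set.preimage_univ, Set.univ_inter]
    refine Finset.sum_congr rfl fun i _ => ?_
    rw [hres, integral_withDensity_ofReal (hg i) fun z => (gramDet_chartFS_pos i z).le]
    simp only [hd]
  · intro i
    rw [Set.preimage_univ, Set.univ_inter, IntegrableOn, hres,
      integrable_withDensity_ofReal (hg i) fun z => (gramDet_chartFS_pos i z).le]
    simp only [hd]
    exact integrableOn_chartPiece (hcont i) i

/-- The expected current of integration over the random zero set. -/
theorem integral_integrate_coeffZeroSet (hℓ : 1 ≤ ℓ) (hm : ℓ + k = m)
    (h : 2 * ℓ + 2 * k = 2 * m) (φ : TestForm m k) :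
    Integrable (fun a => integrate (coeffZeroSet a) φ.form) (coeffLaw m N ℓ) ∧
    ∫ a, integrate (coeffZeroSet a) φ.form ∂(coeffLaw m N ℓ) =
      (N : ℂ) ^ ℓ * integrate (k := m) Set.univ
        (wedge h (wedgePow (fubiniStudy m) ℓ) φ.form) := by
  have hE := fun i => integral_fibreIntegrand (N := N) hℓ hm i φ
  have hae : (fun a => integrate (coeffZeroSet a) φ.form) =ᵐ[coeffLaw m N ℓ] fun a =>
      ∑ i, ∫ z in {z | chart i z ∈ coeffZeroSet a},
        fibreIntegrand hm i φ (restCoeff i a, z) ∂(chartVol k i) := by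
    filter_upwards [ae_isRegular_coeffLaw hℓ, ae_all_iff.mpr fun i => (hE i).1] with a ha hi
    have hpt : ∀ (i : Fin (m + 1)) (z : Fin m → ℂ),
        z ∈ chart i ⁻¹' coeffZeroSet a ∩ chartPiece i →
        density (coeffZeroSet a) φ.form (chart i z) =
          fibreIntegrand hm i φ (restCoeff i a, z) := fun i z hz => by
      rw [density_eq_div hm hz.1 (ha i z hz.1), fibreIntegrand, Set.indicator_of_mem hz.2,
        Pi.one_apply, one_mul]
    have hms := fun i : Fin (m + 1) =>
      measurableSet_chart_preimage (measurableSet_coeffZeroSet a) i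
    rw [integrate, integral_vol_eq_sum (measurableSet_coeffZeroSet a)]
    · refine Finset.sum_congr rfl fun i _ => ?_
      rw [setIntegral_congr_fun (hms i) (hpt i)]
      -- `fibreIntegrand` carries the indicator of the piece, so integrating over the full zero set
      -- in the chart changes nothing.
      refine (setIntegral_eq_of_subset_of_forall_sdiff_eq_zero (measurableSet_chart_mem a i)
        Set.inter_subset_left fun z hz => ?_).symm
      have hz' : z ∉ chartPiece i := fun hp => hz.2 ⟨hz.1, hp⟩
      rw [fibreIntegrand, Set.indicator_of_notMem hz', zero_mul]
    · intro i
      exact ((hi i).mono_set Set.inter_subset_left).congr_fun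
        (fun z hz => (hpt i z hz).symm) (hms i)
  refine ⟨(integrable_finsetSum _ fun i _ => (hE i).2.1).congr hae.symm, ?_⟩
  rw [integral_congr_ae hae, integral_finsetSum _ fun i _ => (hE i).2.1,
    integrate_univ_wedge hm h φ, Finset.mul_sum]
  exact Finset.sum_congr rfl fun i _ => (hE i).2.2

end SUPoly

end

theorem proposition4p5 {m ℓ N : ℕ} (hℓ : 1 ≤ ℓ) (hℓm : ℓ ≤ m)
    {Ω : Type*} [MeasurableSpace Ω] (μ : Measure Ω) [IsProbabilityMeasure μ]
    (a : Fin ℓ → SUPoly.MultiIndex m N → Ω → ℂ)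
    (ha_indep : iIndepFun (fun p : Fin ℓ × SUPoly.MultiIndex m N => a p.1 p.2) μ)
    (ha_law : ∀ i J, HasLaw (a i J) SUPoly.complexGaussian μ) :
    (∀ φ : SUPoly.TestForm m (m - ℓ),
      Integrable (fun x => SUPoly.integrate (SUPoly.randomZeroSet a x) φ.form) μ ∧
      ∫ x, SUPoly.integrate (SUPoly.randomZeroSet a x) φ.form ∂μ =
        (N : ℂ) ^ ℓ * SUPoly.integrate (k := m) Set.univ
          (SUPoly.wedge (by omega) (SUPoly.wedgePow (SUPoly.fubiniStudy m) ℓ) φ.form)) ∧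
    (∀ U : Set (SUPoly.CP m), IsOpen U →
      AEMeasurable (fun x => SUPoly.vol m (2 * m - 2 * ℓ) (U ∩ SUPoly.randomZeroSet a x)) μ ∧
      ∫⁻ x, SUPoly.vol m (2 * m - 2 * ℓ) (U ∩ SUPoly.randomZeroSet a x) ∂μ =
        ((m.factorial : ℝ≥0∞) / ((m - ℓ).factorial : ℝ≥0∞)) * (N : ℝ≥0∞) ^ ℓ *
          SUPoly.vol m (2 * m) U) := by
  have hm : ℓ + (m - ℓ) = m := by omega
  have hX : AEMeasurable (fun x l J => a l J x) μ :=
    aemeasurable_pi_lambda _ fun l => aemeasurable_pi_lambda _ fun J =>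
      (ha_law l J).aemeasurable
  have hlaw := SUPoly.map_coeff ha_indep ha_law
  refine ⟨fun φ => ?_, fun U hU => ?_⟩
  · obtain ⟨h1, h2⟩ := SUPoly.integral_integrate_coeffZeroSet (N := N) hℓ hm (by omega) φ
    rw [← hlaw] at h1 h2
    rw [integral_map hX h1.aestronglyMeasurable] at h2
    exact ⟨h1.comp_aemeasurable hX, h2⟩
  · obtain ⟨h1, h2⟩ := SUPoly.lintegral_vol_coeffZeroSet (N := N) hℓ hm hU.measurableSet
    rw [← hlaw] at h1 h2
    rw [lintegral_map' h1 hX] at h2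
    -- Matches the dimension `2m - 2ℓ` of the statement with `2(m - ℓ)`.
    rw [← Nat.mul_sub]
    exact ⟨h1.comp_aemeasurable hX, h2⟩
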